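/- Let $R,R_0,T_0>0$ with $R_0<R/\sqrt2$, let $T\ge T_0+R+R_0$, and put $\Gamma_R=\{x\in\mathbb R^3:|x|=R\}$. Let $h\in L^1(\mathbb R)$ be a real function that vanishes outside $(-R_0,R_0)$ and does not vanish almost everywhere. For $j=1,2$ let $\tilde f_j\in L^1(\mathbb R^2\times\mathbb R)$ be a real function that vanishes outside $\{\tilde x\in\mathbb R^2:|\tilde x|<R_0\}\times[0,T_0]$, and let $u_j\in L^1_{\mathrm{loc}}(\mathbb R^3\times[0,\infty))$ be the weak solution of $$\partial_t^2u_j(x,t)-\Delta u_j(x,t)=\tilde f_j(x_1,x_2,t)\,h(x_3)\ \text{ in }\mathbb R^3\times(0,\infty),\qquad u_j(x,0)=\partial_tu_j(x,0)=0\ \text{ in }\mathbb R^3,$$ that is, $$\int_0^\infty\!\!\int_{\mathbb R^3}u_j\,(\partial_t^2\varphi-\Delta\varphi)\,dx\,dt=\int_0^\infty\!\!\int_{\mathbb R^3}\tilde f_j(x_1,x_2,t)\,h(x_3)\,\varphi(x,t)\,dx\,dt\qquad\text{for all }\varphi\in C_c^\infty(\mathbb R^3\times\mathbb R).$$ If $u_1=u_2$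 on $\Gamma_R\times(0,T)$, then $\tilde f_1=\tilde f_2$ almost everywhere. Thus, for known $h$, the data $\{u(x,t):x\in\Gamma_R,\ t\in(0,T)\}$ determine $\tilde f$ uniquely. Here the values of $u_j$ on $\Gamma_R\times(0,T)$ are understood as traces: a measurable function $g$ on $\Gamma_R\times(0,T)$ is the trace of $u$ if $$\lim_{\varepsilon\downarrow0}\ \frac1\varepsilon\int_0^T\!\!\int_{\{||x|-R|<\varepsilon\}}\bigl|u(x,t)-g(Rx/|x|,t)\bigr|\,dx\,dt=0.$$ -/

import Mathlib

open Set Filter Topology MeasureTheory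
open scoped ContDiff

noncomputable section

/-- The wave operator `∂ₜ²φ - Δₓφ` on `ℝ³ × ℝ`, evaluated at `p = (x, t)`. -/
def waveOperator (φ : EuclideanSpace ℝ (Fin 3) × ℝ → ℝ) (p : EuclideanSpace ℝ (Fin 3) × ℝ) : ℝ :=
  iteratedDeriv 2 (fun s : ℝ => φ (p.1, s)) p.2
    - Laplacian.laplacian (fun y : EuclideanSpace ℝ (Fin 3) => φ (y, p.2)) p.1

/-- `u` is a weak solution of `∂ₜ²u - Δu = F` in `ℝ³ × (0, ∞)`, `u(·, 0) = ∂ₜu(·, 0) = 0`.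
The test functions need not vanish near `t = 0`: integrating by parts over `t > 0`, the terms at
`t = 0` are `-∫ u(x, 0) ∂ₜφ(x, 0) dx` and `∫ ∂ₜu(x, 0) φ(x, 0) dx`, so that the identity contains
the homogeneous initial conditions. -/
def IsWeakWaveSolution (F u : EuclideanSpace ℝ (Fin 3) × ℝ → ℝ) : Prop :=
  LocallyIntegrableOn u (univ ×ˢ Ici (0 : ℝ)) ∧
    ∀ φ : EuclideanSpace ℝ (Fin 3) × ℝ → ℝ, ContDiff ℝ ∞ φ → HasCompactSupport φ →
      ∫ p in univ ×ˢ Ioi (0 : ℝ), u p * waveOperator φ p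
        = ∫ p in univ ×ˢ Ioi (0 : ℝ), F p * φ p

/-- `g` is the trace of `u` on `Γ_R × (0, T)`, `Γ_R = {|x| = R}`, in the `L¹` sense: the average
of `|u(x, t) - g(R x / |x|, t)|` over the shell `| |x| - R | < ε`, `0 < t < T`, tends to `0` as
`ε → 0` (the volume of the shell is of order `ε`). Only the values of `g` on `Γ_R × (0, T)`
matter. -/
def HasSphereTrace (R T : ℝ) (u g : EuclideanSpace ℝ (Fin 3) × ℝ → ℝ) : Prop :=
  Measurable g ∧
    Tendsto
      (fun ε : ℝ => (ENNReal.ofReal ε)⁻¹ *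
        ∫⁻ p in {p : EuclideanSpace ℝ (Fin 3) × ℝ | |‖p.1‖ - R| < ε ∧ p.2 ∈ Ioo 0 T},
          ‖u p - g ((R / ‖p.1‖) • p.1, p.2)‖ₑ)
      (𝓝[>] 0) (𝓝 0)

/-- The source `F(x, t) = f(x₁, x₂, t) h(x₃)`. -/
def separatedSource (f : EuclideanSpace ℝ (Fin 2) × ℝ → ℝ) (h : ℝ → ℝ)
    (p : EuclideanSpace ℝ (Fin 3) × ℝ) : ℝ :=
  f (!₂[p.1 0, p.1 1], p.2) * h (p.1 2)

end

/-! Let `f = f₁ - f₂`, `u = u₁ - u₂` and `F(x, t) = f(x₁, x₂, t) h(x₃)`; then `u` has zero trace on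
the sphere. Let `ψ` be smooth and zero on `[c, ∞)`. Smoothing the retarded potential in time gives
`v(x, t) = ∫ F(y, s) ψ(|x - y| - t + s) / |x - y|`, modified near the source. Outside the ball `v`
is a smooth solution of the homogeneous wave equation that vanishes early, and on the sphere at time
`t` it depends only on `u` before `t + c`. Hence `v = 0` on the sphere for `t < T - c`
(`integral_mul_conv_sphericalWave`, `conv_sphericalWave_eq_zero_on_sphere`).

If `c < T - R`, uniqueness for the exterior Dirichlet problem (`exterior_eq_zero`) gives `v(rν, r) =
0` for all `r > R` and `|ν| = 1`. The limit of `r v(rν, r)` as `r → ∞` is the far field `∫ F ψ(t -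
ν·x)`, so `F` is orthogonal to these plane waves (`integral_mul_plane_wave_eq_zero`). Since `T - R ≥
T₀ + R₀`, every `c < T₀ + R₀` is admissible.

It remains to remove `h`, whose Fourier transform may have zeros. Tilt a horizontal unit vector `ν`
to `((1 - q)ν, z)` with `(1 - q)² + z² = 1`, and put `a = ν·y`, `σ = τ - a`; the phase becomes `σ +
q a - z s`. On the circle near the horizontal direction `z ~ 2t` and `q ~ 2t²`, so each factor `s`
costs one power of `t` and each factor `a` two. Let `k` be the order of the first nonzero moment of
`h`. If the moments of `f` with `aⁱ`, `i < j`, vanish, the lowest surviving term in the Taylor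
expansion has order `t^(2j+k)`, and its coefficient is a nonzero multiple of `∫ f aʲ ψ^(j+k)(σ)`.
Induction on `j` gives `∫ f aʲ χ(σ) = 0` for all smooth `χ` (`integral_mul_pow_mul_comp_eq_zero`).
Summing the exponential series in `a` shows that the Fourier transform of `f` vanishes. -/

open scoped Pointwise

/-! ### The wave operator in terms of directional derivatives -/

/-- The coordinate directions of `ℝ³` inside `ℝ³ × ℝ`. -/
noncomputable def spaceDir (i : Fin 3) : EuclideanSpace ℝ (Fin 3) × ℝ :=
  (EuclideanSpace.basisFun (Fin 3) ℝ i, 0)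

/-- The iterated directional derivative `∂_w ∂_w g`. -/
noncomputable def secondDeriv {V : Type*} [NormedAddCommGroup V] [NormedSpace ℝ V]
    (w : V) (g : V → ℝ) (p : V) : ℝ :=
  fderiv ℝ (fun p => fderiv ℝ g p w) p w

/-- Directional derivatives on the product space pass through convolutions, reflections and local
equalities, which the slicewise definition does not make visible. -/
theorem waveOperator_eq {g : EuclideanSpace ℝ (Fin 3) × ℝ → ℝ} (hg : ContDiff ℝ ∞ g)
    (p : EuclideanSpace ℝ (Fin 3) × ℝ) :
    waveOperator g p = secondDeriv (0, 1) g p - ∑ i, secondDeriv (spaceDir i) g p := by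
  have hd : Differentiable ℝ g := hg.differentiable (by simp)
  have hdd : ∀ w, Differentiable ℝ (fun p => fderiv ℝ g p w) := fun w =>
    (show ContDiff ℝ ∞ (fun p => fderiv ℝ g p w) by fun_prop).differentiable (by simp)
  unfold waveOperator
  congr 1
  · rw [iteratedDeriv_succ, iteratedDeriv_one]
    have h1 : ∀ (G : EuclideanSpace ℝ (Fin 3) × ℝ → ℝ), Differentiable ℝ G →
        ∀ (x : EuclideanSpace ℝ (Fin 3)) (t : ℝ),
        deriv (fun s : ℝ => G (x, s)) t = fderiv ℝ G (x, t) (0, 1) := by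
      intro G hG x t
      have := (hG (x, t)).hasFDerivAt.comp_hasDerivAt t
        ((hasDerivAt_const t x).prodMk (hasDerivAt_id t))
      exact this.deriv
    have h2 : deriv (fun s : ℝ => g (p.1, s)) = fun s => fderiv ℝ g (p.1, s) (0, 1) :=
      funext fun s => h1 g hd p.1 s
    rw [h2]
    exact h1 _ (hdd (0, 1)) p.1 p.2
  · rw [InnerProductSpace.laplacian_eq_iteratedFDeriv_orthonormalBasis _
      (EuclideanSpace.basisFun (Fin 3) ℝ)]
    refine Finset.sum_congr rfl fun i _ => ?_
    rw [iteratedFDeriv_two_apply]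
    have h1 : ∀ (G : EuclideanSpace ℝ (Fin 3) × ℝ → ℝ), Differentiable ℝ G →
        ∀ (x w : EuclideanSpace ℝ (Fin 3)) (t : ℝ),
        fderiv ℝ (fun y => G (y, t)) x w = fderiv ℝ G (x, t) (w, 0) := by
      intro G hG x w t
      have hin : HasFDerivAt (fun y : EuclideanSpace ℝ (Fin 3) => (y, t))
          ((ContinuousLinearMap.id ℝ _).prod 0) x :=
        (hasFDerivAt_id x).prodMk (hasFDerivAt_const t x)
      have h := ((hG (x, t)).hasFDerivAt.comp x hin).fderiv
      simp only [Function.comp_def] at h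
      rw [h]; simp
    have hs : ContDiff ℝ ∞ (fun y => g (y, p.2)) := by fun_prop
    have hsd : Differentiable ℝ (fderiv ℝ (fun y => g (y, p.2))) :=
      (show ContDiff ℝ ∞ (fderiv ℝ (fun y => g (y, p.2))) by fun_prop).differentiable (by simp)
    simp only [Matrix.cons_val_zero, Matrix.cons_val_one]
    set e := EuclideanSpace.basisFun (Fin 3) ℝ i with he
    have h3 : fderiv ℝ (fderiv ℝ (fun y => g (y, p.2))) p.1 e e
        = fderiv ℝ (fun y => fderiv ℝ (fun y => g (y, p.2)) y e) p.1 e := by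
      rw [fderiv_clm_apply (hsd _) (differentiableAt_const _)]
      simp
    rw [h3]
    have h4 : (fun y => fderiv ℝ (fun y => g (y, p.2)) y e)
        = fun y => fderiv ℝ g (y, p.2) (e, 0) := funext fun y => h1 g hd y e p.2
    rw [h4]
    exact h1 _ (hdd (e, 0)) p.1 e p.2

/-! ### Convolution of an integrable source with a smooth kernel -/

theorem exists_bound_on_differences {V G : Type*} [NormedAddCommGroup V] [NormedAddCommGroup G] {K : V → G}
    (hK : Continuous K) {C D : Set V} (hC : IsCompact C) (hD : IsCompact D) :
    ∃ B, ∀ p ∈ D, ∀ q ∈ C, ‖K (p - q)‖ ≤ B := by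
  obtain ⟨B, hB⟩ := (hD.prod hC).exists_bound_of_continuousOn
    (f := fun z : V × V => K (z.1 - z.2)) (by fun_prop)
  exact ⟨B, fun p hp q hq => hB (p, q) ⟨hp, hq⟩⟩

theorem norm_mul_le_of_support {V G : Type*} [NormedAddCommGroup G] [NormedSpace ℝ G] {F : V → ℝ} {C : Set V}
    (hF : Function.support F ⊆ C) {K : V → G} {B : ℝ} (hB : ∀ q ∈ C, ‖K q‖ ≤ B) (q : V) :
    ‖F q • K q‖ ≤ ‖F q‖ * B := by
  by_cases hq : q ∈ C
  · rw [norm_smul]; gcongr; exact hB q hq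
  · have : F q = 0 := by_contra fun h => hq (hF h)
    simp [this]

theorem secondDeriv_contDiff {V : Type*} [NormedAddCommGroup V] [NormedSpace ℝ V]
    {K : V → ℝ} (hK : ContDiff ℝ ∞ K) (w : V) : ContDiff ℝ ∞ (secondDeriv w K) := by
  unfold secondDeriv; fun_prop

section Convolution

variable {V : Type*} [NormedAddCommGroup V] [NormedSpace ℝ V] [FiniteDimensional ℝ V]
  [MeasurableSpace V] [BorelSpace V]

/-- The convolution of a compactly supported integrable function with a continuous one. -/
noncomputable def conv (μ : Measure V) (F K : V → ℝ) (p : V) : ℝ := ∫ q, F q * K (p - q) ∂μ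

variable {μ : Measure V} {F K : V → ℝ}

theorem conv_integrable {G : Type*} [NormedAddCommGroup G] [NormedSpace ℝ G]
    (hF : Integrable F μ) {C : Set V} (hC : IsCompact C)
    (hFC : Function.support F ⊆ C) {K : V → G} (hK : Continuous K) (p : V) :
    Integrable (fun q => F q • K (p - q)) μ := by
  obtain ⟨B, hB⟩ := exists_bound_on_differences hK hC (isCompact_singleton (x := p))
  refine (hF.norm.mul_const B).mono' ?_ (ae_of_all _ fun q => ?_)
  · exact hF.aestronglyMeasurable.smul (by fun_prop : Continuous fun q => K (p - q)).aestronglyMeasurable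
  · exact norm_mul_le_of_support hFC (K := fun q => K (p - q)) (hB p rfl) q

theorem conv_hasFDerivAt (hF : Integrable F μ) {C : Set V} (hC : IsCompact C)
    (hFC : Function.support F ⊆ C) (hK : ContDiff ℝ 1 K) (p : V) :
    HasFDerivAt (𝕜 := ℝ) (conv μ F K) (∫ q, F q • fderiv ℝ K (p - q) ∂μ) p := by
  have hK' : Continuous (fderiv ℝ K) := hK.continuous_fderiv (by simp)
  have hd : Differentiable ℝ K := hK.differentiable (by simp)
  obtain ⟨B, hB⟩ := exists_bound_on_differences hK' hC (isCompact_closedBall p 1)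
  refine hasFDerivAt_integral_of_dominated_of_fderiv_le (𝕜 := ℝ)
    (F := fun x q => F q * K (x - q)) (F' := fun x q => F q • fderiv ℝ K (x - q)) (s := Metric.closedBall p 1)
    (bound := fun q => ‖F q‖ * B) (Metric.closedBall_mem_nhds p one_pos)
    (Eventually.of_forall fun x => ?_) ?_ ?_ (ae_of_all _ fun q x hx => ?_) (hF.norm.mul_const B)
    (ae_of_all _ fun q x _ => ?_)
  · exact (conv_integrable hF hC hFC hK.continuous x).aestronglyMeasurable
  · exact conv_integrable hF hC hFC hK.continuous p
  · exact (conv_integrable hF hC hFC hK' p).aestronglyMeasurable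
  · exact norm_mul_le_of_support hFC (K := fun q => fderiv ℝ K (x - q)) (hB x hx) q
  · have h1 : HasFDerivAt (fun x => K (x - q)) (fderiv ℝ K (x - q)) x := by
      have := (hd (x - q)).hasFDerivAt.comp x ((hasFDerivAt_id x).sub_const q)
      rwa [ContinuousLinearMap.comp_id] at this
    exact h1.const_mul (F q)

theorem conv_fderiv_apply (hF : Integrable F μ) {C : Set V} (hC : IsCompact C)
    (hFC : Function.support F ⊆ C) (hK : ContDiff ℝ 1 K) (p w : V) :
    fderiv ℝ (conv μ F K) p w = conv μ F (fun z => fderiv ℝ K z w) p := by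
  rw [(conv_hasFDerivAt hF hC hFC hK p).fderiv,
    ContinuousLinearMap.integral_apply
      (conv_integrable hF hC hFC (hK.continuous_fderiv (by simp)) p)]
  rfl

/-- All derivatives fall on `K`, so integrability of `F` suffices; the induction on the order runs
over all smooth kernels at once. -/
theorem conv_contDiff (hF : Integrable F μ) {C : Set V} (hC : IsCompact C)
    (hFC : Function.support F ⊆ C) (hK : ContDiff ℝ ∞ K) : ContDiff ℝ ∞ (conv μ F K) := by
  have key : ∀ n : ℕ, ∀ K : V → ℝ, ContDiff ℝ ∞ K → ContDiff ℝ n (conv μ F K) := by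
    intro n
    induction n with
    | zero =>
      intro K hK
      simp only [Nat.cast_zero, contDiff_zero]
      exact continuous_iff_continuousAt.2 fun p =>
        (conv_hasFDerivAt hF hC hFC (hK.of_le (by simp)) p).continuousAt
    | succ n ih =>
      intro K hK
      have h1 : ContDiff ℝ 1 K := hK.of_le (by simp)
      push_cast
      rw [contDiff_succ_iff_fderiv_apply]
      refine ⟨fun p => (conv_hasFDerivAt hF hC hFC h1 p).differentiableAt, by simp, fun w => ?_⟩
      have : (fun p => fderiv ℝ (conv μ F K) p w) = conv μ F (fun z => fderiv ℝ K z w) :=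
        funext fun p => conv_fderiv_apply hF hC hFC h1 p w
      rw [this]
      exact ih _ (by fun_prop)
  exact contDiff_infty.2 fun n => key n K hK

theorem conv_secondDeriv (hF : Integrable F μ) {C : Set V} (hC : IsCompact C)
    (hFC : Function.support F ⊆ C) (hK : ContDiff ℝ ∞ K) (w p : V) :
    secondDeriv w (conv μ F K) p = conv μ F (secondDeriv w K) p := by
  have h1 : ContDiff ℝ 1 K := hK.of_le (by simp)
  have : (fun p => fderiv ℝ (conv μ F K) p w) = conv μ F (fun z => fderiv ℝ K z w) :=
    funext fun p => conv_fderiv_apply hF hC hFC h1 p w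
  unfold secondDeriv
  rw [this]
  exact conv_fderiv_apply hF hC hFC ((by fun_prop : ContDiff ℝ ∞ _).of_le (by simp)) p w

end Convolution

theorem waveOperator_contDiff {K : EuclideanSpace ℝ (Fin 3) × ℝ → ℝ} (hK : ContDiff ℝ ∞ K) :
    ContDiff ℝ ∞ (waveOperator K) := by
  rw [funext (waveOperator_eq hK)]
  exact (secondDeriv_contDiff hK _).sub (ContDiff.sum fun i _ => secondDeriv_contDiff hK _)

theorem conv_waveOperator {F K : EuclideanSpace ℝ (Fin 3) × ℝ → ℝ}
    (hF : Integrable F) {C : Set (EuclideanSpace ℝ (Fin 3) × ℝ)} (hC : IsCompact C)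
    (hFC : Function.support F ⊆ C) (hK : ContDiff ℝ ∞ K) (p : EuclideanSpace ℝ (Fin 3) × ℝ) :
    waveOperator (conv volume F K) p = conv volume F (waveOperator K) p := by
  have hi : ∀ w, Integrable (fun q => F q * secondDeriv w K (p - q)) := fun w =>
    conv_integrable hF hC hFC (secondDeriv_contDiff hK w).continuous p
  rw [waveOperator_eq (conv_contDiff hF hC hFC hK)]
  simp only [conv_secondDeriv hF hC hFC hK, conv, waveOperator_eq hK]
  rw [← integral_finsetSum _ fun i _ => hi _, ← integral_sub (hi _)
    (integrable_finsetSum _ fun i _ => hi _)]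
  simp only [mul_sub, Finset.mul_sum]

/-! ### Radial functions and spherical waves in dimension three -/

theorem hasFDerivAt_norm_of_ne_zero {z : EuclideanSpace ℝ (Fin 3)} (hz : z ≠ 0) :
    HasFDerivAt (fun y : EuclideanSpace ℝ (Fin 3) => ‖y‖) (‖z‖⁻¹ • innerSL ℝ z) z := by
  have h := ((hasFDerivAt_id z).norm_sq).sqrt (pow_ne_zero 2 (norm_ne_zero_iff.2 hz))
  simp only [id, Real.sqrt_sq (norm_nonneg _)] at h
  refine h.congr_fderiv ?_
  ext w
  have : ‖z‖ ≠ 0 := norm_ne_zero_iff.2 hz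
  simp
  field_simp

theorem fderiv_radial {φ : ℝ → ℝ} {y : EuclideanSpace ℝ (Fin 3)} (hy : y ≠ 0)
    (hφ : DifferentiableAt ℝ φ ‖y‖) :
    HasFDerivAt (fun y : EuclideanSpace ℝ (Fin 3) => φ ‖y‖)
      (deriv φ ‖y‖ • (‖y‖⁻¹ • innerSL ℝ y)) y :=
  hφ.hasDerivAt.comp_hasFDerivAt y (hasFDerivAt_norm_of_ne_zero hy)

/-- The factor `r` absorbs the first-order term `2φ'/r`, which is special to dimension three. It
reduces spherical waves to waves on a line. -/
theorem laplacian_radial {φ : ℝ → ℝ} (hφ : ContDiff ℝ ∞ φ) {z : EuclideanSpace ℝ (Fin 3)}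
    (hz : z ≠ 0) :
    Laplacian.laplacian (fun y : EuclideanSpace ℝ (Fin 3) => φ ‖y‖) z
      = deriv (deriv fun r => r * φ r) ‖z‖ / ‖z‖ := by
  have hn : ‖z‖ ≠ 0 := norm_ne_zero_iff.2 hz
  have hφ' : ContDiff ℝ ∞ (deriv φ) := hφ.deriv'
  have hd : Differentiable ℝ φ := hφ.differentiable (by simp)
  have hd' : Differentiable ℝ (deriv φ) := hφ'.differentiable (by simp)
  have hQ : (deriv fun r => r * φ r) = fun r => φ r + r * deriv φ r := by
    funext r
    have : HasDerivAt (fun r => r * φ r) (1 * φ r + r * deriv φ r) r :=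
      (hasDerivAt_id r).mul (hd r).hasDerivAt
    rw [this.deriv, one_mul]
  have hQ' : deriv (deriv fun r => r * φ r) ‖z‖
      = 2 * deriv φ ‖z‖ + ‖z‖ * deriv (deriv φ) ‖z‖ := by
    rw [hQ]
    have := (hd ‖z‖).hasDerivAt.add ((hasDerivAt_id ‖z‖).mul (hd' ‖z‖).hasDerivAt)
    refine this.deriv.trans ?_
    simp; ring
  rw [hQ', InnerProductSpace.laplacian_eq_iteratedFDeriv_orthonormalBasis _
      (EuclideanSpace.basisFun (Fin 3) ℝ)]
  have key : ∀ i : Fin 3, iteratedFDeriv ℝ 2 (fun y : EuclideanSpace ℝ (Fin 3) => φ ‖y‖) z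
      ![EuclideanSpace.basisFun (Fin 3) ℝ i, EuclideanSpace.basisFun (Fin 3) ℝ i]
      = (deriv (deriv φ) ‖z‖ * ‖z‖ - deriv φ ‖z‖) / ‖z‖ ^ 2 * (‖z‖⁻¹ * z i ^ 2)
        + deriv φ ‖z‖ / ‖z‖ := by
    intro i
    rw [iteratedFDeriv_two_apply]
    simp only [Matrix.cons_val_zero, Matrix.cons_val_one]
    set e := EuclideanSpace.basisFun (Fin 3) ℝ i with he
    have hin : ∀ y : EuclideanSpace ℝ (Fin 3), inner ℝ y e = y i := fun y => by
      simp [he, EuclideanSpace.inner_single_right]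
    have hev : fderiv ℝ (fun y : EuclideanSpace ℝ (Fin 3) => φ ‖y‖)
        =ᶠ[𝓝 z] fun y => (deriv φ ‖y‖ / ‖y‖) • innerSL ℝ y := by
      filter_upwards [isOpen_ne.mem_nhds hz] with y hy
      rw [(fderiv_radial hy (hd _)).fderiv, smul_smul, div_eq_mul_inv]
    rw [hev.fderiv_eq]
    have hq : HasDerivAt (fun r => deriv φ r / r)
        ((deriv (deriv φ) ‖z‖ * ‖z‖ - deriv φ ‖z‖) / ‖z‖ ^ 2) ‖z‖ := by
      have : HasDerivAt (fun r => deriv φ r / r) _ ‖z‖ :=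
        (hd' ‖z‖).hasDerivAt.div (hasDerivAt_id ‖z‖) hn
      simpa using this
    have h1 := hq.comp_hasFDerivAt z (hasFDerivAt_norm_of_ne_zero hz)
    have h2 : HasFDerivAt (fun y : EuclideanSpace ℝ (Fin 3) => (deriv φ ‖y‖ / ‖y‖) • innerSL ℝ y)
        _ z := h1.smul (innerSL ℝ (E := EuclideanSpace ℝ (Fin 3))).hasFDerivAt
    rw [h2.fderiv]
    have hee : innerSL ℝ e e = (1 : ℝ) := by
      rw [innerSL_apply_apply, real_inner_self_eq_norm_sq, he, OrthonormalBasis.norm_eq_one]; norm_num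
    simp [hin, hee]
    ring
  simp only [key]
  have hs : ∑ i, z i ^ 2 = ‖z‖ ^ 2 := (EuclideanSpace.real_norm_sq_eq z).symm
  rw [Finset.sum_add_distrib, ← Finset.mul_sum, ← Finset.mul_sum, hs]
  simp
  field_simp
  ring

/-- A smooth cutoff, `0` on `(-∞, 1/2]` and `1` on `[1, ∞)`. -/
noncomputable def cutoff (s : ℝ) : ℝ := Real.smoothTransition (2 * s - 1)

theorem cutoff_contDiff : ContDiff ℝ ∞ cutoff :=
  (Real.smoothTransition.contDiff (n := ⊤)).comp (by fun_prop : ContDiff ℝ ∞ fun s : ℝ => 2 * s - 1)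

theorem cutoff_of_le {s : ℝ} (hs : s ≤ 1 / 2) : cutoff s = 0 :=
  Real.smoothTransition.zero_of_nonpos (by linarith)

theorem cutoff_of_ge {s : ℝ} (hs : 1 ≤ s) : cutoff s = 1 :=
  Real.smoothTransition.one_of_one_le (by linarith)

theorem deriv_cutoff_eq_zero {s : ℝ} (hs : s < 1 / 2 ∨ 1 < s) :
    deriv cutoff s = 0 ∧ deriv (deriv cutoff) s = 0 := by
  have h1 : ∃ c, cutoff =ᶠ[𝓝 s] fun _ => c := by
    rcases hs with hs | hs
    · exact ⟨0, by filter_upwards [Iio_mem_nhds hs] with r hr using cutoff_of_le (le_of_lt hr)⟩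
    · exact ⟨1, by filter_upwards [Ioi_mem_nhds hs] with r hr using cutoff_of_ge (le_of_lt hr)⟩
  obtain ⟨c, hc⟩ := h1
  have h2 := hc.deriv
  constructor
  · simpa using hc.deriv_eq
  · simpa using h2.deriv_eq

/-- The spherical wave `ψ(|z| - t) / |z|`, cut off in the ball `|z| < ε`. -/
noncomputable def sphericalWave (ψ : ℝ → ℝ) (ε : ℝ) (p : EuclideanSpace ℝ (Fin 3) × ℝ) : ℝ :=
  cutoff (‖p.1‖ / ε) / ‖p.1‖ * ψ (‖p.1‖ - p.2)

theorem cutoff_div_contDiff {ε : ℝ} (hε : 0 < ε) : ContDiff ℝ ∞ fun r => cutoff (r / ε) / r := by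
  rw [contDiff_iff_contDiffAt]
  intro r
  rcases le_or_gt r 0 with hr | hr
  · refine (contDiffAt_const (c := (0 : ℝ))).congr_of_eventuallyEq ?_
    filter_upwards [Iio_mem_nhds (show r < ε / 2 by linarith)] with s hs
    rw [cutoff_of_le, zero_div]
    rw [div_le_iff₀ hε]; linarith [mem_Iio.1 hs]
  · exact (cutoff_contDiff.comp (by fun_prop : ContDiff ℝ ∞ fun r : ℝ => r / ε)).contDiffAt.div
      contDiffAt_id hr.ne'

theorem sphericalWave_contDiff {ψ : ℝ → ℝ} (hψ : ContDiff ℝ ∞ ψ) {ε : ℝ} (hε : 0 < ε) :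
    ContDiff ℝ ∞ (sphericalWave ψ ε) := by
  rw [contDiff_iff_contDiffAt]
  intro p
  by_cases hp : p.1 = 0
  · refine (contDiffAt_const (c := (0 : ℝ))).congr_of_eventuallyEq ?_
    have ho : IsOpen {q : EuclideanSpace ℝ (Fin 3) × ℝ | ‖q.1‖ < ε / 2} :=
      isOpen_lt (by fun_prop) (by fun_prop)
    filter_upwards [ho.mem_nhds (show ‖p.1‖ < ε / 2 by rw [hp, norm_zero]; linarith)] with q hq
    rw [sphericalWave, cutoff_of_le, zero_div, zero_mul]
    rw [div_le_iff₀ hε]; linarith [mem_ofPred.1 hq]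
  · have hn : ContDiffAt ℝ ∞ (fun q : EuclideanSpace ℝ (Fin 3) × ℝ => ‖q.1‖) p :=
      (contDiffAt_norm ℝ hp).comp p contDiffAt_fst
    exact ((cutoff_div_contDiff hε).contDiffAt.comp p hn).mul
      (hψ.contDiffAt.comp p (hn.sub contDiffAt_snd))

/-- Multiplied by `r`, the wave is `cutoff (r / ε) * ψ (r - t)`. The terms with the second
derivative of `ψ` cancel, and every remaining term carries a derivative of the cutoff, hence lives
in the shell `ε/2 ≤ |z| ≤ ε`. -/
theorem waveOperator_sphericalWave {ψ : ℝ → ℝ} (hψ : ContDiff ℝ ∞ ψ) {ε : ℝ} (hε : 0 < ε)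
    (p : EuclideanSpace ℝ (Fin 3) × ℝ) :
    waveOperator (sphericalWave ψ ε) p
      = -(‖p.1‖⁻¹ * (deriv (deriv cutoff) (‖p.1‖ / ε) / ε ^ 2 * ψ (‖p.1‖ - p.2)
          + 2 * (deriv cutoff (‖p.1‖ / ε) / ε) * deriv ψ (‖p.1‖ - p.2))) := by
  obtain ⟨z, t⟩ := p
  have hdψ : Differentiable ℝ ψ := hψ.differentiable (by simp)
  have hdψ' : Differentiable ℝ (deriv ψ) := (hψ.deriv' (n := ∞)).differentiable (by simp)
  by_cases hz : z = 0
  · subst hz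
    have hev : sphericalWave ψ ε =ᶠ[𝓝 ((0 : EuclideanSpace ℝ (Fin 3)), t)] fun _ => 0 := by
      have ho : IsOpen {q : EuclideanSpace ℝ (Fin 3) × ℝ | ‖q.1‖ < ε / 2} :=
        isOpen_lt (by fun_prop) (by fun_prop)
      filter_upwards [ho.mem_nhds (show ‖(0 : EuclideanSpace ℝ (Fin 3))‖ < ε / 2 by
        rw [norm_zero]; linarith)] with q hq
      rw [sphericalWave, cutoff_of_le, zero_div, zero_mul]
      rw [div_le_iff₀ hε]; linarith [mem_ofPred.1 hq]
    rw [waveOperator_eq (sphericalWave_contDiff hψ hε)]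
    have h0 : ∀ w, secondDeriv w (sphericalWave ψ ε) (0, t) = 0 := fun w => by
      have h1 := hev.fderiv (𝕜 := ℝ)
      have h2 : (fun p => fderiv ℝ (sphericalWave ψ ε) p w)
          =ᶠ[𝓝 ((0 : EuclideanSpace ℝ (Fin 3)), t)] fun _ => 0 :=
        h1.mono fun q hq => by simp [hq]
      rw [secondDeriv, h2.fderiv_eq]; simp
    simp [h0]
  · have hn : ‖z‖ ≠ 0 := norm_ne_zero_iff.2 hz
    have hφ : ContDiff ℝ ∞ fun r => cutoff (r / ε) / r * ψ (r - t) :=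
      (cutoff_div_contDiff hε).mul (hψ.comp (by fun_prop : ContDiff ℝ ∞ fun r : ℝ => r - t))
    have ht : iteratedDeriv 2 (fun s => sphericalWave ψ ε (z, s)) t
        = cutoff (‖z‖ / ε) / ‖z‖ * deriv (deriv ψ) (‖z‖ - t) := by
      rw [iteratedDeriv_succ, iteratedDeriv_one]
      have hc : ∀ χ : ℝ → ℝ, Differentiable ℝ χ → ∀ s,
          HasDerivAt (fun s => χ (‖z‖ - s)) (-deriv χ (‖z‖ - s)) s := fun χ hχ s => by
        have : HasDerivAt (fun s => χ (‖z‖ - s)) (deriv χ (‖z‖ - s) * -1) s :=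
          (hχ (‖z‖ - s)).hasDerivAt.comp s ((hasDerivAt_id s).const_sub ‖z‖)
        rwa [mul_neg_one] at this
      have h1 : deriv (fun s => sphericalWave ψ ε (z, s))
          = fun s => cutoff (‖z‖ / ε) / ‖z‖ * -deriv ψ (‖z‖ - s) :=
        funext fun s => ((hc ψ hdψ s).const_mul (cutoff (‖z‖ / ε) / ‖z‖)).deriv
      have h2 : HasDerivAt (fun s => cutoff (‖z‖ / ε) / ‖z‖ * -deriv ψ (‖z‖ - s)) _ t :=
        (hc _ hdψ' t).neg.const_mul _
      rw [h1, h2.deriv, neg_neg]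
    have hQ : (fun r => r * (cutoff (r / ε) / r * ψ (r - t)))
        = fun r => cutoff (r / ε) * ψ (r - t) := by
      funext r
      by_cases hr : r = 0
      · simp [hr, cutoff_of_le]
      · field_simp
    have hc : ∀ χ : ℝ → ℝ, Differentiable ℝ χ → ∀ r,
        HasDerivAt (fun r => χ (r / ε)) (deriv χ (r / ε) / ε) r := fun χ hχ r => by
      have : HasDerivAt (fun r => χ (r / ε)) (deriv χ (r / ε) * (1 / ε)) r :=
        (hχ (r / ε)).hasDerivAt.comp r ((hasDerivAt_id r).div_const ε)
      rwa [mul_one_div] at this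
    have hs : ∀ χ : ℝ → ℝ, Differentiable ℝ χ → ∀ r,
        HasDerivAt (fun r => χ (r - t)) (deriv χ (r - t)) r := fun χ hχ r => by
      have : HasDerivAt (fun r => χ (r - t)) (deriv χ (r - t) * 1) r :=
        (hχ (r - t)).hasDerivAt.comp r ((hasDerivAt_id r).sub_const t)
      rwa [mul_one] at this
    have hdc : Differentiable ℝ cutoff := cutoff_contDiff.differentiable (by simp)
    have hdc' : Differentiable ℝ (deriv cutoff) := (cutoff_contDiff.deriv' (n := ∞)).differentiable (by simp)
    have hQ1 : (deriv fun r => cutoff (r / ε) * ψ (r - t))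
        = fun r => deriv cutoff (r / ε) / ε * ψ (r - t) + cutoff (r / ε) * deriv ψ (r - t) :=
      funext fun r => ((hc _ hdc r).mul (hs _ hdψ r)).deriv
    have hQ2 := ((((hc _ hdc' ‖z‖).div_const ε).mul (hs _ hdψ ‖z‖)).add
      ((hc _ hdc ‖z‖).mul (hs _ hdψ' ‖z‖))).deriv
    have hlap := laplacian_radial hφ hz
    rw [hQ, hQ1] at hlap
    unfold waveOperator
    rw [ht]
    refine (congrArg _ (hlap.trans (congrArg (· / ‖z‖) hQ2))).trans ?_
    field_simp
    ring

theorem waveOperator_sphericalWave_eq_zero {ψ : ℝ → ℝ} (hψ : ContDiff ℝ ∞ ψ) {ε : ℝ} (hε : 0 < ε)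
    {p : EuclideanSpace ℝ (Fin 3) × ℝ} (hp : ε < ‖p.1‖) :
    waveOperator (sphericalWave ψ ε) p = 0 := by
  have h := deriv_cutoff_eq_zero (Or.inr (show 1 < ‖p.1‖ / ε by rwa [lt_div_iff₀ hε, one_mul]))
  rw [waveOperator_sphericalWave hψ hε, h.1, h.2]
  simp

theorem sphericalWave_of_le {ψ : ℝ → ℝ} {ε : ℝ} (hε : 0 < ε)
    {p : EuclideanSpace ℝ (Fin 3) × ℝ} (hp : ε ≤ ‖p.1‖) :
    sphericalWave ψ ε p = ψ (‖p.1‖ - p.2) / ‖p.1‖ := by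
  rw [sphericalWave, cutoff_of_ge (by rwa [le_div_iff₀ hε, one_mul]), one_div, inv_mul_eq_div]

/-! ### Backward potentials as test functions -/

/-- Three-dimensional Euclidean space. -/
abbrev E3 := EuclideanSpace ℝ (Fin 3)

instance : (volume : Measure (E3 × ℝ)).IsAddHaarMeasure :=
  inferInstanceAs ((volume : Measure E3).prod (volume : Measure ℝ)).IsAddHaarMeasure

theorem secondDeriv_congr {V : Type*} [NormedAddCommGroup V] [NormedSpace ℝ V] {g h : V → ℝ} {p : V}
    (hgh : g =ᶠ[𝓝 p] h) (w : V) : secondDeriv w g p = secondDeriv w h p := by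
  have h1 : (fun p => fderiv ℝ g p w) =ᶠ[𝓝 p] fun p => fderiv ℝ h p w :=
    (hgh.fderiv (𝕜 := ℝ)).mono fun q hq => by simp [hq]
  rw [secondDeriv, secondDeriv, h1.fderiv_eq]

theorem waveOperator_congr {g h : E3 × ℝ → ℝ} (hg : ContDiff ℝ ∞ g) (hh : ContDiff ℝ ∞ h)
    {p : E3 × ℝ} (hgh : g =ᶠ[𝓝 p] h) : waveOperator g p = waveOperator h p := by
  rw [waveOperator_eq hg, waveOperator_eq hh]
  simp only [secondDeriv_congr hgh]

theorem secondDeriv_comp_neg {V : Type*} [NormedAddCommGroup V] [NormedSpace ℝ V] (g : V → ℝ)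
    (w p : V) : secondDeriv w (fun q => g (-q)) p = secondDeriv w g (-p) := by
  have h0 : ∀ (g : V → ℝ) (p : V), fderiv ℝ (fun q => g (-q)) p w = -(fderiv ℝ g (-p) w) :=
    fun g p => by
      have := congrArg (fun T => T w)
        ((ContinuousLinearEquiv.neg ℝ (M := V)).comp_right_fderiv (f := g) (x := p))
      simpa [Function.comp_def] using this
  have h1 : (fun p => fderiv ℝ (fun q => g (-q)) p w) = fun p => -(fderiv ℝ g (-p) w) :=
    funext fun p => h0 g p
  rw [secondDeriv, secondDeriv, h1, fderiv_fun_neg]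
  exact (congrArg Neg.neg (h0 (fun p => fderiv ℝ g p w) p)).trans (neg_neg _)

theorem waveOperator_comp_neg {g : E3 × ℝ → ℝ} (hg : ContDiff ℝ ∞ g) (p : E3 × ℝ) :
    waveOperator (fun q => g (-q)) p = waveOperator g (-p) := by
  rw [waveOperator_eq hg, waveOperator_eq (g := fun q => g (-q)) (hg.comp contDiff_neg)]
  simp only [secondDeriv_comp_neg]

theorem exists_norm_le_of_hasCompactSupport {V G : Type*} [NormedAddCommGroup V] [Zero G]
    {ρ : V → G} (h : HasCompactSupport ρ) : ∃ B, 0 < B ∧ ∀ p, ρ p ≠ 0 → ‖p‖ ≤ B := by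
  obtain ⟨B, hB, hb⟩ := h.isBounded.exists_pos_norm_le
  exact ⟨B, hB, fun p hp => hb p (subset_tsupport _ hp)⟩

/-- The superposition of backward spherical waves with sources distributed by `ρ`. -/
noncomputable def backwardPotential (ψ : ℝ → ℝ) (ρ : E3 × ℝ → ℝ) (ε : ℝ) : E3 × ℝ → ℝ :=
  conv volume ρ fun z => sphericalWave ψ ε (-z)

section Potential

variable {ψ : ℝ → ℝ} {ρ : E3 × ℝ → ℝ} {ε : ℝ}

theorem backwardPotential_contDiff (hψ : ContDiff ℝ ∞ ψ) (hρ : ContDiff ℝ ∞ ρ)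
    (hρc : HasCompactSupport ρ) (hε : 0 < ε) : ContDiff ℝ ∞ (backwardPotential ψ ρ ε) :=
  conv_contDiff (hρ.continuous.integrable_of_hasCompactSupport hρc) hρc (subset_tsupport _)
    ((sphericalWave_contDiff hψ hε).comp contDiff_neg)

theorem waveOperator_backwardPotential (hψ : ContDiff ℝ ∞ ψ) (hρ : ContDiff ℝ ∞ ρ)
    (hρc : HasCompactSupport ρ) (hε : 0 < ε) (q : E3 × ℝ) :
    waveOperator (backwardPotential ψ ρ ε) q
      = ∫ p, ρ p * waveOperator (sphericalWave ψ ε) (p - q) := by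
  rw [backwardPotential, conv_waveOperator (hρ.continuous.integrable_of_hasCompactSupport hρc) hρc
    (subset_tsupport _) (K := fun z => sphericalWave ψ ε (-z))
    ((sphericalWave_contDiff hψ hε).comp contDiff_neg)]
  simp only [conv, waveOperator_comp_neg (sphericalWave_contDiff hψ hε), neg_sub]

/-- Either alternative makes the argument of `ψ`, the distance of the space points plus the time
difference, at least `c`. The support is therefore bounded in every half-space `t ≥ t₁`, though not
in the past. -/
theorem backwardPotential_eq_zero {c B : ℝ} (hψc : ∀ s, c ≤ s → ψ s = 0)
    (hB : ∀ p, ρ p ≠ 0 → ‖p‖ ≤ B) {q : E3 × ℝ} (hq : c + B ≤ ‖q.1‖ - B + q.2 ∨ c + B ≤ q.2) :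
    backwardPotential ψ ρ ε q = 0 := by
  refine integral_eq_zero_of_ae (ae_of_all _ fun p => ?_)
  by_cases hp : ρ p = 0
  · simp [hp]
  have h1 := hB p hp
  have h2 : ‖p.1‖ ≤ B := (norm_fst_le p).trans h1
  have h3 : p.2 ≤ B := (le_abs_self _).trans ((norm_snd_le p).trans h1)
  have h4 : ‖q.1‖ - ‖p.1‖ ≤ ‖q.1 - p.1‖ := norm_sub_norm_le _ _
  have h5 : ψ (‖(-(q - p)).1‖ - (-(q - p)).2) = 0 := by
    apply hψc
    simp only [Prod.fst_neg, Prod.snd_neg, Prod.fst_sub, Prod.snd_sub, norm_neg]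
    rcases hq with hq | hq
    · linarith
    · linarith [norm_nonneg (q.1 - p.1)]
  simp only [sphericalWave, h5, mul_zero, Pi.zero_apply]

theorem weak_identity_backwardPotential {F u : E3 × ℝ → ℝ} (hu : IsWeakWaveSolution F u)
    {c : ℝ} (hψ : ContDiff ℝ ∞ ψ) (hψc : ∀ s, c ≤ s → ψ s = 0)
    (hρ : ContDiff ℝ ∞ ρ) (hρc : HasCompactSupport ρ) (hε : 0 < ε) :
    ∫ q in univ ×ˢ Ioi (0 : ℝ), u q * waveOperator (backwardPotential ψ ρ ε) q
      = ∫ q in univ ×ˢ Ioi (0 : ℝ), F q * backwardPotential ψ ρ ε q := by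
  obtain ⟨B, hB0, hB⟩ := exists_norm_le_of_hasCompactSupport hρc
  have hφ := backwardPotential_contDiff hψ hρ hρc hε
  -- This factor is `0` for `t ≤ -2` and `1` for `t ≥ -1`: it makes the support compact and changes
  -- nothing where `t > 0`.
  set Φ : E3 × ℝ → ℝ := fun q => Real.smoothTransition (q.2 + 2) * backwardPotential ψ ρ ε q with hΦ
  have hΦs : ContDiff ℝ ∞ Φ :=
    ((Real.smoothTransition.contDiff (n := ⊤)).comp
      (by fun_prop : ContDiff ℝ ∞ fun q : E3 × ℝ => q.2 + 2)).mul hφ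
  have hΦc : HasCompactSupport Φ := by
    refine HasCompactSupport.intro (K := Metric.closedBall 0 (c + 2 * B + 2) ×ˢ Icc (-2) (c + B))
      ((isCompact_closedBall _ _).prod isCompact_Icc) fun q hq => ?_
    by_cases h2 : q.2 ≤ -2
    · simp only [hΦ]
      rw [Real.smoothTransition.zero_of_nonpos (by linarith), zero_mul]
    · simp only [hΦ]
      rw [backwardPotential_eq_zero hψc hB, mul_zero]
      by_contra! hcon
      exact hq ⟨by rw [mem_closedBall_zero_iff]; linarith [hcon.1], ⟨by linarith, hcon.2.le⟩⟩
  have hS : MeasurableSet (univ ×ˢ Ioi (0 : ℝ) : Set (E3 × ℝ)) :=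
    MeasurableSet.univ.prod measurableSet_Ioi
  have hev : ∀ q ∈ (univ ×ˢ Ioi (0 : ℝ) : Set (E3 × ℝ)), Φ =ᶠ[𝓝 q] backwardPotential ψ ρ ε := by
    intro q hq
    have ho : IsOpen (univ ×ˢ Ioi (0 : ℝ) : Set (E3 × ℝ)) := isOpen_univ.prod isOpen_Ioi
    filter_upwards [ho.mem_nhds hq] with r hr
    have : (0 : ℝ) < r.2 := hr.2
    simp only [hΦ]
    rw [Real.smoothTransition.one_of_one_le (by linarith), one_mul]
  have h := hu.2 Φ hΦs hΦc
  have h1 := setIntegral_congr_fun (μ := volume) (f := fun q => u q * waveOperator Φ q)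
    (g := fun q => u q * waveOperator (backwardPotential ψ ρ ε) q) hS
    fun q hq => by simp only [waveOperator_congr hΦs hφ (hev q hq)]
  have h2 := setIntegral_congr_fun (μ := volume) (f := fun q => F q * Φ q)
    (g := fun q => F q * backwardPotential ψ ρ ε q) hS
    fun q hq => by simp only [(hev q hq).eq_of_nhds]
  exact h1.symm.trans (h.trans h2)

/-- Fubini moves the kernel from `ρ` to `F`. Their supports are at spatial distance at least `δ ≥
ε`, so the kernel is evaluated only where the cutoff equals `1`, and the result does not depend on
`ε`. -/
theorem integral_mul_backwardPotential {F : E3 × ℝ → ℝ} (hF : Integrable F) {C : Set (E3 × ℝ)}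
    (hC : IsCompact C) (hFC : Function.support F ⊆ C) (hFt : ∀ q, F q ≠ 0 → 0 ≤ q.2)
    {δ : ℝ} (hψ : ContDiff ℝ ∞ ψ) (hρ : ContDiff ℝ ∞ ρ) (hρc : HasCompactSupport ρ) (hε : 0 < ε)
    (hεδ : ε ≤ δ) (hsep : ∀ p q, ρ p ≠ 0 → F q ≠ 0 → δ ≤ ‖p.1 - q.1‖) :
    ∫ q in univ ×ˢ Ioi (0 : ℝ), F q * backwardPotential ψ ρ ε q
      = ∫ p, ρ p * conv volume F (sphericalWave ψ δ) p := by
  -- `F` may be nonzero at `t = 0`, outside the domain of the weak identity; this slice is a null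
  -- set.
  have hnull : ∀ᵐ q : E3 × ℝ, q.2 ≠ 0 := by
    have : (volume : Measure (E3 × ℝ)) (univ ×ˢ {(0 : ℝ)}) = 0 := by
      rw [Measure.volume_eq_prod, Measure.prod_prod]; simp
    refine measure_mono_null (fun q hq => ?_) this
    simpa using hq
  have h1 : ∫ q in univ ×ˢ Ioi (0 : ℝ), F q * backwardPotential ψ ρ ε q
      = ∫ q, F q * backwardPotential ψ ρ ε q := by
    refine setIntegral_eq_integral_of_ae_compl_eq_zero ?_
    filter_upwards [hnull] with q hq hqS
    have : F q = 0 := by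
      by_contra h
      exact hqS ⟨mem_univ _, lt_of_le_of_ne (hFt q h) (Ne.symm hq)⟩
    simp [this]
  have hρi : Integrable ρ := hρ.continuous.integrable_of_hasCompactSupport hρc
  have hK := (sphericalWave_contDiff hψ hε).continuous
  have hint : Integrable (Function.uncurry fun q p => F q * (ρ p * sphericalWave ψ ε (p - q)))
      ((volume : Measure (E3 × ℝ)).prod volume) := by
    obtain ⟨M, hM⟩ := exists_bound_on_differences hK hC hρc
    refine ((hF.norm.mul_prod hρi.norm).mul_const M).mono' ?_ (ae_of_all _ fun z => ?_)
    · refine hF.aestronglyMeasurable.comp_fst.mul ?_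
      exact Continuous.aestronglyMeasurable (by have := hρ.continuous; fun_prop)
    · simp only [Function.uncurry, norm_mul, ← mul_assoc]
      by_cases hq : F z.1 = 0
      · simp [hq]
      by_cases hp : ρ z.2 = 0
      · simp [hp]
      gcongr
      exact hM _ (subset_tsupport _ hp) _ (hFC hq)
  have h2 : ∀ q, F q * backwardPotential ψ ρ ε q
      = ∫ p, F q * (ρ p * sphericalWave ψ ε (p - q)) := fun q => by
    simp only [backwardPotential, conv, neg_sub, integral_const_mul]
  have h3 : ∀ p, ∫ q, F q * (ρ p * sphericalWave ψ ε (p - q))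
      = ρ p * conv volume F (sphericalWave ψ δ) p := fun p => by
    rw [conv, ← integral_const_mul]
    congr 1
    funext q
    by_cases hp : ρ p = 0
    · simp [hp]
    by_cases hq : F q = 0
    · simp [hq]
    have hs := hsep p q hp hq
    rw [sphericalWave_of_le (p := p - q) hε (hεδ.trans hs),
      sphericalWave_of_le (p := p - q) (hε.trans_le hεδ) hs]
    ring
  rw [h1]
  simp only [h2, ← h3]
  exact integral_integral_swap hint

end Potential

/-! ### Removal of the cutoff: smoothed retarded potentials by duality -/

/-- The integrand of the wave operator of a backward potential, in the rescaled variable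
`z = (x - q₁) / ε`. -/
noncomputable def rescaledIntegrand (ψ : ℝ → ℝ) (ρ : E3 × ℝ → ℝ) (ε : ℝ) (q z : E3 × ℝ) : ℝ :=
  -(‖z.1‖⁻¹ * (deriv (deriv cutoff) ‖z.1‖ * ψ (ε * ‖z.1‖ - (z.2 - q.2))
    + 2 * ε * deriv cutoff ‖z.1‖ * deriv ψ (ε * ‖z.1‖ - (z.2 - q.2)))) * ρ (q.1 + ε • z.1, z.2)

section Duality

variable {ψ : ℝ → ℝ} {ρ : E3 × ℝ → ℝ}

theorem rescaledIntegrand_measurable (hψ : ContDiff ℝ ∞ ψ) (hρ : Continuous ρ) (ε : ℝ)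
    (q : E3 × ℝ) : Measurable (rescaledIntegrand ψ ρ ε q) := by
  have h1 : Measurable ψ := hψ.continuous.measurable
  have h2 : Measurable (deriv ψ) := measurable_deriv ψ
  have h3 : Measurable (deriv cutoff) := measurable_deriv _
  have h4 : Measurable (deriv (deriv cutoff)) := measurable_deriv _
  have h5 : Measurable fun z : E3 × ℝ => ρ (q.1 + ε • z.1, z.2) :=
    (by fun_prop : Continuous fun z : E3 × ℝ => ρ (q.1 + ε • z.1, z.2)).measurable
  unfold rescaledIntegrand
  fun_prop

/-- The derivatives of `cutoff` confine `z.1`, `ρ` confines `z.2` and `q.1`, and `ψ` bounds `q.2`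
from above. The bounds are uniform in `ε ≤ 1`, as dominated convergence requires in both the `z` and
the `q` integral. -/
theorem rescaledIntegrand_bound {c : ℝ} (hψ : ContDiff ℝ ∞ ψ) (hψc : ∀ s, c ≤ s → ψ s = 0)
    (hρ : Continuous ρ) (hρc : HasCompactSupport ρ) :
    ∃ C M : ℝ, 0 ≤ C ∧ ∀ ε ∈ Ioc (0 : ℝ) 1, ∀ q : E3 × ℝ, 0 < q.2 → ∀ z,
      ‖rescaledIntegrand ψ ρ ε q z‖ ≤ C ∧ (rescaledIntegrand ψ ρ ε q z ≠ 0 →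
        q ∈ Metric.closedBall (0 : E3) M ×ˢ Icc 0 M ∧
          z ∈ Metric.closedBall (0 : E3) 1 ×ˢ Icc (-M) M) := by
  obtain ⟨B, hB0, hB⟩ := exists_norm_le_of_hasCompactSupport hρc
  obtain ⟨Cρ, hCρ⟩ := hρc.exists_bound_of_continuous hρ
  set M := B + 1 + |c| with hM
  have hcM : c ≤ |c| := le_abs_self c
  have hc0 : 0 ≤ |c| := abs_nonneg c
  obtain ⟨C1, hC1⟩ := (isCompact_Icc (a := -M) (b := 1 + 2 * M)).exists_bound_of_continuousOn
    hψ.continuous.continuousOn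
  obtain ⟨C2, hC2⟩ := (isCompact_Icc (a := -M) (b := 1 + 2 * M)).exists_bound_of_continuousOn
    (hψ.continuous_deriv (by simp)).continuousOn
  obtain ⟨C3, hC3⟩ := (isCompact_Icc (a := (0 : ℝ)) (b := 1)).exists_bound_of_continuousOn
    (cutoff_contDiff.continuous_deriv (by simp)).continuousOn
  obtain ⟨C4, hC4⟩ := (isCompact_Icc (a := (0 : ℝ)) (b := 1)).exists_bound_of_continuousOn
    ((cutoff_contDiff.deriv' (n := ∞)).continuous_deriv (by simp)).continuousOn
  have hψ' : ∀ s, c < s → deriv ψ s = 0 := fun s hs => by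
    have : ψ =ᶠ[𝓝 s] fun _ => 0 := by
      filter_upwards [Ioi_mem_nhds hs] with r hr using hψc r (le_of_lt hr)
    simpa using this.deriv_eq
  have hC10 : 0 ≤ C1 := (norm_nonneg _).trans (hC1 0 ⟨by linarith, by linarith⟩)
  have hC20 : 0 ≤ C2 := (norm_nonneg _).trans (hC2 0 ⟨by linarith, by linarith⟩)
  have hC30 : 0 ≤ C3 := (norm_nonneg _).trans (hC3 0 (by simp))
  have hC40 : 0 ≤ C4 := (norm_nonneg _).trans (hC4 0 (by simp))
  have hCρ0 : 0 ≤ Cρ := (norm_nonneg _).trans (hCρ 0)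
  have hC : 0 ≤ 2 * (C4 * C1 + 2 * C3 * C2) * Cρ := by positivity
  refine ⟨2 * (C4 * C1 + 2 * C3 * C2) * Cρ, M, hC, fun ε hε q hq z => ?_⟩
  have hsupp : rescaledIntegrand ψ ρ ε q z ≠ 0 → (1 / 2 ≤ ‖z.1‖ ∧ ‖z.1‖ ≤ 1) ∧ ‖z.2‖ ≤ B ∧
      ‖q.1‖ ≤ B + 1 ∧ q.2 ≤ c + B := by
    intro h
    have hρ0 : ρ (q.1 + ε • z.1, z.2) ≠ 0 := fun h0 => h (by simp [rescaledIntegrand, h0])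
    have h1 : 1 / 2 ≤ ‖z.1‖ ∧ ‖z.1‖ ≤ 1 := by
      by_contra hcon
      have hcon : ‖z.1‖ < 1 / 2 ∨ 1 < ‖z.1‖ := by
        by_contra! h'
        exact hcon h'
      have := deriv_cutoff_eq_zero hcon
      exact h (by simp [rescaledIntegrand, this.1, this.2])
    have h2 := hB _ hρ0
    have h3 : ‖z.2‖ ≤ B := (norm_snd_le (q.1 + ε • z.1, z.2)).trans h2
    have h4 : ‖q.1 + ε • z.1‖ ≤ B := (norm_fst_le (q.1 + ε • z.1, z.2)).trans h2
    have h5 : ‖ε • z.1‖ ≤ 1 := by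
      rw [norm_smul, Real.norm_of_nonneg hε.1.le]
      exact mul_le_one₀ hε.2 (norm_nonneg _) h1.2
    refine ⟨h1, h3, ?_, ?_⟩
    · calc ‖q.1‖ = ‖(q.1 + ε • z.1) - ε • z.1‖ := by simp
        _ ≤ B + 1 := (norm_sub_le _ _).trans (add_le_add h4 h5)
    · by_contra! hcon
      have h6 : z.2 ≤ B := (le_abs_self _).trans h3
      have h7 : c < ε * ‖z.1‖ - (z.2 - q.2) := by
        have := mul_nonneg hε.1.le (norm_nonneg z.1)
        linarith
      exact h (by simp [rescaledIntegrand, hψ' _ h7, hψc _ h7.le])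
  constructor
  · by_cases h : rescaledIntegrand ψ ρ ε q z = 0
    · rw [h, norm_zero]; exact hC
    obtain ⟨⟨h1, h1'⟩, h2, h3, h4⟩ := hsupp h
    have h5 := abs_le.1 h2
    have harg : ε * ‖z.1‖ - (z.2 - q.2) ∈ Icc (-M) (1 + 2 * M) := by
      have h6 := mul_nonneg hε.1.le (norm_nonneg z.1)
      have h7 : ε * ‖z.1‖ ≤ 1 := mul_le_one₀ hε.2 (norm_nonneg _) h1'
      constructor <;> linarith [h5.1, h5.2]
    have hinv : ‖z.1‖⁻¹ ≤ 2 := by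
      rw [inv_le_comm₀ (by linarith) two_pos]; linarith
    have hz : ‖z.1‖ ∈ Icc (0 : ℝ) 1 := ⟨norm_nonneg _, h1'⟩
    rw [rescaledIntegrand, norm_mul, norm_neg, norm_mul, norm_inv, norm_norm]
    have hin : ‖deriv (deriv cutoff) ‖z.1‖ * ψ (ε * ‖z.1‖ - (z.2 - q.2))
        + 2 * ε * deriv cutoff ‖z.1‖ * deriv ψ (ε * ‖z.1‖ - (z.2 - q.2))‖
        ≤ C4 * C1 + 2 * C3 * C2 := by
      refine (norm_add_le _ _).trans (add_le_add ?_ ?_)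
      · rw [norm_mul]
        exact mul_le_mul (hC4 _ hz) (hC1 _ harg) (norm_nonneg _) hC40
      · rw [norm_mul, norm_mul, norm_mul, Real.norm_of_nonneg hε.1.le, Real.norm_ofNat]
        refine mul_le_mul ?_ (hC2 _ harg) (norm_nonneg _) (by positivity)
        calc 2 * ε * ‖deriv cutoff ‖z.1‖‖ ≤ 2 * 1 * C3 :=
              mul_le_mul (by linarith [hε.2]) (hC3 _ hz) (norm_nonneg _) (by norm_num)
          _ = 2 * C3 := by ring
    exact mul_le_mul (mul_le_mul hinv hin (norm_nonneg _) zero_le_two) (hCρ _) (norm_nonneg _)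
      (by positivity)
  · intro h
    obtain ⟨⟨h1, h1'⟩, h2, h3, h4⟩ := hsupp h
    have h5 := abs_le.1 h2
    refine ⟨⟨?_, hq.le, ?_⟩, ?_, ?_, ?_⟩
    · rw [mem_closedBall_zero_iff]; linarith
    · linarith
    · rwa [mem_closedBall_zero_iff]
    · linarith [h5.1]
    · linarith [h5.2]

theorem integrable_of_bounded_of_support {V : Type*} [MeasurableSpace V] {μ : Measure V} {f : V → ℝ}
    (hf : Measurable f) {C : ℝ} {D : Set V} (hD : MeasurableSet D) (hμD : μ D ≠ ⊤)
    (hC : ∀ z, ‖f z‖ ≤ C) (hfD : ∀ z, f z ≠ 0 → z ∈ D) : Integrable f μ := by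
  refine Integrable.mono' (g := D.indicator fun _ => C)
    ((integrable_indicator_iff hD).2 (integrableOn_const hμD)) hf.aestronglyMeasurable
    (ae_of_all _ fun z => ?_)
  by_cases hz : z ∈ D
  · rw [indicator_of_mem hz]; exact hC z
  · rw [indicator_of_notMem hz, not_not.1 (mt (hfD z) hz), norm_zero]

theorem waveOperator_backwardPotential_rescaled {c : ℝ} (hψ : ContDiff ℝ ∞ ψ)
    (hψc : ∀ s, c ≤ s → ψ s = 0) (hρ : ContDiff ℝ ∞ ρ) (hρc : HasCompactSupport ρ) {ε : ℝ}
    (hε : ε ∈ Ioc (0 : ℝ) 1) {q : E3 × ℝ} (hq : 0 < q.2) :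
    waveOperator (backwardPotential ψ ρ ε) q = ∫ z, rescaledIntegrand ψ ρ ε q z := by
  have hε0 := hε.1
  obtain ⟨C, M, hC, hb⟩ := rescaledIntegrand_bound hψ hψc hρ.continuous hρc
  have hWc := (waveOperator_contDiff (sphericalWave_contDiff hψ hε0)).continuous
  have hint1 : Integrable (fun p => ρ p * waveOperator (sphericalWave ψ ε) (p - q))
      ((volume : Measure E3).prod (volume : Measure ℝ)) := by
    have := hρ.continuous
    exact Continuous.integrable_of_hasCompactSupport (by fun_prop) hρc.mul_right
  have hint2 : Integrable (rescaledIntegrand ψ ρ ε q)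
      ((volume : Measure E3).prod (volume : Measure ℝ)) :=
    integrable_of_bounded_of_support (rescaledIntegrand_measurable hψ hρ.continuous ε q)
      (measurableSet_closedBall.prod measurableSet_Icc)
      (((isCompact_closedBall _ _).prod isCompact_Icc).measure_lt_top.ne)
      (fun z => (hb ε hε q hq z).1) (fun z hz => ((hb ε hε q hq z).2 hz).2)
  rw [waveOperator_backwardPotential hψ hρ hρc hε0, Measure.volume_eq_prod, integral_prod _ hint1,
    integral_prod _ hint2]
  set H : E3 → ℝ := fun x => ∫ t, ρ (x, t) * waveOperator (sphericalWave ψ ε) ((x, t) - q) with hH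
  -- The Jacobian `ε³` of `x ↦ q.1 + ε • x` cancels the factor `ε⁻¹` from `1/|x|` and the factor
  -- `ε⁻²` from the second derivative of the cutoff; the first-derivative term keeps a factor `ε`.
  have h1 : ∫ x, H x = ε ^ 3 * ∫ x, H (q.1 + ε • x) := by
    rw [Measure.integral_comp_smul volume (fun x => H (q.1 + x)), integral_add_left_eq_self,
      finrank_euclideanSpace_fin, abs_of_pos (by positivity), smul_eq_mul, ← mul_assoc,
      mul_inv_cancel₀ (by positivity), one_mul]
  refine h1.trans ?_
  rw [← integral_const_mul]
  congr 1
  funext x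
  rw [hH]
  simp only
  rw [← integral_const_mul]
  congr 1
  funext t
  rw [waveOperator_sphericalWave hψ hε0, rescaledIntegrand]
  have h2 : ‖((q.1 + ε • x, t) - q).1‖ = ε * ‖x‖ := by
    rw [Prod.fst_sub, add_sub_cancel_left, norm_smul, Real.norm_of_nonneg hε0.le]
  rw [h2, Prod.snd_sub, mul_div_cancel_left₀ _ hε0.ne', mul_inv]
  field_simp

/-- The total mass of the rescaled source. -/
noncomputable def waveConst : ℝ := ∫ x : E3, -(‖x‖⁻¹ * deriv (deriv cutoff) ‖x‖)

/-- The second-derivative term is an approximate identity in space of mass `waveConst`, and the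
other term tends to zero. Only the fact that this mass is a fixed constant matters later, not its
value. -/
theorem tendsto_waveOperator_backwardPotential {c : ℝ} (hψ : ContDiff ℝ ∞ ψ)
    (hψc : ∀ s, c ≤ s → ψ s = 0) (hρ : ContDiff ℝ ∞ ρ) (hρc : HasCompactSupport ρ)
    {q : E3 × ℝ} (hq : 0 < q.2) :
    Tendsto (fun ε => waveOperator (backwardPotential ψ ρ ε) q) (𝓝[>] 0)
      (𝓝 (waveConst * ∫ t, ρ (q.1, t) * ψ (q.2 - t))) := by
  obtain ⟨C, M, hC, hb⟩ := rescaledIntegrand_bound hψ hψc hρ.continuous hρc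
  have hlim : waveConst * ∫ t, ρ (q.1, t) * ψ (q.2 - t) = ∫ z, rescaledIntegrand ψ ρ 0 q z := by
    rw [waveConst, Measure.volume_eq_prod, ← integral_prod_mul]
    congr 1
    funext z
    simp only [rescaledIntegrand, zero_mul, mul_zero, zero_smul, add_zero]
    rw [show (0 : ℝ) - (z.2 - q.2) = q.2 - z.2 by ring]
    ring
  have hIoc : Ioc (0 : ℝ) 1 ∈ 𝓝[>] (0 : ℝ) := Ioc_mem_nhdsGT one_pos
  rw [hlim]
  refine Tendsto.congr' (f₁ := fun ε => ∫ z, rescaledIntegrand ψ ρ ε q z) ?_ ?_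
  · filter_upwards [hIoc] with ε hε
    rw [waveOperator_backwardPotential_rescaled hψ hψc hρ hρc hε hq]
  refine tendsto_integral_filter_of_dominated_convergence
    ((Metric.closedBall (0 : E3) 1 ×ˢ Icc (-M) M).indicator fun _ => C) ?_ ?_ ?_ ?_
  · exact Eventually.of_forall fun ε =>
      (rescaledIntegrand_measurable hψ hρ.continuous ε q).aestronglyMeasurable
  · filter_upwards [hIoc] with ε hε
    refine ae_of_all _ fun z => ?_
    by_cases hz : z ∈ Metric.closedBall (0 : E3) 1 ×ˢ Icc (-M) M
    · rw [indicator_of_mem hz]; exact (hb ε hε q hq z).1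
    · rw [indicator_of_notMem hz, not_not.1 (mt (fun h => ((hb ε hε q hq z).2 h).2) hz), norm_zero]
  · exact (integrable_indicator_iff (measurableSet_closedBall.prod measurableSet_Icc)).2
      (integrableOn_const ((isCompact_closedBall _ _).prod isCompact_Icc).measure_lt_top.ne)
  · refine ae_of_all _ fun z => ?_
    have h1 := hψ.continuous
    have h2 := hψ.continuous_deriv (by simp)
    have h3 := hρ.continuous
    have : Continuous fun ε => rescaledIntegrand ψ ρ ε q z := by
      unfold rescaledIntegrand
      fun_prop
    exact (this.tendsto 0).mono_left nhdsWithin_le_nhds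

theorem waveOperator_backwardPotential_bound {c : ℝ} (hψ : ContDiff ℝ ∞ ψ)
    (hψc : ∀ s, c ≤ s → ψ s = 0) (hρ : ContDiff ℝ ∞ ρ) (hρc : HasCompactSupport ρ) :
    ∃ C M : ℝ, 0 ≤ C ∧ ∀ ε ∈ Ioc (0 : ℝ) 1, ∀ q : E3 × ℝ, 0 < q.2 →
      ‖waveOperator (backwardPotential ψ ρ ε) q‖ ≤ C ∧
      (waveOperator (backwardPotential ψ ρ ε) q ≠ 0 →
        q ∈ Metric.closedBall (0 : E3) M ×ˢ Icc 0 M) := by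
  obtain ⟨C, M, hC, hb⟩ := rescaledIntegrand_bound hψ hψc hρ.continuous hρc
  set D := Metric.closedBall (0 : E3) 1 ×ˢ Icc (-M) M with hD
  have hDm : MeasurableSet D := measurableSet_closedBall.prod measurableSet_Icc
  have hDt : volume D ≠ ⊤ := ((isCompact_closedBall _ _).prod isCompact_Icc).measure_lt_top.ne
  refine ⟨C * (volume D).toReal, M, by positivity, fun ε hε q hq => ?_⟩
  rw [waveOperator_backwardPotential_rescaled hψ hψc hρ hρc hε hq]
  constructor
  · have h1 : ∫ z in D, rescaledIntegrand ψ ρ ε q z = ∫ z, rescaledIntegrand ψ ρ ε q z :=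
      setIntegral_eq_integral_of_forall_compl_eq_zero fun z hz =>
        not_not.1 (mt (fun h => ((hb ε hε q hq z).2 h).2) hz)
    rw [← h1]
    exact norm_setIntegral_le_of_norm_le_const hDt.lt_top fun z _ => (hb ε hε q hq z).1
  · intro h
    by_contra hcon
    refine h (integral_eq_zero_of_ae (ae_of_all _ fun z => ?_))
    exact not_not.1 (mt (fun h => ((hb ε hε q hq z).2 h).1) hcon)

/-- The solution of the wave equation with source `F` is a superposition of spherical waves,
tested against the densities `ρ` that are supported away from the source. -/
theorem integral_mul_conv_sphericalWave {F u : E3 × ℝ → ℝ} (hu : IsWeakWaveSolution F u)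
    (hF : Integrable F) {K : Set (E3 × ℝ)} (hK : IsCompact K) (hFK : Function.support F ⊆ K)
    (hFt : ∀ q, F q ≠ 0 → 0 ≤ q.2) {c δ : ℝ} (hψ : ContDiff ℝ ∞ ψ) (hψc : ∀ s, c ≤ s → ψ s = 0)
    (hρ : ContDiff ℝ ∞ ρ) (hρc : HasCompactSupport ρ) (hδ : 0 < δ)
    (hsep : ∀ p q, ρ p ≠ 0 → F q ≠ 0 → δ ≤ ‖p.1 - q.1‖) :
    ∫ p, ρ p * conv volume F (sphericalWave ψ δ) p
      = ∫ q in univ ×ˢ Ioi (0 : ℝ), u q * (waveConst * ∫ t, ρ (q.1, t) * ψ (q.2 - t)) := by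
  obtain ⟨C, M, hC, hb⟩ := waveOperator_backwardPotential_bound hψ hψc hρ hρc
  have hS : MeasurableSet (univ ×ˢ Ioi (0 : ℝ) : Set (E3 × ℝ)) :=
    MeasurableSet.univ.prod measurableSet_Ioi
  set D := Metric.closedBall (0 : E3) M ×ˢ Icc 0 M with hD
  have hDm : MeasurableSet D := measurableSet_closedBall.prod measurableSet_Icc
  have huD : IntegrableOn u D := hu.1.integrableOn_compact_subset
    (Set.prod_mono (subset_univ _) fun t ht => ht.1) ((isCompact_closedBall _ _).prod isCompact_Icc)
  have huS : AEStronglyMeasurable u (volume.restrict (univ ×ˢ Ioi (0 : ℝ))) :=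
    hu.1.aestronglyMeasurable.mono_measure
      (Measure.restrict_mono (Set.prod_mono le_rfl Ioi_subset_Ici_self) le_rfl)
  have hIoc : Ioc (0 : ℝ) 1 ∈ 𝓝[>] (0 : ℝ) := Ioc_mem_nhdsGT one_pos
  have hev : ∀ᶠ ε in 𝓝[>] (0 : ℝ), ∫ p, ρ p * conv volume F (sphericalWave ψ δ) p
      = ∫ q in univ ×ˢ Ioi (0 : ℝ), u q * waveOperator (backwardPotential ψ ρ ε) q := by
    filter_upwards [Ioc_mem_nhdsGT hδ] with ε hε
    rw [weak_identity_backwardPotential hu hψ hψc hρ hρc hε.1,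
      integral_mul_backwardPotential hF hK hFK hFt hψ hρ hρc hε.1 hε.2 hsep]
  -- The left-hand side is constant in small `ε`, so it equals the limit of the right-hand side.
  refine tendsto_nhds_unique (tendsto_const_nhds (x := ∫ p, ρ p * conv volume F
    (sphericalWave ψ δ) p) (f := 𝓝[>] (0 : ℝ))) (Tendsto.congr' (EventuallyEq.symm hev) ?_)
  refine tendsto_integral_filter_of_dominated_convergence
    (D.indicator fun q => ‖u q‖ * C) ?_ ?_ ?_ ?_
  · filter_upwards [hIoc] with ε hε
    exact huS.mul (waveOperator_contDiff
      (backwardPotential_contDiff hψ hρ hρc hε.1)).continuous.aestronglyMeasurable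
  · filter_upwards [hIoc] with ε hε
    refine (ae_restrict_iff' hS).2 (ae_of_all _ fun q hq => ?_)
    have hbq := hb ε hε q hq.2
    by_cases hqD : q ∈ D
    · rw [indicator_of_mem hqD, norm_mul]
      exact mul_le_mul_of_nonneg_left hbq.1 (norm_nonneg _)
    · rw [indicator_of_notMem hqD, not_not.1 (mt hbq.2 hqD), mul_zero, norm_zero]
  · exact ((integrable_indicator_iff hDm).2 (huD.norm.mul_const C)).integrableOn
  · refine (ae_restrict_iff' hS).2 (ae_of_all _ fun q hq => ?_)
    exact (tendsto_waveOperator_backwardPotential hψ hψc hρ hρc hq.2).const_mul (u q)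

end Duality

/-! ### From the zero trace of `u` to zeros of the potential on the sphere -/

/-- Dilate a conical sector `C` of the ball around the direction `x₀`: `(1 + ε) C \ C` lies in the
piece of shell, and its volume is at least `((1 + ε)³ - 1) |C| ≥ 3 ε |C|`. -/
theorem exists_le_volume_shell {R r : ℝ} (hR : 0 < R) (hr : 0 < r) {x₀ : E3} (hx₀ : ‖x₀‖ = R) :
    ∃ c : ℝ, 0 < c ∧ ∀ ε > 0, ε * R ≤ r / 2 →
      ENNReal.ofReal (c * ε) ≤ volume {x : E3 | ‖x - x₀‖ < r ∧ R ≤ ‖x‖ ∧ ‖x‖ ≤ (1 + ε) * R} := by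
  set A : Set E3 := {x | x ≠ 0} ∩ (fun x => (R / ‖x‖) • x) ⁻¹' Metric.ball x₀ (r / 2) with hA
  have hAo : IsOpen A := by
    refine ContinuousOn.isOpen_inter_preimage (fun x hx => ?_) isOpen_ne Metric.isOpen_ball
    have : ‖x‖ ≠ 0 := norm_ne_zero_iff.2 hx
    exact ContinuousAt.continuousWithinAt (by fun_prop (disch := assumption))
  set C : Set E3 := A ∩ Metric.ball 0 R with hC
  have hCo : IsOpen C := hAo.inter Metric.isOpen_ball
  have hscale : ∀ s : ℝ, 0 < s → ∀ x : E3, (R / ‖s • x‖) • s • x = (R / ‖x‖) • x := fun s hs x => by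
    rw [norm_smul, Real.norm_of_nonneg hs.le, smul_smul]
    congr 1
    field_simp
  have hx₀0 : x₀ ≠ 0 := norm_ne_zero_iff.1 (by rw [hx₀]; exact hR.ne')
  have hCne : C.Nonempty := by
    refine ⟨(1 / 2 : ℝ) • x₀, ⟨smul_ne_zero (by norm_num) hx₀0, ?_⟩, ?_⟩
    · rw [mem_preimage, hscale _ (by norm_num), hx₀, div_self hR.ne', one_smul]
      exact Metric.mem_ball_self (by linarith)
    · rw [mem_ball_zero_iff, norm_smul, hx₀]
      norm_num
      linarith
  have hCpos : 0 < volume C := hCo.measure_pos volume hCne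
  have hCfin : volume C ≠ ⊤ :=
    ((measure_mono inter_subset_right).trans_lt Metric.isBounded_ball.measure_lt_top).ne
  have hv : 0 < (volume C).toReal := ENNReal.toReal_pos hCpos.ne' hCfin
  refine ⟨3 * (volume C).toReal, by positivity, fun ε hε hεr => ?_⟩
  have hsub : (1 + ε) • C \ C ⊆ {x : E3 | ‖x - x₀‖ < r ∧ R ≤ ‖x‖ ∧ ‖x‖ ≤ (1 + ε) * R} := by
    rintro x ⟨⟨y, hy, rfl⟩, hxC⟩
    have hs : 0 < 1 + ε := by linarith
    have hyR : ‖y‖ < R := mem_ball_zero_iff.1 hy.2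
    have hxA : (1 + ε) • y ∈ A := by
      refine ⟨smul_ne_zero hs.ne' hy.1.1, ?_⟩
      rw [mem_preimage, hscale _ hs]
      exact hy.1.2
    have hxn : R ≤ ‖(1 + ε) • y‖ := by
      by_contra! h
      exact hxC ⟨hxA, mem_ball_zero_iff.2 h⟩
    have hxn' : ‖(1 + ε) • y‖ ≤ (1 + ε) * R := by
      rw [norm_smul, Real.norm_of_nonneg hs.le]
      gcongr
    refine ⟨?_, hxn, hxn'⟩
    simp only
    set x := (1 + ε) • y
    have hx0 : 0 < ‖x‖ := hR.trans_le hxn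
    have h1 : ‖x - (R / ‖x‖) • x‖ = ‖x‖ - R := by
      have h2 : x - (R / ‖x‖) • x = (1 - R / ‖x‖) • x := by rw [sub_smul, one_smul]
      have h3 : 0 ≤ 1 - R / ‖x‖ := by rw [sub_nonneg, div_le_one hx0]; exact hxn
      rw [h2, norm_smul, Real.norm_of_nonneg h3]
      field_simp
    have h2 : ‖(R / ‖x‖) • x - x₀‖ < r / 2 := mem_ball_iff_norm.1 hxA.2
    calc ‖x - x₀‖ ≤ ‖x - (R / ‖x‖) • x‖ + ‖(R / ‖x‖) • x - x₀‖ := norm_sub_le_norm_sub_add_norm_sub _ _ _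
      _ < r := by rw [h1]; linarith
  refine le_trans ?_ ((le_measure_sdiff (μ := volume) (s₁ := (1 + ε) • C) (s₂ := C)).trans
    (measure_mono hsub))
  rw [Measure.addHaar_smul, finrank_euclideanSpace_fin, abs_of_pos (by positivity),
    ← ENNReal.ofReal_toReal hCfin, ← ENNReal.ofReal_mul (by positivity),
    ← ENNReal.ofReal_sub _ hv.le, ENNReal.toReal_ofReal hv.le]
  refine ENNReal.ofReal_le_ofReal ?_
  have : 0 ≤ (3 * ε ^ 2 + ε ^ 3) * (volume C).toReal := by positivity
  nlinarith

/-- The shell `| |x| - R | < ε`, `0 < t < T`. -/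
def sphericalShell (R T ε : ℝ) : Set (E3 × ℝ) := {p | |‖p.1‖ - R| < ε ∧ p.2 ∈ Ioo 0 T}

theorem measurableSet_sphericalShell (R T ε : ℝ) : MeasurableSet (sphericalShell R T ε) :=
  (measurableSet_lt (f := fun p : E3 × ℝ => |‖p.1‖ - R|) (g := fun _ => ε)
    (by fun_prop) (by fun_prop)).inter (measurable_snd measurableSet_Ioo)

/-- If `v(x₀, t₀) ≠ 0`, test with bumps of thickness of order `ε` across the sphere near `(x₀, t₀)`.
The integral of `ρ v` is at least a constant times `ε`, whereas by duality it is at most a constant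
times the integral of `|u|` over a shell, which is `o(ε)`. -/
theorem conv_sphericalWave_eq_zero_on_sphere {F u : E3 × ℝ → ℝ} (hu : IsWeakWaveSolution F u)
    (hF : Integrable F) {K : Set (E3 × ℝ)} (hK : IsCompact K) (hFK : Function.support F ⊆ K)
    (hFt : ∀ q, F q ≠ 0 → 0 ≤ q.2) {ψ : ℝ → ℝ} {c δ R T ρ₀ : ℝ} (hψ : ContDiff ℝ ∞ ψ)
    (hψc : ∀ s, c ≤ s → ψ s = 0) (hδ : 0 < δ) (hR : 0 < R) (hFx : ∀ q, F q ≠ 0 → ‖q.1‖ ≤ ρ₀)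
    (hρ₀ : ρ₀ + δ < R)
    (htr : Tendsto (fun ε : ℝ => (ENNReal.ofReal ε)⁻¹ * ∫⁻ p in sphericalShell R T ε, ‖u p‖ₑ)
      (𝓝[>] 0) (𝓝 0)) {x₀ : E3} {t₀ : ℝ} (hx₀ : ‖x₀‖ = R) (ht₀ : t₀ < T - c) :
    conv volume F (sphericalWave ψ δ) (x₀, t₀) = 0 := by
  set v := conv volume F (sphericalWave ψ δ) with hv
  have hvc : Continuous v := (conv_contDiff hF hK hFK (sphericalWave_contDiff hψ hδ)).continuous
  by_contra hv0
  set a := |v (x₀, t₀)| / 2 with ha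
  have ha0 : 0 < a := by positivity
  -- a neighbourhood on which `v` keeps its sign and size
  obtain ⟨r, hr0, hrv, hrt, hrx⟩ : ∃ r > 0, (∀ p ∈ Metric.ball (x₀, t₀) r, a ≤ SignType.sign (v (x₀, t₀)) * v p) ∧
      t₀ + r < T - c ∧ r < R - (ρ₀ + δ) := by
    have h1 : ∀ᶠ p in 𝓝 (x₀, t₀), a < SignType.sign (v (x₀, t₀)) * v p := by
      have h0 : a < SignType.sign (v (x₀, t₀)) * v (x₀, t₀) := by
        rw [sign_mul_self]
        linarith
      exact (continuous_const.mul hvc).continuousAt.eventually (lt_mem_nhds h0)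
    obtain ⟨r1, hr1, h1⟩ := Metric.eventually_nhds_iff_ball.1 h1
    refine ⟨min r1 (min ((T - c - t₀) / 2) ((R - (ρ₀ + δ)) / 2)), ?_, ?_, ?_, ?_⟩
    · exact lt_min hr1 (lt_min (by linarith) (by linarith))
    · exact fun p hp => (h1 p (Metric.ball_subset_ball (min_le_left _ _) hp)).le
    · have : min r1 (min ((T - c - t₀) / 2) ((R - (ρ₀ + δ)) / 2)) ≤ (T - c - t₀) / 2 :=
        (min_le_right _ _).trans (min_le_left _ _)
      linarith
    · have : min r1 (min ((T - c - t₀) / 2) ((R - (ρ₀ + δ)) / 2)) ≤ (R - (ρ₀ + δ)) / 2 :=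
        (min_le_right _ _).trans (min_le_right _ _)
      linarith
  let P : ContDiffBump (x₀, t₀) := ⟨r / 2, r, by linarith, by linarith⟩
  -- For `R ≤ |x| ≤ (1 + ε)R` and `ε ≤ 1` one has `|x|² - R² ≤ 3R²ε`, so `χ = 1` there. The outer
  -- radius `4R²` confines the support to `| |x| - R | < 4Rε`.
  let χ : ContDiffBump (0 : ℝ) := ⟨3 * R ^ 2, 4 * R ^ 2, by positivity, by nlinarith⟩
  set ρ : ℝ → E3 × ℝ → ℝ := fun ε p => P p * χ ((‖p.1‖ ^ 2 - R ^ 2) / ε) with hρ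
  have hρs : ∀ ε, ContDiff ℝ ∞ (ρ ε) := fun ε => by
    have h1 : ContDiff ℝ ∞ fun p : E3 × ℝ => (‖p.1‖ ^ 2 - R ^ 2) / ε :=
      ((contDiff_fst.norm_sq ℝ).sub contDiff_const).div_const _
    exact P.contDiff.mul (χ.contDiff.comp h1)
  have hρc : ∀ ε, HasCompactSupport (ρ ε) := fun ε => P.hasCompactSupport.mul_right
  have hρ0 : ∀ ε p, 0 ≤ ρ ε p := fun ε p => mul_nonneg P.nonneg χ.nonneg
  have hρ1 : ∀ ε p, ρ ε p ≤ 1 := fun ε p => mul_le_one₀ P.le_one χ.nonneg χ.le_one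
  have hρsupp : ∀ ε > 0, ∀ p, ρ ε p ≠ 0 → p ∈ Metric.ball (x₀, t₀) r ∧
      |‖p.1‖ - R| < 4 * R * ε := by
    intro ε hε p hp
    have h1 : P p ≠ 0 := left_ne_zero_of_mul hp
    have h2 : χ ((‖p.1‖ ^ 2 - R ^ 2) / ε) ≠ 0 := right_ne_zero_of_mul hp
    have h3 : p ∈ Function.support P := h1
    have h4 : (‖p.1‖ ^ 2 - R ^ 2) / ε ∈ Function.support χ := h2
    rw [P.support_eq] at h3
    rw [χ.support_eq, mem_ball_zero_iff, norm_div, Real.norm_of_nonneg hε.le, div_lt_iff₀ hε,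
      sq_sub_sq, norm_mul, Real.norm_eq_abs, Real.norm_eq_abs,
      abs_of_nonneg (by positivity : 0 ≤ ‖p.1‖ + R)] at h4
    refine ⟨h3, ?_⟩
    change (‖p.1‖ + R) * |‖p.1‖ - R| < 4 * R ^ 2 * ε at h4
    have h5 : R * |‖p.1‖ - R| ≤ (‖p.1‖ + R) * |‖p.1‖ - R| := by
      gcongr; linarith [norm_nonneg p.1]
    have h6 : R * |‖p.1‖ - R| < R * (4 * R * ε) := by linarith
    exact lt_of_mul_lt_mul_left h6 hR.le
  -- the lower bound
  obtain ⟨κ, hκ0, hκ⟩ := exists_le_volume_shell hR (show 0 < r / 2 by linarith) hx₀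
  have hlow : ∀ ε > 0, ε ≤ 1 → ε * R ≤ r / 2 / 2 →
      ENNReal.ofReal (a * (κ * ε * r)) ≤ ‖∫ p, ρ ε p * v p‖ₑ := by
    intro ε hε hε1 hεr
    set A : Set (E3 × ℝ) := {x : E3 | ‖x - x₀‖ < r / 2 ∧ R ≤ ‖x‖ ∧ ‖x‖ ≤ (1 + ε) * R} ×ˢ
      Metric.ball t₀ (r / 2) with hA
    have hAm : MeasurableSet A := by
      refine MeasurableSet.prod ?_ measurableSet_ball
      exact (measurableSet_lt (f := fun x : E3 => ‖x - x₀‖) (g := fun _ => r / 2)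
          (by fun_prop) (by fun_prop)).inter
        ((measurableSet_le (f := fun _ => R) (g := fun x : E3 => ‖x‖)
          (by fun_prop) (by fun_prop)).inter
          (measurableSet_le (f := fun x : E3 => ‖x‖) (g := fun _ => (1 + ε) * R)
            (by fun_prop) (by fun_prop)))
    have hρA : ∀ p ∈ A, ρ ε p = 1 := by
      intro p hp
      have h1 : P p = 1 := by
        apply P.one_of_mem_closedBall
        rw [Metric.mem_closedBall, Prod.dist_eq]
        refine max_le ?_ (le_of_lt hp.2)
        rw [dist_eq_norm]
        exact hp.1.1.le
      have h2 : χ ((‖p.1‖ ^ 2 - R ^ 2) / ε) = 1 := by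
        apply χ.one_of_mem_closedBall
        have hp1 : R ≤ ‖p.1‖ := hp.1.2.1
        have hp2 : ‖p.1‖ ≤ (1 + ε) * R := hp.1.2.2
        have h3 : 0 ≤ ‖p.1‖ ^ 2 - R ^ 2 := by nlinarith
        rw [mem_closedBall_zero_iff, Real.norm_of_nonneg (by positivity), div_le_iff₀ hε]
        change _ ≤ 3 * R ^ 2 * ε
        have h4 : ‖p.1‖ ^ 2 ≤ ((1 + ε) * R) ^ 2 := by gcongr
        have h5 : ε ^ 2 * R ^ 2 ≤ ε * R ^ 2 := by
          gcongr; nlinarith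
        nlinarith
      simp only [hρ, h1, h2, mul_one]
    have hint : Integrable (fun p => ρ ε p * v p) :=
      ((hρs ε).continuous.mul hvc).integrable_of_hasCompactSupport (hρc ε).mul_right
    have h1 : ∀ p, A.indicator (fun _ => a) p ≤ SignType.sign (v (x₀, t₀)) * (ρ ε p * v p) := by
      intro p
      by_cases hp : p ∈ A
      · have hpb : p ∈ Metric.ball (x₀, t₀) r := by
          rw [Metric.mem_ball, Prod.dist_eq]
          refine max_lt ?_ ((Metric.mem_ball.1 hp.2).trans (by linarith))
          rw [dist_eq_norm]
          exact hp.1.1.trans (by linarith)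
        rw [indicator_of_mem hp, hρA p hp, one_mul]
        exact hrv p hpb
      · rw [indicator_of_notMem hp]
        by_cases h0 : ρ ε p = 0
        · simp [h0]
        have h2 := hrv p (hρsupp ε hε p h0).1
        rw [mul_left_comm]
        exact mul_nonneg (hρ0 ε p) (ha0.le.trans h2)
    have hAfin : volume A ≠ ⊤ := by
      refine ((measure_mono (t := Metric.closedBall (x₀, t₀) (r / 2)) fun p hp => ?_).trans_lt
        measure_closedBall_lt_top).ne
      rw [Metric.mem_closedBall, Prod.dist_eq]
      refine max_le ?_ (le_of_lt hp.2)
      rw [dist_eq_norm]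
      exact hp.1.1.le
    have h2 : (volume A).toReal * a ≤ SignType.sign (v (x₀, t₀)) * ∫ p, ρ ε p * v p := by
      rw [← integral_const_mul]
      refine le_trans (le_of_eq ?_) (integral_mono
        ((integrable_indicator_iff hAm).2 (integrableOn_const hAfin)) (hint.const_mul _) h1)
      rw [integral_indicator hAm, setIntegral_const, smul_eq_mul]
      rfl
    have h3 : (SignType.sign (v (x₀, t₀)) : ℝ) * ∫ p, ρ ε p * v p ≤ ‖∫ p, ρ ε p * v p‖ := by
      refine (le_abs_self _).trans ?_
      rw [abs_mul, Real.norm_eq_abs]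
      refine mul_le_of_le_one_left (abs_nonneg _) ?_
      rcases SignType.sign (v (x₀, t₀)) with _ | _ | _ <;> simp
    have h4 : κ * ε * r ≤ (volume A).toReal := by
      rw [← ENNReal.ofReal_le_iff_le_toReal hAfin, hA, Measure.volume_eq_prod, Measure.prod_prod,
        Real.volume_ball, ENNReal.ofReal_mul (by positivity)]
      gcongr
      · exact hκ ε hε hεr
      · linarith
    rw [← ofReal_norm]
    refine ENNReal.ofReal_le_ofReal ?_
    nlinarith [mul_le_mul_of_nonneg_left h4 ha0.le]
  -- the upper bound
  obtain ⟨Cψ, hCψ⟩ := (isCompact_Icc (a := -(t₀ + r)) (b := T - t₀ + r)).exists_bound_of_continuousOn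
    hψ.continuous.continuousOn
  set C := |waveConst| * (|Cψ| * (2 * r)) with hCdef
  have hinner : ∀ ε > 0, ∀ q : E3 × ℝ, 0 < q.2 →
      ‖waveConst * ∫ t, ρ ε (q.1, t) * ψ (q.2 - t)‖ ≤
        (sphericalShell R T (4 * R * ε)).indicator (fun _ => C) q := by
    intro ε hε q hq
    have hz : ∀ t, ρ ε (q.1, t) * ψ (q.2 - t) ≠ 0 → |t - t₀| < r ∧ |‖q.1‖ - R| < 4 * R * ε ∧
        q.2 < T := by
      intro t ht
      have h1 := hρsupp ε hε _ (left_ne_zero_of_mul ht)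
      have h2 : |t - t₀| < r := (le_max_right _ _).trans_lt (Metric.mem_ball.1 h1.1)
      refine ⟨h2, h1.2, ?_⟩
      -- A nonzero `ψ (q.2 - t)` requires `q.2 < t + c < t₀ + r + c < T`: only data before time `T`
      -- enter.
      by_contra! h3
      exact right_ne_zero_of_mul ht (hψc _ (by linarith [(abs_lt.1 h2).2]))
    by_cases hqs : q ∈ sphericalShell R T (4 * R * ε)
    · rw [indicator_of_mem hqs, norm_mul, Real.norm_eq_abs, hCdef]
      gcongr
      have h1 : ∫ t in Metric.ball t₀ r, ρ ε (q.1, t) * ψ (q.2 - t)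
          = ∫ t, ρ ε (q.1, t) * ψ (q.2 - t) :=
        setIntegral_eq_integral_of_forall_compl_eq_zero fun t ht =>
          not_not.1 (mt (fun h => (hz t h).1) ht)
      rw [← h1]
      have h2 := norm_setIntegral_le_of_norm_le_const (μ := volume) (s := Metric.ball t₀ r)
        (f := fun t => ρ ε (q.1, t) * ψ (q.2 - t)) (C := |Cψ|) measure_ball_lt_top
        (fun t ht => by
          have ht' := abs_lt.1 (Real.dist_eq t t₀ ▸ Metric.mem_ball.1 ht)
          have hψb := hCψ (q.2 - t) ⟨by linarith [ht'.2], by linarith [ht'.1, hqs.2.2]⟩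
          rw [norm_mul, Real.norm_of_nonneg (hρ0 _ _)]
          exact (mul_le_of_le_one_left (norm_nonneg _) (hρ1 _ _)).trans (hψb.trans (le_abs_self _)))
      refine h2.trans (le_of_eq ?_)
      rw [measureReal_def, Real.volume_ball, ENNReal.toReal_ofReal (by linarith)]
    · rw [indicator_of_notMem hqs]
      have h1 : (fun t => ρ ε (q.1, t) * ψ (q.2 - t)) = fun _ => 0 := by
        funext t
        by_contra h
        have := hz t h
        exact hqs ⟨this.2.1, hq, this.2.2⟩
      simp [h1]
  have hup : ∀ ε > 0, ‖∫ q in univ ×ˢ Ioi (0 : ℝ), u q *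
      (waveConst * ∫ t, ρ ε (q.1, t) * ψ (q.2 - t))‖ₑ
        ≤ ENNReal.ofReal C * ∫⁻ p in sphericalShell R T (4 * R * ε), ‖u p‖ₑ := by
    intro ε hε
    have hm := measurableSet_sphericalShell R T (4 * R * ε)
    refine (enorm_integral_le_lintegral_enorm _).trans ?_
    rw [← lintegral_const_mul' _ _ ENNReal.ofReal_ne_top, ← lintegral_indicator hm]
    refine (setLIntegral_mono' (g := (sphericalShell R T (4 * R * ε)).indicator
      fun p => ENNReal.ofReal C * ‖u p‖ₑ) (MeasurableSet.univ.prod measurableSet_Ioi)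
      fun q hq => ?_).trans (setLIntegral_le_lintegral _ _)
    have h := hinner ε hε q hq.2
    rw [enorm_mul, mul_comm]
    by_cases hqs : q ∈ sphericalShell R T (4 * R * ε)
    · rw [indicator_of_mem hqs] at h ⊢
      gcongr
      rw [← ofReal_norm]
      exact ENNReal.ofReal_le_ofReal h
    · rw [indicator_of_notMem hqs] at h ⊢
      rw [norm_le_zero_iff.1 h]
      simp
  -- comparison
  have hcomp : ∀ᶠ ε in 𝓝[>] (0 : ℝ), ENNReal.ofReal (a * (κ * r)) ≤
      ENNReal.ofReal C * ENNReal.ofReal (4 * R) *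
        ((ENNReal.ofReal (4 * R * ε))⁻¹ * ∫⁻ p in sphericalShell R T (4 * R * ε), ‖u p‖ₑ) := by
    have hε0 : 0 < min 1 (r / 2 / 2 / R) := lt_min one_pos (by positivity)
    filter_upwards [Ioc_mem_nhdsGT hε0] with ε hε
    have hε1 : ε ≤ 1 := hε.2.trans (min_le_left _ _)
    have hε2 : ε * R ≤ r / 2 / 2 := by
      rw [← le_div_iff₀ hR]; exact hε.2.trans (min_le_right _ _)
    have h1 := hlow ε hε.1 hε1 hε2
    rw [integral_mul_conv_sphericalWave hu hF hK hFK hFt hψ hψc (hρs ε) (hρc ε) hδ] at h1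
    · have h2 := h1.trans (hup ε hε.1)
      have h3 : ENNReal.ofReal (4 * R * ε) = ENNReal.ofReal (4 * R) * ENNReal.ofReal ε :=
        ENNReal.ofReal_mul (by positivity)
      have h4 : ENNReal.ofReal (a * (κ * ε * r))
          = ENNReal.ofReal (a * (κ * r)) * ENNReal.ofReal ε := by
        rw [← ENNReal.ofReal_mul (by positivity)]; congr 1; ring
      have hεne : ENNReal.ofReal ε ≠ 0 := by simpa using hε.1
      have hRne : ENNReal.ofReal (4 * R) ≠ 0 := by simpa using hR
      rw [h4] at h2
      rw [h3, ENNReal.mul_inv (Or.inl hRne) (Or.inl ENNReal.ofReal_ne_top)]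
      calc ENNReal.ofReal (a * (κ * r))
          = ENNReal.ofReal (a * (κ * r)) * ENNReal.ofReal ε * (ENNReal.ofReal ε)⁻¹ := by
            rw [mul_assoc, ENNReal.mul_inv_cancel hεne ENNReal.ofReal_ne_top, mul_one]
        _ ≤ ENNReal.ofReal C * (∫⁻ p in sphericalShell R T (4 * R * ε), ‖u p‖ₑ)
            * (ENNReal.ofReal ε)⁻¹ := by gcongr
        _ = ENNReal.ofReal C * (ENNReal.ofReal (4 * R) * (ENNReal.ofReal (4 * R))⁻¹)
            * ((ENNReal.ofReal ε)⁻¹ * ∫⁻ p in sphericalShell R T (4 * R * ε), ‖u p‖ₑ) := by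
            rw [ENNReal.mul_inv_cancel hRne ENNReal.ofReal_ne_top]; ring
        _ = _ := by ring
    · intro p q hp hq
      have h2 := (hρsupp ε hε.1 p hp).1
      have h3 : ‖p.1 - x₀‖ < r := by
        rw [← dist_eq_norm]
        exact (le_max_left _ _).trans_lt (Metric.mem_ball.1 h2)
      have h4 := hFx q hq
      have h5 := norm_sub_norm_le p.1 q.1
      have h6 := norm_sub_norm_le x₀ p.1
      rw [norm_sub_rev, hx₀] at h6
      linarith
  have hlin : Tendsto (fun ε : ℝ => 4 * R * ε) (𝓝[>] 0) (𝓝[>] 0) := by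
    refine tendsto_nhdsWithin_iff.2 ⟨?_, ?_⟩
    · have : Tendsto (fun ε : ℝ => 4 * R * ε) (𝓝 0) (𝓝 (4 * R * 0)) :=
        (by fun_prop : Continuous fun ε : ℝ => 4 * R * ε).tendsto 0
      rw [mul_zero] at this
      exact this.mono_left nhdsWithin_le_nhds
    · filter_upwards [self_mem_nhdsWithin] with ε hε
      have : 0 < ε := hε
      exact mem_Ioi.2 (by positivity)
  have hlim := ENNReal.Tendsto.const_mul (a := ENNReal.ofReal C * ENNReal.ofReal (4 * R))
    (htr.comp hlin) (Or.inr (ENNReal.mul_ne_top ENNReal.ofReal_ne_top ENNReal.ofReal_ne_top))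
  rw [mul_zero] at hlim
  have := ge_of_tendsto hlim hcomp
  rw [nonpos_iff_eq_zero, ENNReal.ofReal_eq_zero] at this
  have : 0 < a * (κ * r) := by positivity
  linarith

/-! ### Weighted energy identity and hyperboloids -/

theorem integral_fderiv_eq_zero_of_hasCompactSupport {V : Type*} [NormedAddCommGroup V]
    [NormedSpace ℝ V] [FiniteDimensional ℝ V] [MeasurableSpace V] [BorelSpace V] {μ : Measure V}
    [μ.IsAddHaarMeasure] {g : V → ℝ} (hg : ContDiff ℝ 1 g) (hgc : HasCompactSupport g) (w : V) :
    ∫ p, fderiv ℝ g p w ∂μ = 0 := by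
  have hc : Continuous fun p => fderiv ℝ g p w :=
    (hg.continuous_fderiv (by simp)).clm_apply continuous_const
  have hi : Integrable (fun p => fderiv ℝ g p w) μ :=
    hc.integrable_of_hasCompactSupport (hgc.fderiv_apply (𝕜 := ℝ) w)
  have h := integral_mul_fderiv_eq_neg_fderiv_mul_of_integrable (μ := μ) (𝕜 := ℝ)
    (f := fun _ : V => (1 : ℝ)) (g := g) (v := w) (by simp) (by simpa using hi)
    (by simpa using hg.continuous.integrable_of_hasCompactSupport hgc) (by fun_prop)
    fun x _ => hg.differentiable (by simp) x
  simpa using h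

theorem fderiv_fderiv_apply_comm {V : Type*} [NormedAddCommGroup V] [NormedSpace ℝ V] {v : V → ℝ}
    (hv : ContDiff ℝ ∞ v) (p a b : V) :
    fderiv ℝ (fun p => fderiv ℝ v p a) p b = fderiv ℝ (fun p => fderiv ℝ v p b) p a := by
  have hd : Differentiable ℝ (fderiv ℝ v) :=
    (show ContDiff ℝ ∞ (fderiv ℝ v) by fun_prop).differentiable (by simp)
  have h : ∀ a b, fderiv ℝ (fun p => fderiv ℝ v p a) p b = fderiv ℝ (fderiv ℝ v) p b a := by
    intro a b
    rw [fderiv_clm_apply (hd p) (differentiableAt_const a)]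
    simp
  rw [h, h]
  refine (hv.contDiffAt.isSymmSndFDerivAt ?_).eq b a
  rw [minSmoothness_of_isRCLikeNormedField]
  exact WithTop.coe_le_coe.2 (le_top (a := (2 : ℕ∞)))

section Energy

variable {v : E3 × ℝ → ℝ}

/-- The energy density of `v`. -/
noncomputable def energyDensity (v : E3 × ℝ → ℝ) (p : E3 × ℝ) : ℝ :=
  (fderiv ℝ v p (0, 1) ^ 2 + ∑ i, fderiv ℝ v p (spaceDir i) ^ 2) / 2

/-- Multiply the equation by `θ ∂ₜv` and integrate the resulting divergence. Compactness is asked of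
the products with `θ` only, since the weight used below is not compactly supported and the vanishing
of `v` has to help. -/
theorem integral_energy_identity {θ : E3 × ℝ → ℝ} (hv : ContDiff ℝ ∞ v) (hθ : ContDiff ℝ 1 θ)
    (hwave : ∀ p, θ p ≠ 0 → waveOperator v p = 0) {K : Set (E3 × ℝ)} (hK : IsCompact K)
    (hθK : ∀ p, p ∉ K → ∀ w w', θ p * (fderiv ℝ v p w * fderiv ℝ v p w') = 0) :
    ∫ p, (fderiv ℝ θ p (0, 1) * energyDensity v p
      - ∑ i, fderiv ℝ θ p (spaceDir i) * (fderiv ℝ v p (0, 1) * fderiv ℝ v p (spaceDir i))) = 0 := by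
  have hvw : ∀ w, ContDiff ℝ ∞ fun p => fderiv ℝ v p w := fun w => by fun_prop
  have hvd : ∀ w p, DifferentiableAt ℝ (fun p => fderiv ℝ v p w) p := fun w =>
    (hvw w).differentiable (by simp)
  have hθd : ∀ p, DifferentiableAt ℝ θ p := hθ.differentiable (by simp)
  have hZ : ∀ w w', ContDiff ℝ 1 fun p => θ p * (fderiv ℝ v p w * fderiv ℝ v p w') := fun w w' =>
    hθ.mul (((hvw w).mul (hvw w')).of_le (by simp))
  have hZc : ∀ w w', HasCompactSupport fun p => θ p * (fderiv ℝ v p w * fderiv ℝ v p w') :=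
    fun w w' => HasCompactSupport.intro hK fun p hp => hθK p hp w w'
  have hZi : ∀ w w' a, Integrable fun p =>
      fderiv ℝ (fun p => θ p * (fderiv ℝ v p w * fderiv ℝ v p w')) p a := fun w w' a =>
    (((hZ w w').continuous_fderiv (by simp)).clm_apply
      continuous_const).integrable_of_hasCompactSupport ((hZc w w').fderiv_apply (𝕜 := ℝ) a)
  have hZd : ∀ w w' a p, fderiv ℝ (fun p => θ p * (fderiv ℝ v p w * fderiv ℝ v p w')) p a
      = fderiv ℝ θ p a * (fderiv ℝ v p w * fderiv ℝ v p w')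
        + θ p * (fderiv ℝ (fun p => fderiv ℝ v p w) p a * fderiv ℝ v p w'
          + fderiv ℝ v p w * fderiv ℝ (fun p => fderiv ℝ v p w') p a) := by
    intro w w' a p
    have h := (hθd p).hasFDerivAt.mul ((hvd w p).hasFDerivAt.mul (hvd w' p).hasFDerivAt)
    refine (congrArg (fun T => T a) h.fderiv).trans ?_
    simp
    ring
  have hpt : ∀ p, fderiv ℝ θ p (0, 1) * energyDensity v p
      - ∑ i, fderiv ℝ θ p (spaceDir i) * (fderiv ℝ v p (0, 1) * fderiv ℝ v p (spaceDir i))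
      = (fderiv ℝ (fun p => θ p * (fderiv ℝ v p (0, 1) * fderiv ℝ v p (0, 1))) p (0, 1)
        + ∑ i, fderiv ℝ (fun p => θ p * (fderiv ℝ v p (spaceDir i) * fderiv ℝ v p (spaceDir i)))
          p (0, 1)) / 2
        - ∑ i, fderiv ℝ (fun p => θ p * (fderiv ℝ v p (0, 1) * fderiv ℝ v p (spaceDir i)))
          p (spaceDir i) := by
    intro p
    simp only [hZd, fderiv_fderiv_apply_comm hv p (spaceDir _) (0, 1)]
    have hw : θ p * waveOperator v p = 0 := by
      by_cases h : θ p = 0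
      · simp [h]
      · rw [hwave p h, mul_zero]
    rw [waveOperator_eq hv] at hw
    simp only [secondDeriv, Fin.sum_univ_three, energyDensity] at hw ⊢
    -- By symmetry of second derivatives the mixed terms cancel, leaving `θ ∂ₜv` times the wave
    -- operator.
    linear_combination -(fderiv ℝ v p (0, 1)) * hw
  simp only [hpt]
  rw [integral_sub, integral_div, integral_add (hZi _ _ _)
    (integrable_finsetSum _ fun i _ => hZi _ _ _), integral_finsetSum _ fun i _ => hZi _ _ _,
    integral_finsetSum _ fun i _ => hZi _ _ _]
  · simp only [fun w w' a => integral_fderiv_eq_zero_of_hasCompactSupport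
      (μ := (volume : Measure (E3 × ℝ))) (hZ w w') (hZc w w') a]
    simp
  · exact ((hZi _ _ _).add (integrable_finsetSum _ fun i _ => hZi _ _ _)).div_const 2
  · exact integrable_finsetSum _ fun i _ => hZi _ _ _

theorem hasDerivAt_max_zero_sq (s : ℝ) : HasDerivAt (fun s : ℝ => max s 0 ^ 2) (2 * max s 0) s := by
  rcases lt_trichotomy s 0 with hs | hs | hs
  · rw [max_eq_right hs.le, mul_zero]
    refine (hasDerivAt_const s (0 : ℝ)).congr_of_eventuallyEq ?_
    filter_upwards [Iio_mem_nhds hs] with r hr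
    rw [max_eq_right (le_of_lt (mem_Iio.1 hr))]; norm_num
  · subst hs
    rw [max_self, mul_zero, hasDerivAt_iff_isLittleO]
    have h1 : (fun x : ℝ => max x 0 ^ 2 - max 0 0 ^ 2 - (x - 0) • (0 : ℝ)) =O[𝓝 0]
        fun x : ℝ => x ^ 2 := by
      refine Asymptotics.IsBigO.of_bound 1 (Eventually.of_forall fun x => ?_)
      simp only [max_self, smul_zero, sub_zero, one_mul, norm_pow, ne_eq, OfNat.ofNat_ne_zero,
        not_false_eq_true, zero_pow]
      gcongr
      rw [Real.norm_of_nonneg (le_max_right _ _)]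
      exact max_le (le_abs_self x) (norm_nonneg x)
    refine h1.trans_isLittleO ?_
    simpa using (Asymptotics.isLittleO_pow_pow (𝕜 := ℝ) one_lt_two)
  · rw [max_eq_left hs.le]
    have h := (hasDerivAt_id s).pow 2
    refine (h.congr_deriv (by simp)).congr_of_eventuallyEq ?_
    filter_upwards [Ioi_mem_nhds hs] with r hr
    rw [max_eq_left (le_of_lt (mem_Ioi.1 hr))]; rfl

/-- Squaring the positive part gives a `C¹` weight, which is the regularity that the energy identity
asks for. -/
theorem max_zero_sq_contDiff : ContDiff ℝ 1 fun s : ℝ => max s 0 ^ 2 := by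
  rw [contDiff_one_iff_deriv]
  refine ⟨fun s => (hasDerivAt_max_zero_sq s).differentiableAt, ?_⟩
  rw [show deriv (fun s : ℝ => max s 0 ^ 2) = fun s => 2 * max s 0 from
    funext fun s => (hasDerivAt_max_zero_sq s).deriv]
  fun_prop

theorem deriv_smoothTransition_eq_zero {s : ℝ} (hs : s ≤ 0 ∨ 1 ≤ s) :
    deriv Real.smoothTransition s = 0 := by
  rcases hs with hs | hs
  · refine IsLocalMin.deriv_eq_zero (Eventually.of_forall fun r => ?_)
    rw [Real.smoothTransition.zero_of_nonpos hs]
    exact Real.smoothTransition.nonneg r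
  · refine IsLocalMax.deriv_eq_zero (Eventually.of_forall fun r => ?_)
    rw [Real.smoothTransition.one_of_one_le hs]
    exact Real.smoothTransition.le_one r

end Energy

section EnergyEstimate

/-- The height of `√(A + m²|x|²)` above `t`. -/
noncomputable def coneGap (A m : ℝ) (p : E3 × ℝ) : ℝ := √(A + m ^ 2 * ‖p.1‖ ^ 2) - p.2

/-- The weight of the energy estimate: it vanishes for `|x| ≤ R` and above the hyperboloid
`t = √(A + m²|x|²)`. -/
noncomputable def energyWeight (R A m ε : ℝ) (p : E3 × ℝ) : ℝ :=
  Real.smoothTransition ((‖p.1‖ ^ 2 - R ^ 2) / ε) * max (coneGap A m p) 0 ^ 2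

variable {v : E3 × ℝ → ℝ} {R A m ε : ℝ}

theorem coneGap_contDiff (hA : 0 < A) : ContDiff ℝ ∞ (coneGap A m) := by
  refine ContDiff.sub (ContDiff.sqrt ?_ fun p => by positivity) contDiff_snd
  exact contDiff_const.add (contDiff_const.mul (contDiff_fst.norm_sq ℝ))

theorem energyWeight_contDiff (hA : 0 < A) : ContDiff ℝ 1 (energyWeight R A m ε) := by
  have h1 : ContDiff ℝ ∞ fun p : E3 × ℝ => (‖p.1‖ ^ 2 - R ^ 2) / ε :=
    ((contDiff_fst.norm_sq ℝ).sub contDiff_const).div_const _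
  exact (((Real.smoothTransition.contDiff (n := ⊤)).comp h1).of_le (by simp)).mul
    (max_zero_sq_contDiff.comp ((coneGap_contDiff hA).of_le (by simp)))

theorem energyWeight_fderiv (hA : 0 < A) (p w : E3 × ℝ) :
    fderiv ℝ (energyWeight R A m ε) p w =
      deriv Real.smoothTransition ((‖p.1‖ ^ 2 - R ^ 2) / ε) * (2 * inner ℝ p.1 w.1 / ε)
          * max (coneGap A m p) 0 ^ 2
        + Real.smoothTransition ((‖p.1‖ ^ 2 - R ^ 2) / ε) * (2 * max (coneGap A m p) 0 *
          (m ^ 2 * inner ℝ p.1 w.1 / √(A + m ^ 2 * ‖p.1‖ ^ 2) - w.2)) := by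
  have hN : HasFDerivAt (fun p : E3 × ℝ => ‖p.1‖ ^ 2)
      (2 • (innerSL ℝ p.1).comp (ContinuousLinearMap.fst ℝ E3 ℝ)) p :=
    (hasFDerivAt_fst (𝕜 := ℝ) (p := p)).norm_sq
  have hpos : A + m ^ 2 * ‖p.1‖ ^ 2 ≠ 0 := by positivity
  have hs : √(A + m ^ 2 * ‖p.1‖ ^ 2) ≠ 0 := by positivity
  have hB := (((hN.const_mul (m ^ 2)).const_add A).sqrt hpos).sub
    (hasFDerivAt_snd (𝕜 := ℝ) (p := p))
  have hW := (hasDerivAt_max_zero_sq (coneGap A m p)).comp_hasFDerivAt p hB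
  have hst : HasDerivAt Real.smoothTransition (deriv Real.smoothTransition
      ((‖p.1‖ ^ 2 - R ^ 2) / ε)) ((‖p.1‖ ^ 2 - R ^ 2) / ε) :=
    ((Real.smoothTransition.contDiff (n := ⊤)).differentiable (by simp) _).hasDerivAt
  have hd : HasDerivAt (fun s : ℝ => (s - R ^ 2) / ε) (1 / ε) (‖p.1‖ ^ 2) :=
    ((hasDerivAt_id _).sub_const _).div_const ε
  have hS := (hst.comp (‖p.1‖ ^ 2) hd).comp_hasFDerivAt p hN
  have h := (hS.mul hW).fderiv
  refine (congrArg (fun T => T w) h).trans ?_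
  simp [coneGap]
  field_simp
  ring

/-- The density of the energy flux through the hyperboloids. -/
noncomputable def fluxDensity (A m : ℝ) (v : E3 × ℝ → ℝ) (p : E3 × ℝ) : ℝ :=
  2 * max (coneGap A m p) 0 * (energyDensity v p + fderiv ℝ v p (0, 1) *
    ∑ i, m ^ 2 * p.1 i / √(A + m ^ 2 * ‖p.1‖ ^ 2) * fderiv ℝ v p (spaceDir i))

theorem energyDensity_nonneg (v : E3 × ℝ → ℝ) (p : E3 × ℝ) : 0 ≤ energyDensity v p := by
  unfold energyDensity; positivity

/-- The gradient of `√(A + m²|x|²)` has norm at most `m`. Hence, by Cauchy–Schwarz, the mixed term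
is at most `m` times the energy density; for `m < 1` the hyperboloids are spacelike. -/
theorem le_fluxDensity (hA : 0 < A) (hm : 0 < m) (p : E3 × ℝ) :
    2 * max (coneGap A m p) 0 * ((1 - m) * energyDensity v p) ≤ fluxDensity A m v p := by
  unfold fluxDensity
  refine mul_le_mul_of_nonneg_left ?_ (by positivity)
  set Q := √(A + m ^ 2 * ‖p.1‖ ^ 2) with hQ
  have hQ0 : 0 < Q := by positivity
  have hQ2 : Q ^ 2 = A + m ^ 2 * ‖p.1‖ ^ 2 := Real.sq_sqrt (by positivity)
  set P := ∑ i, m ^ 2 * p.1 i / Q * fderiv ℝ v p (spaceDir i) with hP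
  set G := ∑ i, fderiv ℝ v p (spaceDir i) ^ 2 with hG
  have hG0 : 0 ≤ G := Finset.sum_nonneg fun i _ => sq_nonneg _
  have hCS : P ^ 2 ≤ (∑ i, (m ^ 2 * p.1 i / Q) ^ 2) * G := Finset.sum_mul_sq_le_sq_mul_sq _ _ _
  have hq : ∑ i, (m ^ 2 * p.1 i / Q) ^ 2 ≤ m ^ 2 := by
    have h1 : ∑ i, (m ^ 2 * p.1 i / Q) ^ 2 = m ^ 2 * (m ^ 2 * ‖p.1‖ ^ 2) / Q ^ 2 := by
      rw [EuclideanSpace.real_norm_sq_eq, Finset.mul_sum, Finset.mul_sum, Finset.sum_div]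
      exact Finset.sum_congr rfl fun i _ => by ring
    rw [h1, div_le_iff₀ (by positivity), hQ2]
    gcongr
    linarith
  have hP2 : P ^ 2 ≤ m ^ 2 * G := hCS.trans (by gcongr)
  have hsq := sq_nonneg (m * fderiv ℝ v p (0, 1) + P)
  have hmul : 0 ≤ m * (2 * (fderiv ℝ v p (0, 1) * P)
      + m * (fderiv ℝ v p (0, 1) ^ 2 + G)) := by nlinarith
  have h2 := nonneg_of_mul_nonneg_right hmul hm
  unfold energyDensity
  linarith

/-- This is the energy identity with weight `energyWeight`. The derivative of the hyperboloid factor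
gives the flux, that of the radial cutoff gives the error near the sphere. -/
theorem integral_flux_identity (hv : ContDiff ℝ ∞ v) (hA : 0 < A) (hε : 0 < ε)
    (hR : 0 ≤ R) (hwave : ∀ p, R < ‖p.1‖ → waveOperator v p = 0) {K : Set (E3 × ℝ)} (hK : IsCompact K)
    (hvK : ∀ p : E3 × ℝ, p ∉ K → R < ‖p.1‖ → 0 < coneGap A m p → fderiv ℝ v p = 0) :
    ∫ p, (Real.smoothTransition ((‖p.1‖ ^ 2 - R ^ 2) / ε) * fluxDensity A m v p
      + max (coneGap A m p) 0 ^ 2 * (fderiv ℝ v p (0, 1) *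
        (deriv Real.smoothTransition ((‖p.1‖ ^ 2 - R ^ 2) / ε) *
          (2 / ε * ∑ i, p.1 i * fderiv ℝ v p (spaceDir i))))) = 0 := by
  have hpos : ∀ p, energyWeight R A m ε p ≠ 0 → R < ‖p.1‖ ∧ 0 < coneGap A m p := by
    intro p hp
    constructor
    · by_contra! h
      refine left_ne_zero_of_mul hp (Real.smoothTransition.zero_of_nonpos ?_)
      refine div_nonpos_of_nonpos_of_nonneg ?_ hε.le
      nlinarith [norm_nonneg p.1]
    · by_contra! h
      exact right_ne_zero_of_mul hp (by rw [max_eq_right h]; norm_num)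
  have h := integral_energy_identity hv (energyWeight_contDiff (R := R) (m := m) (ε := ε) hA)
    (fun p hp => hwave p (hpos p hp).1) hK (fun p hp w w' => by
      by_cases h0 : energyWeight R A m ε p = 0
      · rw [h0, zero_mul]
      · rw [hvK p hp (hpos p h0).1 (hpos p h0).2]; simp)
  rw [← neg_eq_zero, ← integral_neg]
  refine Eq.trans ?_ h
  congr 1
  funext p
  have hin : ∀ i, inner ℝ p.1 (spaceDir i).1 = p.1 i := fun i => by
    simp [spaceDir, EuclideanSpace.inner_single_right]
  have hsd : ∀ i, (spaceDir i).2 = 0 := fun i => rfl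
  simp only [energyWeight_fderiv hA, fluxDensity, hin, hsd, inner_zero_right, Fin.sum_univ_three]
  ring

end EnergyEstimate

/-! ### Uniqueness for the exterior Dirichlet problem -/

section ExteriorUniqueness

variable {v : E3 × ℝ → ℝ} {R A m T L : ℝ}

theorem coneGap_le (hA : 0 < A) (hm : 0 < m) (p : E3 × ℝ) :
    coneGap A m p ≤ √A + m * ‖p.1‖ - p.2 := by
  unfold coneGap
  have h : √(A + m ^ 2 * ‖p.1‖ ^ 2) ≤ √A + m * ‖p.1‖ := by
    have h0 : 0 ≤ m * ‖p.1‖ := by positivity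
    rw [Real.sqrt_le_left (by positivity)]
    nlinarith [Real.sq_sqrt hA.le, Real.sqrt_nonneg A, mul_nonneg (Real.sqrt_nonneg A) h0]
  linarith

/-- The hyperboloid grows with slope `m < 1`, the early zero region with slope `1`. What lies
between them outside the ball is bounded. A ball times an interval is convex, as the mean value
inequality below requires. -/
theorem exists_convex_compact (hA : 0 < A) (hm : 0 < m) (hm1 : m < 1)
    (hearly : ∀ p : E3 × ℝ, R ≤ ‖p.1‖ → p.2 ≤ ‖p.1‖ - L → v p = 0) :
    ∃ M a b : ℝ, ∀ p : E3 × ℝ, R < ‖p.1‖ → 0 < coneGap A m p →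
      p ∉ Metric.closedBall (0 : E3) M ×ˢ Icc a b → fderiv ℝ v p = 0 := by
  refine ⟨(L + √A) / (1 - m), R - L, √A + m * ((L + √A) / (1 - m)), fun p hp hg hK => ?_⟩
  have hlt : p.2 < ‖p.1‖ - L := by
    by_contra! h
    have h1 := coneGap_le hA hm p
    have h2 : ‖p.1‖ ≤ (L + √A) / (1 - m) := by
      rw [le_div_iff₀ (by linarith)]; linarith
    refine hK ⟨mem_closedBall_zero_iff.2 h2, by linarith, ?_⟩
    have h3 : m * ‖p.1‖ ≤ m * ((L + √A) / (1 - m)) := by gcongr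
    linarith
  have ho : IsOpen {q : E3 × ℝ | R < ‖q.1‖ ∧ q.2 < ‖q.1‖ - L} :=
    (isOpen_lt (f := fun _ : E3 × ℝ => R) (g := fun q => ‖q.1‖) (by fun_prop) (by fun_prop)).inter
      (isOpen_lt (f := fun q : E3 × ℝ => q.2) (g := fun q => ‖q.1‖ - L) (by fun_prop) (by fun_prop))
  have hev : v =ᶠ[𝓝 p] fun _ => 0 := by
    filter_upwards [ho.mem_nhds ⟨hp, hlt⟩] with q hq using hearly q hq.1.le hq.2.le
  rw [hev.fderiv_eq]
  simp

theorem fluxDensity_continuous (hv : ContDiff ℝ ∞ v) (hA : 0 < A) :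
    Continuous (fluxDensity A m v) := by
  have h1 : ∀ w, Continuous fun p => fderiv ℝ v p w := fun w =>
    (by fun_prop : ContDiff ℝ ∞ fun p => fderiv ℝ v p w).continuous
  have h2 := (coneGap_contDiff (m := m) hA).continuous
  have h3 : ∀ p : E3 × ℝ, √(A + m ^ 2 * ‖p.1‖ ^ 2) ≠ 0 := fun p => by positivity
  unfold fluxDensity energyDensity
  fun_prop (disch := intros; solve_by_elim)

/-- The error term of the energy identity stays bounded as the cutoff tends to the exterior of the
ball. -/
theorem exists_flux_error_bound (hv : ContDiff ℝ ∞ v) (hR : 0 < R) (hA : 0 < A)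
    (hT : A + m ^ 2 * R ^ 2 < T ^ 2) (hT0 : 0 < T)
    (hzero : ∀ x t, ‖x‖ = R → t < T → v (x, t) = 0) (M a b : ℝ) :
    ∃ C ε₀ : ℝ, 0 < ε₀ ∧ ∀ ε ∈ Ioc 0 ε₀, ∀ p ∈ Metric.closedBall (0 : E3) M ×ˢ Icc a b,
      ‖max (coneGap A m p) 0 ^ 2 * (fderiv ℝ v p (0, 1) *
        (deriv Real.smoothTransition ((‖p.1‖ ^ 2 - R ^ 2) / ε) *
          (2 / ε * ∑ i, p.1 i * fderiv ℝ v p (spaceDir i))))‖ ≤ C := by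
  set K := Metric.closedBall (0 : E3) M ×ˢ Icc a b with hK
  have hKc : IsCompact K := (isCompact_closedBall _ _).prod isCompact_Icc
  have hKconv : Convex ℝ K := (convex_closedBall _ _).prod (convex_Icc _ _)
  have hvw : ∀ w, ContDiff ℝ ∞ fun p => fderiv ℝ v p w := fun w => by fun_prop
  obtain ⟨C1, hC1⟩ := hKc.exists_bound_of_continuousOn
    (f := fun p : E3 × ℝ => max (coneGap A m p) 0 ^ 2)
    (by have := (coneGap_contDiff (m := m) hA).continuous; fun_prop)
  obtain ⟨C2, hC2⟩ := hKc.exists_bound_of_continuousOn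
    (f := fun p : E3 × ℝ => ∑ i, p.1 i * fderiv ℝ v p (spaceDir i))
    (by have := fun w => (hvw w).continuous; fun_prop)
  obtain ⟨C3, hC3⟩ := (isCompact_Icc (a := (0 : ℝ)) (b := 1)).exists_bound_of_continuousOn
    (((Real.smoothTransition.contDiff (n := ⊤)).continuous_deriv (by simp)).continuousOn)
  obtain ⟨C4, hC4⟩ := hKc.exists_bound_of_continuousOn
    (f := fderiv ℝ fun p => fderiv ℝ v p (0, 1))
    ((hvw (0, 1)).continuous_fderiv (by simp)).continuousOn
  have hC30 : 0 ≤ C3 := (norm_nonneg _).trans (hC3 0 (by simp))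
  -- With this `ε₀`, `|x|² < R² + ε` implies `A + m²|x|² < T²`, so all points that contribute have
  -- `t < T`, where the boundary condition holds.
  refine ⟨|C1| * (|C4| / R * (C3 * (2 * |C2|))), (T ^ 2 - (A + m ^ 2 * R ^ 2)) / (m ^ 2 + 1),
    by apply div_pos <;> nlinarith [sq_nonneg m], fun ε hε p hp => ?_⟩
  have hε0 : 0 < ε := hε.1
  by_cases hs : (‖p.1‖ ^ 2 - R ^ 2) / ε ≤ 0 ∨ 1 ≤ (‖p.1‖ ^ 2 - R ^ 2) / ε
  · rw [deriv_smoothTransition_eq_zero hs]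
    simp only [zero_mul, mul_zero, norm_zero]
    positivity
  by_cases hg : coneGap A m p ≤ 0
  · rw [max_eq_right hg]
    simp only [ne_eq, OfNat.ofNat_ne_zero, not_false_eq_true, zero_pow, zero_mul, norm_zero]
    positivity
  push Not at hs hg
  have hs1 : R ^ 2 < ‖p.1‖ ^ 2 := by
    have := (lt_div_iff₀ hε0).1 hs.1
    linarith
  have hs2 : ‖p.1‖ ^ 2 - R ^ 2 < ε := by
    have := (div_lt_iff₀ hε0).1 hs.2
    linarith
  have hx : R < ‖p.1‖ := lt_of_pow_lt_pow_left₀ 2 (norm_nonneg _) hs1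
  have hx0 : 0 < ‖p.1‖ := hR.trans hx
  have htT : p.2 < T := by
    have h1 : √(A + m ^ 2 * ‖p.1‖ ^ 2) < T := by
      rw [Real.sqrt_lt' hT0]
      have h2 := (le_div_iff₀ (by positivity)).1 hε.2
      have h3 : m ^ 2 * (‖p.1‖ ^ 2 - R ^ 2) ≤ m ^ 2 * ε := by gcongr
      nlinarith
    unfold coneGap at hg
    linarith
  -- At the radial projection to the sphere `∂ₜv = 0`, because `v` vanishes there for all times
  -- before `T`. Hence `∂ₜv = O(ε)` at `p`, which compensates the factor `2 / ε`.
  set p' : E3 × ℝ := ((R / ‖p.1‖) • p.1, p.2) with hp'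
  have hn' : ‖(R / ‖p.1‖) • p.1‖ = R := by
    rw [norm_smul, Real.norm_of_nonneg (by positivity)]; field_simp
  have hp'K : p' ∈ K := by
    refine ⟨?_, hp.2⟩
    rw [mem_closedBall_zero_iff, hn']
    exact hx.le.trans (mem_closedBall_zero_iff.1 hp.1)
  have hv' : fderiv ℝ v p' (0, 1) = 0 := by
    have h1 := (hv.differentiable (by simp) p').hasFDerivAt.comp_hasDerivAt p.2
      ((hasDerivAt_const p.2 ((R / ‖p.1‖) • p.1)).prodMk (hasDerivAt_id p.2))
    have h2 : (fun t => v ((R / ‖p.1‖) • p.1, t)) =ᶠ[𝓝 p.2] fun _ => 0 := by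
      filter_upwards [Iio_mem_nhds htT] with t ht using hzero _ _ hn' ht
    have h3 := h1.deriv
    have h4 := h2.deriv_eq
    rw [deriv_const] at h4
    exact h3.symm.trans h4
  have hlip := hKconv.norm_image_sub_le_of_norm_fderiv_le
    (fun q _ => (hvw (0, 1)).differentiable (by simp) q) hC4 hp'K hp
  have hdist : ‖p - p'‖ ≤ ε / R := by
    have h1 : ‖p - p'‖ = ‖p.1‖ - R := by
      have h2 : p - p' = ((1 - R / ‖p.1‖) • p.1, 0) := by
        ext1
        · simp [hp', sub_smul]
        · simp [hp']
      have h3 : 0 ≤ 1 - R / ‖p.1‖ := by rw [sub_nonneg, div_le_one hx0]; exact hx.le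
      rw [h2, Prod.norm_def]
      simp only [norm_zero, norm_smul, Real.norm_of_nonneg h3]
      rw [max_eq_left (by positivity)]
      field_simp
    rw [h1, le_div_iff₀ hR]
    nlinarith
  have hvt : ‖fderiv ℝ v p (0, 1)‖ ≤ |C4| * (ε / R) := by
    rw [hv', sub_zero] at hlip
    exact hlip.trans (mul_le_mul (le_abs_self _) hdist (norm_nonneg _) (abs_nonneg _))
  have hst := hC3 _ ⟨hs.1.le, hs.2.le⟩
  rw [norm_mul, norm_mul, norm_mul, norm_mul, norm_div, Real.norm_ofNat, Real.norm_of_nonneg hε0.le]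
  calc _ ≤ |C1| * (|C4| * (ε / R) * (C3 * (2 / ε * |C2|))) := by
        gcongr
        · exact (hC1 p hp).trans (le_abs_self _)
        · exact (hC2 p hp).trans (le_abs_self _)
    _ = |C1| * (|C4| / R * (C3 * (2 * |C2|))) := by field_simp

/-- As `ε → 0` the cutoff tends to the indicator of the exterior. The error term is bounded on a
fixed compact set and vanishes at each point once `ε` is small, so dominated convergence removes it.
-/
theorem setIntegral_fluxDensity_eq_zero (hv : ContDiff ℝ ∞ v) (hR : 0 < R) (hA : 0 < A)
    (hm : 0 < m) (hm1 : m < 1) (hT : A + m ^ 2 * R ^ 2 < T ^ 2) (hT0 : 0 < T)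
    (hwave : ∀ p, R < ‖p.1‖ → waveOperator v p = 0)
    (hzero : ∀ x t, ‖x‖ = R → t < T → v (x, t) = 0)
    (hearly : ∀ p : E3 × ℝ, R ≤ ‖p.1‖ → p.2 ≤ ‖p.1‖ - L → v p = 0) :
    IntegrableOn (fluxDensity A m v) {p : E3 × ℝ | R < ‖p.1‖} ∧
      ∫ p in {p : E3 × ℝ | R < ‖p.1‖}, fluxDensity A m v p = 0 := by
  obtain ⟨M, a, b, hK⟩ := exists_convex_compact hA hm hm1 hearly
  obtain ⟨C, ε₀, hε₀, hC⟩ := exists_flux_error_bound hv hR hA hT hT0 hzero M a b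
  set K := Metric.closedBall (0 : E3) M ×ˢ Icc a b with hKdef
  have hKc : IsCompact K := (isCompact_closedBall _ _).prod isCompact_Icc
  set U : Set (E3 × ℝ) := {p : E3 × ℝ | R < ‖p.1‖} with hU
  have hUo : IsOpen U := isOpen_lt (f := fun _ : E3 × ℝ => R) (g := fun q => ‖q.1‖)
    (by fun_prop) (by fun_prop)
  have hfc := fluxDensity_continuous (m := m) hv hA
  have hflux0 : ∀ p, p ∉ K → R < ‖p.1‖ → fluxDensity A m v p = 0 := by
    intro p hp hpR
    by_cases hg : 0 < coneGap A m p
    · simp [fluxDensity, energyDensity, hK p hpR hg hp]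
    · simp [fluxDensity, max_eq_right (not_lt.1 hg)]
  have hint : Integrable (U.indicator (fluxDensity A m v)) := by
    have h1 : U.indicator (fluxDensity A m v) = K.indicator (U.indicator (fluxDensity A m v)) := by
      funext p
      by_cases hp : p ∈ K
      · rw [indicator_of_mem hp]
      · rw [indicator_of_notMem hp]
        by_cases hpU : p ∈ U
        · rw [indicator_of_mem hpU, hflux0 p hp hpU]
        · rw [indicator_of_notMem hpU]
    rw [h1, integrable_indicator_iff hKc.measurableSet]
    exact (hfc.continuousOn.integrableOn_compact hKc).indicator hUo.measurableSet
  refine ⟨(integrable_indicator_iff hUo.measurableSet).1 hint, ?_⟩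
  rw [← integral_indicator hUo.measurableSet]
  obtain ⟨Cf, hCf⟩ := hKc.exists_bound_of_continuousOn hfc.continuousOn
  set X : ℝ → E3 × ℝ → ℝ := fun ε p =>
    Real.smoothTransition ((‖p.1‖ ^ 2 - R ^ 2) / ε) * fluxDensity A m v p
      + max (coneGap A m p) 0 ^ 2 * (fderiv ℝ v p (0, 1) *
        (deriv Real.smoothTransition ((‖p.1‖ ^ 2 - R ^ 2) / ε) *
          (2 / ε * ∑ i, p.1 i * fderiv ℝ v p (spaceDir i)))) with hX
  have hin : ∀ ε > 0, ∀ p : E3 × ℝ, ‖p.1‖ ≤ R → X ε p = 0 := by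
    intro ε hε p hp
    have h1 : (‖p.1‖ ^ 2 - R ^ 2) / ε ≤ 0 := by
      refine div_nonpos_of_nonpos_of_nonneg ?_ hε.le
      nlinarith [norm_nonneg p.1]
    simp [hX, Real.smoothTransition.zero_of_nonpos h1, deriv_smoothTransition_eq_zero (Or.inl h1)]
  have hlim : Tendsto (fun ε => ∫ p, X ε p) (𝓝[>] 0)
      (𝓝 (∫ p, U.indicator (fluxDensity A m v) p)) := by
    refine tendsto_integral_filter_of_dominated_convergence (K.indicator fun _ => |Cf| + C)
      ?_ ?_ ?_ ?_
    · refine Eventually.of_forall fun ε => Continuous.aestronglyMeasurable ?_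
      have h1 : ∀ w, Continuous fun p => fderiv ℝ v p w := fun w =>
        (by fun_prop : ContDiff ℝ ∞ fun p => fderiv ℝ v p w).continuous
      have h2 := (coneGap_contDiff (m := m) hA).continuous
      have h3 : Continuous (deriv Real.smoothTransition) :=
        (Real.smoothTransition.contDiff (n := ⊤)).continuous_deriv (by simp)
      have h4 : Continuous Real.smoothTransition := Real.smoothTransition.continuous
      fun_prop
    · filter_upwards [Ioc_mem_nhdsGT hε₀] with ε hε
      refine ae_of_all _ fun p => ?_
      by_cases hp : p ∈ K
      · rw [indicator_of_mem hp]
        refine (norm_add_le _ _).trans (add_le_add ?_ (hC ε hε p hp))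
        rw [norm_mul, Real.norm_of_nonneg (Real.smoothTransition.nonneg _)]
        exact (mul_le_of_le_one_left (norm_nonneg _) (Real.smoothTransition.le_one _)).trans
          ((hCf p hp).trans (le_abs_self _))
      · rw [indicator_of_notMem hp, norm_le_zero_iff]
        rcases le_or_gt ‖p.1‖ R with hpR | hpR
        · exact hin ε hε.1 p hpR
        · by_cases hg : 0 < coneGap A m p
          · simp [hX, fluxDensity, energyDensity, hK p hpR hg hp]
          · simp [hX, fluxDensity, max_eq_right (not_lt.1 hg)]
    · exact (integrable_indicator_iff hKc.measurableSet).2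
        (integrableOn_const hKc.measure_lt_top.ne)
    · refine ae_of_all _ fun p => ?_
      refine tendsto_const_nhds.congr' ?_
      rcases le_or_gt ‖p.1‖ R with hpR | hpR
      · filter_upwards [self_mem_nhdsWithin] with ε hε
        rw [hin ε hε p hpR, indicator_of_notMem]
        exact not_lt.2 hpR
      · have hd : 0 < ‖p.1‖ ^ 2 - R ^ 2 := by nlinarith
        filter_upwards [Ioc_mem_nhdsGT hd] with ε hε
        have h1 : 1 ≤ (‖p.1‖ ^ 2 - R ^ 2) / ε := by rw [le_div_iff₀ hε.1, one_mul]; exact hε.2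
        rw [indicator_of_mem (show p ∈ U from hpR)]
        simp [hX, Real.smoothTransition.one_of_one_le h1,
          deriv_smoothTransition_eq_zero (Or.inr h1)]
  refine tendsto_nhds_unique hlim (tendsto_const_nhds.congr' ?_)
  filter_upwards [self_mem_nhdsWithin] with ε hε
  exact (integral_flux_identity hv hA hε hR.le hwave hKc fun p hp hpR hg => hK p hpR hg hp).symm

/-- Uniqueness for the exterior Dirichlet problem of the wave equation: a solution outside the ball
`|x| < R` that vanishes early and on `|x| = R`, `t < T`, vanishes below every hyperboloid that meets
the sphere before the time `T`. -/
theorem exterior_eq_zero (hv : ContDiff ℝ ∞ v) (hR : 0 < R) (hA : 0 < A)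
    (hm : 0 < m) (hm1 : m < 1) (hT : A + m ^ 2 * R ^ 2 < T ^ 2) (hT0 : 0 < T)
    (hwave : ∀ p, R < ‖p.1‖ → waveOperator v p = 0)
    (hzero : ∀ x t, ‖x‖ = R → t < T → v (x, t) = 0)
    (hearly : ∀ p : E3 × ℝ, R ≤ ‖p.1‖ → p.2 ≤ ‖p.1‖ - L → v p = 0)
    {p : E3 × ℝ} (hp : R < ‖p.1‖) (hpg : 0 < coneGap A m p) : v p = 0 := by
  obtain ⟨hi, h0⟩ := setIntegral_fluxDensity_eq_zero hv hR hA hm hm1 hT hT0 hwave hzero hearly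
  have hUo : IsOpen {p : E3 × ℝ | R < ‖p.1‖} := isOpen_lt (f := fun _ : E3 × ℝ => R)
    (g := fun q => ‖q.1‖) (by fun_prop) (by fun_prop)
  have hnn : ∀ p, 0 ≤ fluxDensity A m v p := fun p =>
    le_trans (by have := energyDensity_nonneg v p; have : 0 ≤ 1 - m := by linarith
                 positivity) (le_fluxDensity hA hm p)
  have hae := (integral_eq_zero_iff_of_nonneg hnn hi).1 h0
  -- A nonnegative density with zero integral vanishes almost everywhere, and by continuity
  -- everywhere in the exterior.
  have heq := Measure.eqOn_open_of_ae_eq hae hUo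
    (fluxDensity_continuous (m := m) hv hA).continuousOn continuousOn_const
  have hvt : ∀ q : E3 × ℝ, R < ‖q.1‖ → 0 < coneGap A m q → fderiv ℝ v q (0, 1) = 0 := by
    intro q hq hqg
    have h1 : fluxDensity A m v q = 0 := heq hq
    have h2 := le_fluxDensity (v := v) hA hm q
    rw [h1, max_eq_left hqg.le] at h2
    have h3 : energyDensity v q ≤ 0 := by
      by_contra! h
      have : 0 < 1 - m := by linarith
      have : 0 < 2 * coneGap A m q * ((1 - m) * energyDensity v q) := by positivity
      linarith
    unfold energyDensity at h3
    have h4 : 0 ≤ ∑ i, fderiv ℝ v q (spaceDir i) ^ 2 := Finset.sum_nonneg fun i _ => sq_nonneg _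
    have h5 : fderiv ℝ v q (0, 1) ^ 2 ≤ 0 := by linarith
    exact pow_eq_zero_iff two_ne_zero |>.1 (le_antisymm h5 (sq_nonneg _))
  obtain ⟨x, t⟩ := p
  rcases le_or_gt t (‖x‖ - L) with ht | ht
  · exact hearly (x, t) hp.le ht
  have hder : ∀ s, HasDerivAt (fun s => v (x, s)) (fderiv ℝ v (x, s) (0, 1)) s := fun s =>
    (hv.differentiable (by simp) (x, s)).hasFDerivAt.comp_hasDerivAt s
      ((hasDerivAt_const s x).prodMk (hasDerivAt_id s))
  -- Start at time `‖x‖ - L`, where `v = 0`. The segment up to `t` stays below the hyperboloid,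
  -- where `∂ₜv = 0`.
  obtain ⟨s, hs, hs'⟩ := exists_hasDerivAt_eq_slope (fun s => v (x, s)) _ ht
    (fun s _ => (hder s).continuousAt.continuousWithinAt) fun s _ => hder s
  have hsg : 0 < coneGap A m (x, s) := by
    unfold coneGap at hpg ⊢
    simp only at hpg ⊢
    linarith [hs.2]
  rw [hvt (x, s) hp hsg, hearly (x, ‖x‖ - L) hp.le le_rfl, sub_zero, eq_comm,
    div_eq_zero_iff] at hs'
  rcases hs' with h | h
  · exact h
  · linarith

end ExteriorUniqueness

/-! ### Far fields and orthogonality to plane waves -/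

theorem tendsto_norm_smul_sub_div {ν : E3} (hν : ‖ν‖ = 1) (y : E3) :
    Tendsto (fun r : ℝ => ‖r • ν - y‖ / r) atTop (𝓝 1) := by
  have h1 : Tendsto (fun r : ℝ => ‖ν - r⁻¹ • y‖) atTop (𝓝 ‖ν - (0 : ℝ) • y‖) :=
    (tendsto_const_nhds.sub (tendsto_inv_atTop_zero.smul_const y)).norm
  rw [zero_smul, sub_zero, hν] at h1
  refine h1.congr' ?_
  filter_upwards [eventually_gt_atTop 0] with r hr
  have : ν - r⁻¹ • y = r⁻¹ • (r • ν - y) := by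
    rw [smul_sub, smul_smul, inv_mul_cancel₀ hr.ne', one_smul]
  rw [this, norm_smul, norm_inv, Real.norm_of_nonneg hr.le, div_eq_inv_mul]

/-- Rationalise: the difference is `(‖rν - y‖² - r²) / (‖rν - y‖ + r)`. -/
theorem tendsto_norm_smul_sub_sub {ν : E3} (hν : ‖ν‖ = 1) (y : E3) :
    Tendsto (fun r : ℝ => ‖r • ν - y‖ - r) atTop (𝓝 (-inner ℝ ν y)) := by
  have h1 : Tendsto (fun r : ℝ => (-2 * inner ℝ ν y + ‖y‖ ^ 2 * r⁻¹) / (‖r • ν - y‖ / r + 1)) atTop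
      (𝓝 ((-2 * inner ℝ ν y + ‖y‖ ^ 2 * 0) / (1 + 1))) :=
    (tendsto_const_nhds.add (tendsto_const_nhds.mul tendsto_inv_atTop_zero)).div
      ((tendsto_norm_smul_sub_div hν y).add_const 1) (by norm_num)
  rw [show (-2 * inner ℝ ν y + ‖y‖ ^ 2 * 0) / (1 + 1) = -inner ℝ ν y by ring] at h1
  refine h1.congr' ?_
  filter_upwards [eventually_gt_atTop 0] with r hr
  have h2 : ‖r • ν - y‖ ^ 2 = r ^ 2 - 2 * r * inner ℝ ν y + ‖y‖ ^ 2 := by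
    rw [norm_sub_sq_real, norm_smul, hν, inner_smul_left, Real.norm_of_nonneg hr.le]
    simp
    ring
  have h3 : 0 < ‖r • ν - y‖ + r := by positivity
  rw [div_eq_iff (by positivity)]
  field_simp
  linear_combination -h2

section FarField

variable {F u : E3 × ℝ → ℝ} {ψ : ℝ → ℝ} {c R T ρ₀ δ : ℝ}

/-- On the ray `(rν, r)` the phase `‖rν - y‖ - r + s` tends to `s - ν·y` and the amplitude `r / ‖rν
- y‖` to `1`; for large `r` the cutoff plays no role. -/
theorem tendsto_far_field (hF : Integrable F) {K : Set (E3 × ℝ)} (hK : IsCompact K)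
    (hFK : Function.support F ⊆ K) (hψ : Continuous ψ) (hδ : 0 < δ) {ν : E3} (hν : ‖ν‖ = 1) :
    Tendsto (fun r : ℝ => r * conv volume F (sphericalWave ψ δ) (r • ν, r)) atTop
      (𝓝 (∫ q, F q * ψ (q.2 - inner ℝ ν q.1))) := by
  obtain ⟨B, hB0, hB⟩ := hK.isBounded.exists_pos_norm_le
  have hBF : ∀ q, F q ≠ 0 → ‖q.1‖ ≤ B ∧ |q.2| ≤ B := fun q hq =>
    ⟨(norm_fst_le q).trans (hB q (hFK hq)), (norm_snd_le q).trans (hB q (hFK hq))⟩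
  obtain ⟨C, hC⟩ := (isCompact_Icc (a := -(2 * B)) (b := 2 * B)).exists_bound_of_continuousOn
    hψ.continuousOn
  have hfar : ∀ r, 2 * B + δ ≤ r → ∀ q : E3 × ℝ, F q ≠ 0 → r / 2 ≤ ‖r • ν - q.1‖ ∧
      |‖r • ν - q.1‖ - r| ≤ B ∧ δ ≤ ‖r • ν - q.1‖ := by
    intro r hr q hq
    have hr0 : 0 < r := by linarith
    have h1 := (hBF q hq).1
    have h2 : ‖r • ν‖ = r := by rw [norm_smul, hν, Real.norm_of_nonneg hr0.le, mul_one]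
    have h3 := norm_sub_norm_le (r • ν) q.1
    have h4 := norm_sub_le (r • ν) q.1
    rw [h2] at h3 h4
    refine ⟨by linarith, abs_le.2 ⟨by linarith, by linarith⟩, by linarith⟩
  have hev : ∀ᶠ r : ℝ in atTop, ∫ q, F q * (r / ‖r • ν - q.1‖ * ψ (‖r • ν - q.1‖ - r + q.2))
      = r * conv volume F (sphericalWave ψ δ) (r • ν, r) := by
    filter_upwards [eventually_ge_atTop (2 * B + δ)] with r hr
    rw [conv, ← integral_const_mul]
    congr 1
    funext q
    by_cases hq : F q = 0
    · simp [hq]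
    have h := hfar r hr q hq
    rw [sphericalWave_of_le (p := (r • ν, r) - q) hδ h.2.2]
    simp only [Prod.fst_sub, Prod.snd_sub]
    rw [show ‖r • ν - q.1‖ - (r - q.2) = ‖r • ν - q.1‖ - r + q.2 by ring]
    ring
  refine Tendsto.congr' hev ?_
  refine tendsto_integral_filter_of_dominated_convergence (fun q => ‖F q‖ * (2 * |C|)) ?_ ?_
    (hF.norm.mul_const _) ?_
  · refine Eventually.of_forall fun r => hF.aestronglyMeasurable.mul ?_
    have := hψ.measurable
    exact (by fun_prop : Measurable fun q : E3 × ℝ =>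
      r / ‖r • ν - q.1‖ * ψ (‖r • ν - q.1‖ - r + q.2)).aestronglyMeasurable
  · filter_upwards [eventually_ge_atTop (2 * B + δ)] with r hr
    refine ae_of_all _ fun q => ?_
    by_cases hq : F q = 0
    · simp [hq]
    have hr0 : 0 < r := by linarith
    obtain ⟨h1, h2, h3⟩ := hfar r hr q hq
    have h4 := abs_le.1 h2
    have h5 := abs_le.1 (hBF q hq).2
    rw [norm_mul, norm_mul]
    gcongr
    · rw [norm_div, norm_norm, Real.norm_of_nonneg hr0.le, div_le_iff₀ (by linarith)]
      linarith
    · exact (hC _ ⟨by linarith [h4.1, h5.1], by linarith [h4.2, h5.2]⟩).trans (le_abs_self _)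
  · refine ae_of_all _ fun q => Tendsto.const_mul _ ?_
    have h1 : Tendsto (fun r : ℝ => r / ‖r • ν - q.1‖) atTop (𝓝 1) := by
      have := (tendsto_norm_smul_sub_div hν q.1).inv₀ one_ne_zero
      simpa using this
    have h2 := (hψ.tendsto _).comp ((tendsto_norm_smul_sub_sub hν q.1).add_const q.2)
    have h3 := h1.mul h2
    rw [one_mul, show -inner ℝ ν q.1 + q.2 = q.2 - inner ℝ ν q.1 by ring] at h3
    exact h3

/-- Put `A + m²R² = R² + d`, halfway between `R²` and `T²`, and `m² = 1 - η`. Then `A + m²r² - r² =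
d + ηR² - ηr²`, positive as soon as `ηr² < d`. -/
theorem exists_cone_parameters {R T r : ℝ} (hR : 0 < R) (hT : R < T) (hr : 0 < r) :
    ∃ A m : ℝ, 0 < A ∧ 0 < m ∧ m < 1 ∧ A + m ^ 2 * R ^ 2 < T ^ 2 ∧ r < √(A + m ^ 2 * r ^ 2) := by
  set d := (T ^ 2 - R ^ 2) / 2 with hd
  have hd0 : 0 < d := by rw [hd]; nlinarith
  set η := d / (d + r ^ 2) / 2 with hη
  have hη0 : 0 < η := by positivity
  have hη1 : η < 1 := by
    have : d / (d + r ^ 2) ≤ 1 := by rw [div_le_one (by positivity)]; nlinarith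
    rw [hη]; linarith
  have hηr : η * r ^ 2 < d := by
    rw [hη, div_div, div_mul_eq_mul_div, div_lt_iff₀ (by positivity)]
    nlinarith [mul_pos hd0 hd0, mul_pos hd0 (pow_pos hr 2)]
  have hm2 : √(1 - η) ^ 2 = 1 - η := Real.sq_sqrt (by linarith)
  refine ⟨R ^ 2 + d - (1 - η) * R ^ 2, √(1 - η), by nlinarith [mul_pos hη0 (pow_pos hR 2)],
    Real.sqrt_pos.2 (by linarith), ?_, ?_, ?_⟩
  · rw [Real.sqrt_lt' one_pos]; linarith
  · rw [hm2, hd]; nlinarith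
  · rw [hm2]
    apply Real.lt_sqrt_of_sq_lt
    nlinarith [mul_pos hη0 (pow_pos hR 2)]

/-- A source whose wave has zero trace on the sphere is orthogonal to the plane waves that leave the
ball before the end of the observation. -/
theorem integral_mul_plane_wave_eq_zero (hu : IsWeakWaveSolution F u)
    (hF : Integrable F) {K : Set (E3 × ℝ)} (hK : IsCompact K) (hFK : Function.support F ⊆ K)
    (hFt : ∀ q, F q ≠ 0 → 0 ≤ q.2) (hFx : ∀ q, F q ≠ 0 → ‖q.1‖ ≤ ρ₀) (hR : 0 < R)
    (hρ₀ : ρ₀ < R) (hψ : ContDiff ℝ ∞ ψ) (hψc : ∀ s, c ≤ s → ψ s = 0) (hc : c < T - R)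
    (htr : Tendsto (fun ε : ℝ => (ENNReal.ofReal ε)⁻¹ * ∫⁻ p in sphericalShell R T ε, ‖u p‖ₑ)
      (𝓝[>] 0) (𝓝 0)) {ν : E3} (hν : ‖ν‖ = 1) :
    ∫ q, F q * ψ (q.2 - inner ℝ ν q.1) = 0 := by
  set δ := (R - ρ₀) / 2 with hδdef
  have hδ : 0 < δ := by rw [hδdef]; linarith
  set v := conv volume F (sphericalWave ψ δ) with hvdef
  have hv : ContDiff ℝ ∞ v := conv_contDiff hF hK hFK (sphericalWave_contDiff hψ hδ)
  have hzero : ∀ x t, ‖x‖ = R → t < T - c → v (x, t) = 0 := fun x t hx ht =>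
    conv_sphericalWave_eq_zero_on_sphere hu hF hK hFK hFt hψ hψc hδ hR hFx (by rw [hδdef]; linarith)
      htr hx ht
  have hwave : ∀ p, R < ‖p.1‖ → waveOperator v p = 0 := by
    intro p hp
    rw [hvdef, conv_waveOperator hF hK hFK (sphericalWave_contDiff hψ hδ)]
    refine integral_eq_zero_of_ae (ae_of_all _ fun q => ?_)
    by_cases hq : F q = 0
    · simp [hq]
    have h1 := hFx q hq
    have h2 := norm_sub_norm_le p.1 q.1
    simp only
    rw [waveOperator_sphericalWave_eq_zero (p := p - q) hψ hδ (by rw [Prod.fst_sub]; linarith),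
      mul_zero]
    rfl
  -- The source lies in `|x| ≤ ρ₀`, `t ≥ 0`, so the argument of `ψ` is at least `|x| - ρ₀ - t`.
  have hearly : ∀ p : E3 × ℝ, R ≤ ‖p.1‖ → p.2 ≤ ‖p.1‖ - (ρ₀ + c) → v p = 0 := by
    intro p hp hpt
    refine integral_eq_zero_of_ae (ae_of_all _ fun q => ?_)
    by_cases hq : F q = 0
    · simp [hq]
    have h1 := hFx q hq
    have h2 := norm_sub_norm_le p.1 q.1
    have h3 := hFt q hq
    have h4 : ψ (‖(p - q).1‖ - (p - q).2) = 0 := by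
      apply hψc
      simp only [Prod.fst_sub, Prod.snd_sub]
      linarith
    simp only [sphericalWave, h4, mul_zero, Pi.zero_apply]
  refine tendsto_nhds_unique (tendsto_far_field hF hK hFK hψ.continuous hδ hν)
    (tendsto_const_nhds.congr' ?_)
  filter_upwards [eventually_gt_atTop R] with r hr
  have hr0 : 0 < r := hR.trans hr
  -- The hyperboloid depends on `r`; it exists because `T - c > R`, and it passes above `(rν, r)`.
  obtain ⟨A, m, hA, hm, hm1, hT, hg⟩ := exists_cone_parameters hR (T := T - c) (by linarith) hr0
  have hrν : ‖r • ν‖ = r := by rw [norm_smul, hν, Real.norm_of_nonneg hr0.le, mul_one]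
  have h := exterior_eq_zero hv hR hA hm hm1 hT (by linarith) hwave hzero hearly
    (p := (r • ν, r)) (by rwa [hrν]) (by unfold coneGap; rw [hrν]; linarith)
  rw [← hvdef, h, mul_zero]

end FarField

/-! ### Moments of the horizontal factor by tilting the direction -/

theorem exists_taylor_bound {ψ : ℝ → ℝ} (hψ : ContDiff ℝ ∞ ψ) (M : ℕ) (B D : ℝ) :
    ∃ C, 0 ≤ C ∧ ∀ x δ : ℝ, |x| ≤ B → |δ| ≤ D →
      |ψ (x + δ) - ∑ n ∈ Finset.range (M + 1), iteratedDeriv n ψ x * δ ^ n / n.factorial|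
        ≤ C * |δ| ^ (M + 1) := by
  obtain ⟨C, hC⟩ := (isCompact_Icc (a := -(B + D)) (b := B + D)).exists_bound_of_continuousOn
    ((hψ.continuous_iteratedDeriv (M + 1) (mod_cast le_top)).continuousOn)
  refine ⟨|C|, abs_nonneg _, fun x δ hx hδ => ?_⟩
  have hx' := abs_le.1 hx
  have hδ' := abs_le.1 hδ
  by_cases h0 : δ = 0
  · subst h0
    rw [Finset.sum_range_succ']
    simp
  obtain ⟨y, hy, hyeq⟩ := taylor_mean_remainder_lagrange_iteratedDeriv (f := ψ) (x := x + δ)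
    (x₀ := x) (n := M) (by simpa using h0) ((hψ.of_le (mod_cast le_top)).contDiffOn)
  have htay : taylorWithinEval ψ M (uIcc x (x + δ)) x (x + δ)
      = ∑ n ∈ Finset.range (M + 1), iteratedDeriv n ψ x * δ ^ n / n.factorial := by
    rw [taylor_within_apply]
    refine Finset.sum_congr rfl fun n _ => ?_
    have hU : UniqueDiffOn ℝ (uIcc x (x + δ)) := uniqueDiffOn_Icc (by simpa using h0)
    rw [iteratedDerivWithin_eq_iteratedDeriv hU (hψ.of_le (mod_cast le_top)).contDiffAt
      left_mem_uIcc, smul_eq_mul, add_sub_cancel_left]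
    ring
  rw [← htay, hyeq, add_sub_cancel_left, abs_div, abs_mul, abs_pow]
  have hyB : y ∈ Icc (-(B + D)) (B + D) := by
    have h1 : y ∈ uIcc x (x + δ) := uIoo_subset_uIcc_self hy
    rcases mem_uIcc.1 h1 with h | h <;> constructor <;> linarith
  have h2 : |iteratedDeriv (M + 1) ψ y| ≤ |C| := (hC y hyB).trans (le_abs_self _)
  have h3 : (1 : ℝ) ≤ |((M + 1).factorial : ℝ)| := by
    rw [Nat.abs_cast]; exact_mod_cast Nat.one_le_iff_ne_zero.2 (Nat.factorial_ne_zero _)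
  calc _ ≤ |iteratedDeriv (M + 1) ψ y| * |δ| ^ (M + 1) := div_le_self (by positivity) h3
    _ ≤ |C| * |δ| ^ (M + 1) := by gcongr

/-- Integrate from `c`: the primitive that starts there stays zero on `[c, ∞)`, so the support
condition survives every step. -/
theorem exists_iteratedDeriv_eq {c : ℝ} (n : ℕ) : ∀ {χ : ℝ → ℝ}, ContDiff ℝ ∞ χ →
    (∀ s, c ≤ s → χ s = 0) →
    ∃ ψ : ℝ → ℝ, ContDiff ℝ ∞ ψ ∧ (∀ s, c ≤ s → ψ s = 0) ∧ iteratedDeriv n ψ = χ := by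
  induction n with
  | zero => exact fun {χ} hχ hc => ⟨χ, hχ, hc, iteratedDeriv_zero⟩
  | succ n ih =>
    intro χ hχ hc
    have hder : ∀ s, HasDerivAt (fun s => ∫ r in c..s, χ r) (χ s) s := fun s =>
      (hχ.continuous.integral_hasStrictDerivAt c s).hasDerivAt
    have hΦ : ContDiff ℝ ∞ fun s => ∫ r in c..s, χ r := by
      rw [contDiff_infty_iff_deriv]
      refine ⟨fun s => (hder s).differentiableAt, ?_⟩
      rw [show deriv (fun s => ∫ r in c..s, χ r) = χ from funext fun s => (hder s).deriv]
      exact hχ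
    obtain ⟨ψ, hψ, hψc, hψn⟩ := ih hΦ fun s hs => by
      rw [intervalIntegral.integral_congr (g := fun _ => 0)]
      · simp
      · intro r hr
        rw [uIcc_of_le hs] at hr
        exact hc r hr.1
    refine ⟨ψ, hψ, hψc, ?_⟩
    rw [iteratedDeriv_succ, hψn]
    exact funext fun s => (hder s).deriv

theorem contDiff_iteratedDeriv {ψ : ℝ → ℝ} (hψ : ContDiff ℝ ∞ ψ) (n : ℕ) :
    ContDiff ℝ ∞ (iteratedDeriv n ψ) := by
  induction n with
  | zero => rwa [iteratedDeriv_zero]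
  | succ n ih =>
    rw [iteratedDeriv_succ]
    exact (contDiff_infty_iff_deriv.1 ih).2

theorem integrable_mul_of_bound_on_support {Ω : Type*} [MeasurableSpace Ω]
    {μ : Measure Ω} {f g : Ω → ℝ} (hf : Integrable f μ)
    (hg : AEStronglyMeasurable g μ) {C : ℝ} (hC : ∀ x, f x ≠ 0 → |g x| ≤ C) :
    Integrable (fun x => f x * g x) μ := by
  refine (hf.norm.mul_const C).mono' (hf.aestronglyMeasurable.mul hg) (ae_of_all _ fun x => ?_)
  by_cases hx : f x = 0
  · simp [hx]
  · rw [norm_mul]; gcongr; exact hC x hx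

section Moments

variable {Ω : Type*} [MeasurableSpace Ω] {μ : Measure Ω} {f a σ : Ω → ℝ} {h : ℝ → ℝ}
  {B s₀ : ℝ}

theorem integrable_mul_pow_mul_comp (hf : Integrable f μ) (ha : Measurable a) (hσ : Measurable σ)
    (haB : ∀ x, f x ≠ 0 → |a x| ≤ B) (hσB : ∀ x, f x ≠ 0 → |σ x| ≤ B) {χ : ℝ → ℝ}
    (hχ : Continuous χ) (i : ℕ) : Integrable (fun x => f x * (a x ^ i * χ (σ x))) μ := by
  obtain ⟨C, hC⟩ := (isCompact_Icc (a := -B) (b := B)).exists_bound_of_continuousOn hχ.continuousOn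
  have hχm := hχ.measurable
  refine integrable_mul_of_bound_on_support hf (by fun_prop) (C := B ^ i * C) fun x hx => ?_
  rw [abs_mul, abs_pow]
  have h1 := haB x hx
  have h2 : |χ (σ x)| ≤ C := hC _ (abs_le.1 (hσB x hx))
  have h3 : 0 ≤ B := (abs_nonneg _).trans h1
  gcongr

variable [SFinite μ]

/-- The expansion of `∫ f h ψ(σ + q a - z s)` in powers of `q` and `z`. -/
theorem abs_moment_expansion_le (hf : Integrable f μ) (ha : Measurable a) (hσ : Measurable σ)
    (haB : ∀ x, f x ≠ 0 → |a x| ≤ B) (hσB : ∀ x, f x ≠ 0 → |σ x| ≤ B) (hh : Integrable h)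
    (hhB : ∀ s, h s ≠ 0 → |s| ≤ B) (hB : 0 ≤ B) {ψ : ℝ → ℝ} (hψ : ContDiff ℝ ∞ ψ) (M : ℕ) :
    ∃ C, ∀ q z t : ℝ, |t| ≤ 1 → |q| ≤ 2 * |t| → |z| ≤ 2 * |t| →
      ∫ p : Ω × ℝ, f p.1 * h p.2 * ψ (σ p.1 + (q * a p.1 - z * p.2)) ∂(μ.prod volume) = 0 →
      |∑ n ∈ Finset.range (M + 1), ∑ i ∈ Finset.range (n + 1),
        (n.choose i / n.factorial * ((∫ x, f x * (a x ^ i * iteratedDeriv n ψ (σ x)) ∂μ) *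
          ∫ s, h s * s ^ (n - i))) * (q ^ i * (-z) ^ (n - i))| ≤ C * |t| ^ (M + 1) := by
  obtain ⟨C, hC0, hC⟩ := exists_taylor_bound hψ M B (4 * B)
  refine ⟨(∫ p : Ω × ℝ, ‖f p.1 * h p.2‖ ∂(μ.prod volume)) * (C * (4 * B) ^ (M + 1)),
    fun q z t ht hq hz h0 => ?_⟩
  have hD : ∀ n, Continuous (iteratedDeriv n ψ) := fun n =>
    hψ.continuous_iteratedDeriv n (mod_cast le_top)
  have hfi : ∀ n i, Integrable (fun x => f x * (a x ^ i * iteratedDeriv n ψ (σ x))) μ := fun n i =>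
    integrable_mul_pow_mul_comp hf ha hσ haB hσB (hD n) i
  have hhi : ∀ l, Integrable fun s => h s * s ^ l := fun l =>
    integrable_mul_of_bound_on_support hh (by fun_prop) (C := B ^ l) fun s hs => by
      rw [abs_pow]; gcongr; exact hhB s hs
  have hfh : Integrable (fun p : Ω × ℝ => f p.1 * h p.2) (μ.prod volume) := hf.mul_prod hh
  set S : Ω × ℝ → ℝ := fun p => ∑ n ∈ Finset.range (M + 1), ∑ i ∈ Finset.range (n + 1),
    (n.choose i / n.factorial * (q ^ i * (-z) ^ (n - i))) *
      ((f p.1 * (a p.1 ^ i * iteratedDeriv n ψ (σ p.1))) * (h p.2 * p.2 ^ (n - i))) with hS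
  have hterm : ∀ n i, Integrable (fun p : Ω × ℝ =>
      (n.choose i / n.factorial * (q ^ i * (-z) ^ (n - i))) *
      ((f p.1 * (a p.1 ^ i * iteratedDeriv n ψ (σ p.1))) * (h p.2 * p.2 ^ (n - i))))
      (μ.prod volume) := fun n i => ((hfi n i).mul_prod (hhi (n - i))).const_mul _
  have hSint : ∫ p, S p ∂(μ.prod volume) = ∑ n ∈ Finset.range (M + 1), ∑ i ∈ Finset.range (n + 1),
        (n.choose i / n.factorial * ((∫ x, f x * (a x ^ i * iteratedDeriv n ψ (σ x)) ∂μ) *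
          ∫ s, h s * s ^ (n - i))) * (q ^ i * (-z) ^ (n - i)) := by
    rw [hS, integral_finsetSum _ fun n _ => integrable_finsetSum _ fun i _ => hterm n i]
    refine Finset.sum_congr rfl fun n _ => ?_
    rw [integral_finsetSum _ fun i _ => hterm n i]
    refine Finset.sum_congr rfl fun i _ => ?_
    rw [integral_const_mul, integral_prod_mul (fun x => f x * (a x ^ i * iteratedDeriv n ψ (σ x)))
      fun s => h s * s ^ (n - i)]
    ring
  have hSi : Integrable S (μ.prod volume) :=
    integrable_finsetSum _ fun n _ => integrable_finsetSum _ fun i _ => hterm n i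
  have hSeq : ∀ p, S p = f p.1 * h p.2 * ∑ n ∈ Finset.range (M + 1),
      iteratedDeriv n ψ (σ p.1) * (q * a p.1 - z * p.2) ^ n / n.factorial := by
    intro p
    rw [hS, Finset.mul_sum]
    refine Finset.sum_congr rfl fun n _ => ?_
    rw [sub_eq_add_neg, add_pow, Finset.mul_sum, Finset.sum_div, Finset.mul_sum]
    refine Finset.sum_congr rfl fun i _ => ?_
    rw [mul_pow, ← neg_mul, mul_pow]
    ring
  have hδ : ∀ p : Ω × ℝ, f p.1 * h p.2 ≠ 0 → |q * a p.1 - z * p.2| ≤ 4 * B * |t| := by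
    intro p hp
    have h1 := haB _ (left_ne_zero_of_mul hp)
    have h2 := hhB _ (right_ne_zero_of_mul hp)
    calc |q * a p.1 - z * p.2| ≤ |q| * |a p.1| + |z| * |p.2| := by
          rw [← abs_mul, ← abs_mul]; exact abs_sub _ _
      _ ≤ 2 * |t| * B + 2 * |t| * B := by gcongr
      _ = 4 * B * |t| := by ring
  have hbound : ∀ p : Ω × ℝ, ‖f p.1 * h p.2 * ψ (σ p.1 + (q * a p.1 - z * p.2)) - S p‖
      ≤ ‖f p.1 * h p.2‖ * (C * (4 * B) ^ (M + 1) * |t| ^ (M + 1)) := by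
    intro p
    rw [hSeq, ← mul_sub, norm_mul]
    by_cases hp : f p.1 * h p.2 = 0
    · simp [hp]
    have h1 := hδ p hp
    have h2 := hC (σ p.1) (q * a p.1 - z * p.2) (hσB _ (left_ne_zero_of_mul hp))
      (h1.trans (mul_le_of_le_one_right (by positivity) ht))
    gcongr
    refine h2.trans ?_
    rw [mul_assoc, ← mul_pow]
    gcongr
  have hm : Integrable (fun p : Ω × ℝ => f p.1 * h p.2 * ψ (σ p.1 + (q * a p.1 - z * p.2)))
      (μ.prod volume) := by
    have hψm := hψ.continuous.measurable
    have h1 : AEStronglyMeasurable (fun p : Ω × ℝ =>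
        f p.1 * h p.2 * ψ (σ p.1 + (q * a p.1 - z * p.2))) (μ.prod volume) :=
      hfh.aestronglyMeasurable.mul (by fun_prop)
    have h2 : Integrable (fun p : Ω × ℝ => f p.1 * h p.2 * ψ (σ p.1 + (q * a p.1 - z * p.2)) - S p)
        (μ.prod volume) :=
      (hfh.norm.mul_const _).mono' (h1.sub hSi.aestronglyMeasurable) (ae_of_all _ hbound)
    exact (h2.add hSi).congr (ae_of_all _ fun p => sub_add_cancel _ _)
  have hfin := norm_integral_le_of_norm_le (hfh.norm.mul_const _) (ae_of_all _ hbound)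
  rw [integral_sub hm hSi, h0, zero_sub, norm_neg, hSint, integral_mul_const, ← mul_assoc,
    ← mul_assoc, Real.norm_eq_abs] at hfin
  simpa [mul_assoc] using hfin

/-- Along the circle near `q = z = 0`, the term with `aⁱ s^(n-i)` has order `t^(n+i)`. Terms with `i
< j` vanish by `hj`, those with `n - i < k` by the choice of `k`. Among the rest `n + i = 2i + (n -
i)` is minimal only for `i = j`, `n = j + k`, so this coefficient must vanish. -/
theorem integral_iteratedDeriv_eq_zero (hf : Integrable f μ) (ha : Measurable a) (hσ : Measurable σ)
    (haB : ∀ x, f x ≠ 0 → |a x| ≤ B) (hσB : ∀ x, f x ≠ 0 → |σ x| ≤ B) (hh : Integrable h)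
    (hhB : ∀ s, h s ≠ 0 → |s| ≤ B) (hB : 0 ≤ B) {k : ℕ} (hk : ∫ s, h s * s ^ k ≠ 0)
    (hkl : ∀ l < k, ∫ s, h s * s ^ l = 0) {ψ : ℝ → ℝ} (hψ : ContDiff ℝ ∞ ψ)
    (H : ∀ q z : ℝ, (1 - q) ^ 2 + z ^ 2 = 1 →
      ∫ p : Ω × ℝ, f p.1 * h p.2 * ψ (σ p.1 + (q * a p.1 - z * p.2)) ∂(μ.prod volume) = 0) {j : ℕ}
    (hj : ∀ i < j, ∀ χ : ℝ → ℝ, ContDiff ℝ ∞ χ → ∫ x, f x * (a x ^ i * χ (σ x)) ∂μ = 0) :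
    ∫ x, f x * (a x ^ j * iteratedDeriv (j + k) ψ (σ x)) ∂μ = 0 := by
  set M := 2 * j + k with hM
  obtain ⟨C, hC⟩ := abs_moment_expansion_le hf ha hσ haB hσB hh hhB hB hψ M
  set coef : ℕ → ℕ → ℝ := fun n i => n.choose i / n.factorial *
    ((∫ x, f x * (a x ^ i * iteratedDeriv n ψ (σ x)) ∂μ) * ∫ s, h s * s ^ (n - i)) with hcoef
  have hsmooth := contDiff_iteratedDeriv hψ
  have hc1 : ∀ n i, i < j → coef n i = 0 := fun n i hi => by
    simp only [hcoef]; rw [hj i hi _ (hsmooth n)]; simp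
  have hc2 : ∀ n i, n - i < k → coef n i = 0 := fun n i hi => by
    simp only [hcoef]; rw [hkl _ hi]; simp
  -- The rational parametrisation of the circle: `q = t² Q t`, `z = t Q t`, hence `1 - q = (1 - t²)
  -- / (1 + t²)`.
  set Q : ℝ → ℝ := fun t => 2 / (1 + t ^ 2) with hQ
  have hQc : Continuous Q := by
    have : ∀ t : ℝ, 1 + t ^ 2 ≠ 0 := fun t => by positivity
    fun_prop (disch := assumption)
  -- This is the expansion divided by `t^M`. Where the truncated subtraction `n + i - M` would be
  -- wrong, `coef n i` is zero.
  set G : ℝ → ℝ := fun t => ∑ n ∈ Finset.range (M + 1), ∑ i ∈ Finset.range (n + 1),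
    coef n i * (t ^ (n + i - M) * (Q t ^ i * (-Q t) ^ (n - i))) with hG
  have hGc : Continuous G := by fun_prop
  have hGt : ∀ t, 0 < t → t ≤ 1 → |G t| ≤ C * t := by
    intro t ht0 ht1
    have hQ0 : 0 < Q t := by positivity
    have hQ2 : Q t ≤ 2 := by
      simp only [hQ]; rw [div_le_iff₀ (by positivity)]; nlinarith [sq_nonneg t]
    have h := hC (t ^ 2 * Q t) (t * Q t) t (by rwa [abs_of_pos ht0])
      (by rw [abs_of_pos ht0, abs_of_pos (by positivity)]; nlinarith [mul_pos ht0 hQ0])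
      (by rw [abs_of_pos ht0, abs_of_pos (by positivity)]; nlinarith)
      (H _ _ (by simp only [hQ]; field_simp; ring))
    have hEq : ∑ n ∈ Finset.range (M + 1), ∑ i ∈ Finset.range (n + 1),
        coef n i * ((t ^ 2 * Q t) ^ i * (-(t * Q t)) ^ (n - i)) = t ^ M * G t := by
      rw [hG, Finset.mul_sum]
      refine Finset.sum_congr rfl fun n _ => ?_
      rw [Finset.mul_sum]
      refine Finset.sum_congr rfl fun i hi => ?_
      have hin : i ≤ n := Nat.lt_succ_iff.1 (Finset.mem_range.1 hi)
      rcases lt_or_ge i j with h1 | h1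
      · simp [hc1 n i h1]
      rcases lt_or_ge (n - i) k with h2 | h2
      · simp [hc2 n i h2]
      have h3 : t ^ (2 * i) * t ^ (n - i) = t ^ M * t ^ (n + i - M) := by
        rw [← pow_add, ← pow_add]; congr 1; omega
      rw [← mul_neg, mul_pow, mul_pow, ← pow_mul]
      linear_combination (coef n i * Q t ^ i * (-Q t) ^ (n - i)) * h3
    rw [hEq, abs_mul, abs_pow, abs_of_pos ht0, pow_succ] at h
    have h4 : t ^ M * |G t| ≤ t ^ M * (C * t) := by linarith
    exact le_of_mul_le_mul_left h4 (by positivity)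
  have hG0 : G 0 = 0 := by
    have h1 : Tendsto (fun t => |G t|) (𝓝[>] 0) (𝓝 |G 0|) :=
      (hGc.abs.tendsto 0).mono_left nhdsWithin_le_nhds
    have h2 : Tendsto (fun t => C * t) (𝓝[>] 0) (𝓝 (C * 0)) :=
      ((continuous_const.mul continuous_id).tendsto (0 : ℝ)).mono_left nhdsWithin_le_nhds
    rw [mul_zero] at h2
    have h3 : |G 0| ≤ 0 := le_of_tendsto_of_tendsto h1 h2 (by
      filter_upwards [Ioc_mem_nhdsGT one_pos] with t ht using hGt t ht.1 ht.2)
    exact abs_nonpos_iff.1 h3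
  have hGval : G 0 = coef (j + k) j * (2 ^ j * (-2) ^ k) := by
    simp only [hG]
    rw [Finset.sum_eq_single (j + k), Finset.sum_eq_single j]
    · rw [show j + k + j - M = 0 by omega, show j + k - j = k by omega]
      simp [hQ]
    · intro i hi hij
      rcases lt_or_ge i j with h1 | h1
      · simp [hc1 _ i h1]
      · rw [hc2 _ i (by have := Finset.mem_range.1 hi; omega), zero_mul]
    · intro hni
      exact absurd (Finset.mem_range.2 (by omega)) hni
    · intro n hn hnjk
      refine Finset.sum_eq_zero fun i hi => ?_
      rcases lt_or_ge i j with h1 | h1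
      · simp [hc1 n i h1]
      rcases lt_or_ge (n - i) k with h2 | h2
      · simp [hc2 n i h2]
      have := Finset.mem_range.1 hi
      rw [zero_pow (by omega)]
      simp
    · intro hni
      exact absurd (Finset.mem_range.2 (by omega)) hni
  rw [hGval] at hG0
  have hch : ((j + k).choose j : ℝ) ≠ 0 := by
    exact_mod_cast (Nat.choose_pos (by omega)).ne'
  have hfac : ((j + k).factorial : ℝ) ≠ 0 := by exact_mod_cast Nat.factorial_ne_zero _
  simp only [hcoef, show j + k - j = k by omega] at hG0
  have h2j : (2 : ℝ) ^ j * (-2) ^ k ≠ 0 := by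
    exact mul_ne_zero (pow_ne_zero _ (by norm_num)) (pow_ne_zero _ (by norm_num))
  have h3 := (mul_eq_zero.1 hG0).resolve_right h2j
  have h4 := (mul_eq_zero.1 h3).resolve_left (div_ne_zero hch hfac)
  exact (mul_eq_zero.1 h4).resolve_right hk

/-- Every `χ` that vanishes on some `[c, ∞)`, `c < s₀`, is a derivative of order `j + k` of an
admissible profile. Since `σ < s₀` strictly where `f ≠ 0`, such functions approximate any smooth `χ`
on the values that matter. -/
theorem integral_mul_pow_mul_comp_eq_zero (hf : Integrable f μ) (ha : Measurable a)
    (hσ : Measurable σ) (haB : ∀ x, f x ≠ 0 → |a x| ≤ B) (hσB : ∀ x, f x ≠ 0 → |σ x| ≤ B)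
    (hσs : ∀ x, f x ≠ 0 → σ x < s₀) (hh : Integrable h)
    (hhB : ∀ s, h s ≠ 0 → |s| ≤ B) (hB : 0 ≤ B) {k : ℕ} (hk : ∫ s, h s * s ^ k ≠ 0)
    (hkl : ∀ l < k, ∫ s, h s * s ^ l = 0)
    (H : ∀ ψ : ℝ → ℝ, ContDiff ℝ ∞ ψ → ∀ c < s₀, (∀ s, c ≤ s → ψ s = 0) →
      ∀ q z : ℝ, (1 - q) ^ 2 + z ^ 2 = 1 →
      ∫ p : Ω × ℝ, f p.1 * h p.2 * ψ (σ p.1 + (q * a p.1 - z * p.2)) ∂(μ.prod volume) = 0)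
    (j : ℕ) : ∀ χ : ℝ → ℝ, ContDiff ℝ ∞ χ → ∫ x, f x * (a x ^ j * χ (σ x)) ∂μ = 0 := by
  induction j using Nat.strong_induction_on with
  | _ j ih =>
  have hcut : ∀ χ : ℝ → ℝ, ContDiff ℝ ∞ χ → ∀ c < s₀, (∀ s, c ≤ s → χ s = 0) →
      ∫ x, f x * (a x ^ j * χ (σ x)) ∂μ = 0 := by
    intro χ hχ c hc hχc
    obtain ⟨ψ, hψ, hψc, hψn⟩ := exists_iteratedDeriv_eq (j + k) hχ hχc
    rw [← hψn]
    exact integral_iteratedDeriv_eq_zero hf ha hσ haB hσB hh hhB hB hk hkl hψ (H ψ hψ c hc hψc) ih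
  intro χ hχ
  -- The factor is `0` for `s₀ - s ≤ 1/(n+1)` and `1` for `s₀ - s ≥ 2/(n+1)`.
  set χn : ℕ → ℝ → ℝ := fun n s => χ s * Real.smoothTransition ((n + 1) * (s₀ - s) - 1) with hχn
  have hsm : ∀ n, ContDiff ℝ ∞ (χn n) := fun n =>
    hχ.mul ((Real.smoothTransition.contDiff (n := ⊤)).comp
      (by fun_prop : ContDiff ℝ ∞ fun s : ℝ => ((n : ℝ) + 1) * (s₀ - s) - 1))
  have hz : ∀ n, ∫ x, f x * (a x ^ j * χn n (σ x)) ∂μ = 0 := by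
    intro n
    have hn : (0 : ℝ) < n + 1 := by positivity
    refine hcut _ (hsm n) (s₀ - 1 / (n + 1)) (by have : (0 : ℝ) < 1 / (n + 1) := by positivity
                                                 linarith) fun s hs => ?_
    simp only [hχn]
    rw [Real.smoothTransition.zero_of_nonpos, mul_zero]
    have h1 : s₀ - s ≤ 1 / (n + 1) := by linarith
    rw [le_div_iff₀ hn] at h1
    linarith
  have hlim : Tendsto (fun n => ∫ x, f x * (a x ^ j * χn n (σ x)) ∂μ) atTop
      (𝓝 (∫ x, f x * (a x ^ j * χ (σ x)) ∂μ)) := by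
    refine tendsto_integral_of_dominated_convergence
      (fun x => ‖f x * (a x ^ j * χ (σ x))‖) (fun n => ?_) ?_ (fun n => ?_) ?_
    · exact (integrable_mul_pow_mul_comp hf ha hσ haB hσB (hsm n).continuous j).aestronglyMeasurable
    · exact (integrable_mul_pow_mul_comp hf ha hσ haB hσB hχ.continuous j).norm
    · refine ae_of_all _ fun x => ?_
      simp only [hχn, ← mul_assoc]
      rw [norm_mul _ (Real.smoothTransition _), Real.norm_of_nonneg (Real.smoothTransition.nonneg _)]
      exact mul_le_of_le_one_right (norm_nonneg _) (Real.smoothTransition.le_one _)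
    · refine ae_of_all _ fun x => ?_
      by_cases hx : f x = 0
      · simp [hx]
      refine tendsto_const_nhds.congr' ?_
      have hd : 0 < s₀ - σ x := by have := hσs x hx; linarith
      obtain ⟨N, hN⟩ := exists_nat_gt (2 / (s₀ - σ x))
      filter_upwards [eventually_ge_atTop N] with n hn
      simp only [hχn]
      rw [Real.smoothTransition.one_of_one_le, mul_one]
      have h1 : 2 < N * (s₀ - σ x) := by rwa [div_lt_iff₀ hd] at hN
      have h2 : (N : ℝ) ≤ n := by exact_mod_cast hn
      nlinarith
  simp only [hz] at hlim
  exact (tendsto_nhds_unique hlim tendsto_const_nhds)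

end Moments

/-! ### From moments to Fourier transforms -/

/-- Expand the exponential. As `a` is bounded where `f ≠ 0`, the integrals of the norms are
dominated by an exponential series, so sum and integral may be exchanged. -/
theorem integral_mul_cexp_eq_zero_of_moments {Ω : Type*} [MeasurableSpace Ω] {μ : Measure Ω}
    {f a : Ω → ℝ} {w : Ω → ℂ} {B : ℝ} (hf : Integrable f μ) (ha : Measurable a) (hw : Measurable w)
    (haB : ∀ x, f x ≠ 0 → |a x| ≤ B) (hw1 : ∀ x, ‖w x‖ ≤ 1)
    (H : ∀ j : ℕ, ∫ x, (f x : ℂ) * (a x ^ j * w x) ∂μ = 0) (β : ℝ) :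
    ∫ x, (f x : ℂ) * (Complex.exp (β * a x * Complex.I) * w x) ∂μ = 0 := by
  set G : ℕ → Ω → ℂ := fun j x =>
    (β * Complex.I) ^ j / j.factorial * ((f x : ℂ) * (a x ^ j * w x)) with hG
  have hfac : ∀ j : ℕ, ‖(j.factorial : ℂ)‖ = j.factorial := fun j => by simp
  have hbound : ∀ j x, ‖G j x‖ ≤ ‖f x‖ * ((|β| * B) ^ j / j.factorial) := by
    intro j x
    by_cases hx : f x = 0
    · simp [hG, hx]
    have h1 := haB x hx
    have h2 := hw1 x
    have hB : 0 ≤ B := (abs_nonneg _).trans h1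
    calc ‖G j x‖ = ‖f x‖ * (|β| ^ j * |a x| ^ j / j.factorial) * ‖w x‖ := by
          simp only [hG, norm_mul, norm_div, norm_pow, hfac, Complex.norm_real, Complex.norm_I,
            Real.norm_eq_abs]
          ring
      _ ≤ ‖f x‖ * (|β| ^ j * B ^ j / j.factorial) * 1 := by gcongr
      _ = _ := by rw [mul_one, mul_pow]
  have hGi : ∀ j, Integrable (G j) μ := fun j =>
    (hf.norm.mul_const _).mono' (((hf.aestronglyMeasurable.aemeasurable.complex_ofReal.mul
      (by fun_prop)).const_mul _).aestronglyMeasurable) (ae_of_all _ (hbound j))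
  have hsum := hasSum_integral_of_summable_integral_norm hGi (by
    refine Summable.of_nonneg_of_le (fun j => integral_nonneg fun x => norm_nonneg _)
      (fun j => ?_) ((Real.summable_pow_div_factorial (|β| * B)).mul_left (∫ x, ‖f x‖ ∂μ))
    rw [← integral_mul_const]
    exact integral_mono (hGi j).norm (hf.norm.mul_const _) (hbound j))
  have hterm : ∀ j, ∫ x, G j x ∂μ = 0 := fun j => by
    simp only [hG]; rw [integral_const_mul, H, mul_zero]
  simp only [hterm] at hsum
  rw [← hsum.unique hasSum_zero]
  refine integral_congr_ae (ae_of_all _ fun x => ?_)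
  have h1 := NormedSpace.expSeries_div_hasSum_exp (β * a x * Complex.I)
  rw [← Complex.exp_eq_exp_ℂ] at h1
  have h2 := (h1.mul_right (w x)).mul_left (f x : ℂ)
  simp only
  rw [← h2.tsum_eq]
  refine tsum_congr fun j => ?_
  simp only [hG]
  ring

/-- The positive and negative parts of `f` are densities of finite measures with equal
characteristic functions; the measures agree, hence so do the densities. -/
theorem ae_eq_zero_of_integral_cexp_eq_zero {V : Type*} [NormedAddCommGroup V] [NormedSpace ℝ V]
    [MeasurableSpace V] [BorelSpace V] [SecondCountableTopology V] [CompleteSpace V]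
    {m : Measure V} {f : V → ℝ} (hf : Integrable f m)
    (H : ∀ L : StrongDual ℝ V, ∫ v, (f v : ℂ) * Complex.exp (L v * Complex.I) ∂m = 0) :
    f =ᵐ[m] 0 := by
  have hfm := hf.aestronglyMeasurable.aemeasurable
  have := isFiniteMeasure_withDensity_ofReal hf.2
  have := isFiniteMeasure_withDensity_ofReal hf.neg.2
  have hnorm : ∀ (L : StrongDual ℝ V) v, ‖Complex.exp (L v * Complex.I)‖ ≤ 1 := fun L v =>
    (Complex.norm_exp_ofReal_mul_I _).le
  have hpart : ∀ (L : StrongDual ℝ V) {g : V → ℝ}, Integrable g m →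
      Integrable (fun v => (g v : ℂ) * Complex.exp (L v * Complex.I)) m := fun L g hg =>
    hg.ofReal.mul_bdd (c := 1) (Continuous.aestronglyMeasurable (by fun_prop))
      (ae_of_all _ (hnorm L))
  have hchar : ∀ (L : StrongDual ℝ V) {g : V → ℝ}, AEMeasurable g m →
      charFunDual (m.withDensity fun v => ENNReal.ofReal (g v)) L
        = ∫ v, ((max (g v) 0 : ℝ) : ℂ) * Complex.exp (L v * Complex.I) ∂m := by
    intro L g hg
    rw [charFunDual_apply, integral_withDensity_eq_integral_toReal_smul₀ hg.ennreal_ofReal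
      (ae_of_all _ fun _ => ENNReal.ofReal_lt_top)]
    simp only [ENNReal.toReal_ofReal', Complex.real_smul]
  have heq : (m.withDensity fun v => ENNReal.ofReal (f v))
      = m.withDensity fun v => ENNReal.ofReal ((-f) v) := by
    refine Measure.ext_of_charFunDual (funext fun L => ?_)
    rw [hchar L hfm, hchar L hfm.neg, ← sub_eq_zero,
      ← integral_sub (hpart L hf.pos_part) (hpart L hf.neg.pos_part), ← H L]
    refine integral_congr_ae (ae_of_all _ fun v => ?_)
    simp only
    rw [← sub_mul, ← Complex.ofReal_sub, Pi.neg_apply, max_zero_sub_max_neg_zero_eq_self]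
  rw [withDensity_eq_iff hfm.ennreal_ofReal hfm.neg.ennreal_ofReal
    (by exact (hf.lintegral_lt_top).ne)] at heq
  filter_upwards [heq] with v hv
  rw [Pi.neg_apply] at hv
  rcases le_total (f v) 0 with h | h
  · rw [ENNReal.ofReal_of_nonpos h, eq_comm, ENNReal.ofReal_eq_zero] at hv
    simp only [Pi.zero_apply]; linarith
  · rw [ENNReal.ofReal_of_nonpos (neg_nonpos.2 h), ENNReal.ofReal_eq_zero] at hv
    simp only [Pi.zero_apply]; linarith

/-- If all moments vanished, the exponential series would make the Fourier transform of the
compactly supported `h` zero. -/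
theorem exists_moment_ne_zero {h : ℝ → ℝ} {B : ℝ} (hh : Integrable h)
    (hB : ∀ s, h s ≠ 0 → |s| ≤ B) (hne : ¬ h =ᵐ[volume] 0) : ∃ k : ℕ, ∫ s, h s * s ^ k ≠ 0 := by
  by_contra! hz
  refine hne (ae_eq_zero_of_integral_cexp_eq_zero hh fun L => ?_)
  have h1 := integral_mul_cexp_eq_zero_of_moments (w := fun _ => 1) hh measurable_id
    measurable_const hB (by simp) (fun j => by
      rw [← Complex.ofReal_zero, ← hz j, ← integral_complex_ofReal]
      simp) (L 1)
  rw [← h1]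
  refine integral_congr_ae (ae_of_all _ fun s => ?_)
  have h2 : L s = L 1 * s := by
    conv_lhs => rw [← mul_one s, ← smul_eq_mul, map_smul, smul_eq_mul, mul_comm]
  simp [h2]

/-- A function on `ℝ² × ℝ` that integrates to zero against all `⟪ν, y⟫ʲ χ(τ - ⟪ν, y⟫)` vanishes. -/
theorem ae_eq_zero_of_integral_inner_pow_mul_eq_zero {V : Type*} [NormedAddCommGroup V]
    [InnerProductSpace ℝ V] [FiniteDimensional ℝ V] [Nontrivial V] [MeasurableSpace V]
    [BorelSpace V] {m : Measure (V × ℝ)} {f : V × ℝ → ℝ} {B : ℝ}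
    (hf : Integrable f m) (hfB : ∀ p, f p ≠ 0 → ‖p.1‖ ≤ B ∧ |p.2| ≤ B)
    (H : ∀ ν : V, ‖ν‖ = 1 → ∀ (j : ℕ) (χ : ℝ → ℝ), ContDiff ℝ ∞ χ →
      ∫ p, f p * (inner ℝ ν p.1 ^ j * χ (p.2 - inner ℝ ν p.1)) ∂m = 0) :
    f =ᵐ[m] 0 := by
  refine ae_eq_zero_of_integral_cexp_eq_zero hf fun L => ?_
  obtain ⟨ν, b, hν, hb⟩ : ∃ (ν : V) (b : ℝ), ‖ν‖ = 1 ∧ ∀ y, L (y, 0) = b * inner ℝ ν y := by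
    set ξ := (InnerProductSpace.toDual ℝ V).symm (L.comp (.inl ℝ V ℝ)) with hξ
    have h1 : ∀ y, L (y, 0) = inner ℝ ξ y := fun y => by
      rw [hξ, InnerProductSpace.toDual_symm_apply]; simp
    by_cases h0 : ξ = 0
    · obtain ⟨ν, hν⟩ := exists_norm_eq V (zero_le_one (α := ℝ))
      exact ⟨ν, 0, hν, fun y => by rw [h1, h0, inner_zero_left, zero_mul]⟩
    · have h2 : ‖ξ‖ ≠ 0 := norm_ne_zero_iff.2 h0
      refine ⟨‖ξ‖⁻¹ • ξ, ‖ξ‖, norm_smul_inv_norm h0, fun y => ?_⟩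
      rw [h1, real_inner_smul_left, mul_inv_cancel_left₀ h2]
  set l : ℝ := L (0, 1) with hl
  -- Every linear phase is a combination of `a = ⟪ν, y⟫` and `σ = τ - a`. The exponential series
  -- handles `a`, and cosine and sine of `lσ` serve as `χ`.
  have hL : ∀ p, L p = (b + l) * inner ℝ ν p.1 + l * (p.2 - inner ℝ ν p.1) := by
    intro p
    have h1 : p = (p.1, 0) + p.2 • ((0 : V), (1 : ℝ)) := by ext <;> simp
    conv_lhs => rw [h1, map_add, map_smul, hb, ← hl, smul_eq_mul]
    ring
  have ham : Measurable fun p : V × ℝ => inner ℝ ν p.1 := by fun_prop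
  have haB : ∀ p, f p ≠ 0 → |inner ℝ ν p.1| ≤ B := fun p hp =>
    (abs_real_inner_le_norm _ _).trans (by rw [hν, one_mul]; exact (hfB p hp).1)
  have h1 := integral_mul_cexp_eq_zero_of_moments (β := b + l) hf ham
    (w := fun p => Complex.exp (((l * (p.2 - inner ℝ ν p.1) : ℝ) : ℂ) * Complex.I))
    (by fun_prop) haB (fun p => (Complex.norm_exp_ofReal_mul_I _).le) (fun j => ?_)
  · rw [← h1]
    refine integral_congr_ae (ae_of_all _ fun p => ?_)
    simp only
    rw [← Complex.exp_add, hL]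
    push_cast
    ring_nf
  · have hσB : ∀ p, f p ≠ 0 → |p.2 - inner ℝ ν p.1| ≤ B + B := fun p hp =>
      (abs_sub _ _).trans (add_le_add (hfB p hp).2 (haB p hp))
    have haB' : ∀ p, f p ≠ 0 → |inner ℝ ν p.1| ≤ B + B := fun p hp =>
      (haB p hp).trans (le_add_of_nonneg_left ((abs_nonneg _).trans (haB p hp)))
    have hσm : Measurable fun p : V × ℝ => p.2 - inner ℝ ν p.1 := by fun_prop
    have hc : ContDiff ℝ ∞ fun s : ℝ => Real.cos (l * s) := by fun_prop
    have hs : ContDiff ℝ ∞ fun s : ℝ => Real.sin (l * s) := by fun_prop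
    have ic := integrable_mul_pow_mul_comp hf ham hσm haB' hσB hc.continuous j
    have is := integrable_mul_pow_mul_comp hf ham hσm haB' hσB hs.continuous j
    have hsplit : ∀ p : V × ℝ, (f p : ℂ) * ((inner ℝ ν p.1 : ℝ) ^ j *
        Complex.exp (((l * (p.2 - inner ℝ ν p.1) : ℝ) : ℂ) * Complex.I))
        = ((f p * (inner ℝ ν p.1 ^ j * Real.cos (l * (p.2 - inner ℝ ν p.1))) : ℝ) : ℂ)
          + ((f p * (inner ℝ ν p.1 ^ j * Real.sin (l * (p.2 - inner ℝ ν p.1))) : ℝ) : ℂ)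
            * Complex.I := by
      intro p
      rw [Complex.exp_mul_I, ← Complex.ofReal_cos, ← Complex.ofReal_sin]
      push_cast
      ring
    simp only [hsplit]
    rw [integral_add ic.ofReal (is.ofReal.mul_const _), integral_mul_const,
      integral_complex_ofReal, integral_complex_ofReal, H ν hν j _ hc, H ν hν j _ hs]
    simp

/-! ### Separated sources and conclusion -/

abbrev E2 := EuclideanSpace ℝ (Fin 2)

/-- Separating the third coordinate preserves the volume. -/
theorem exists_measurePreserving_separation :
    ∃ e : E3 × ℝ ≃ᵐ (E2 × ℝ) × ℝ, MeasurePreserving e volume (volume.prod volume) ∧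
      ∀ p, e p = ((!₂[p.1 0, p.1 1], p.2), p.1 2) := by
  let A : E3 ≃ᵐ (Fin 3 → ℝ) := (MeasurableEquiv.toLp 2 (Fin 3 → ℝ)).symm
  let B : (Fin 3 → ℝ) ≃ᵐ ℝ × (Fin 2 → ℝ) := MeasurableEquiv.piFinSuccAbove (fun _ => ℝ) 2
  let D : (Fin 2 → ℝ) ≃ᵐ E2 := MeasurableEquiv.toLp 2 (Fin 2 → ℝ)
  have hA : MeasurePreserving A := EuclideanSpace.volume_preserving_symm_measurableEquiv_toLp _
  have hB : MeasurePreserving B := volume_preserving_piFinSuccAbove (fun _ : Fin 3 => ℝ) 2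
  have hD : MeasurePreserving D := PiLp.volume_preserving_toLp (Fin 2)
  let G : E3 ≃ᵐ ℝ × E2 := (A.trans B).trans ((MeasurableEquiv.refl ℝ).prodCongr D)
  have hG : MeasurePreserving G :=
    ((MeasurePreserving.id (volume : Measure ℝ)).prod hD).comp (hB.comp hA)
  refine ⟨((G.prodCongr (MeasurableEquiv.refl ℝ)).trans MeasurableEquiv.prodAssoc).trans
    MeasurableEquiv.prodComm, ?_, fun p => ?_⟩
  · exact Measure.measurePreserving_swap.comp ((measurePreserving_prodAssoc _ _ _).comp
      (hG.prod (MeasurePreserving.id (volume : Measure ℝ))))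
  · refine Prod.ext (Prod.ext ?_ rfl) rfl
    ext i
    fin_cases i <;> rfl

theorem integrable_separatedSource {f : E2 × ℝ → ℝ} {h : ℝ → ℝ} (hf : Integrable f)
    (hh : Integrable h) : Integrable (separatedSource f h) := by
  obtain ⟨e, he, hep⟩ := exists_measurePreserving_separation
  have hFe : separatedSource f h = (fun p : (E2 × ℝ) × ℝ => f p.1 * h p.2) ∘ e := by
    funext p; simp [separatedSource, hep]
  rw [hFe]
  exact (he.integrable_comp_emb e.measurableEmbedding).2 (hf.mul_prod hh)

theorem waveOperator_eq_zero_of_notMem_tsupport {φ : E3 × ℝ → ℝ} (hφ : ContDiff ℝ ∞ φ)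
    {p : E3 × ℝ} (hp : p ∉ tsupport φ) : waveOperator φ p = 0 := by
  have h0 : waveOperator (fun _ : E3 × ℝ => (0 : ℝ)) p = 0 := by
    rw [waveOperator_eq contDiff_const]
    simp [secondDeriv]
  rw [← h0]
  exact waveOperator_congr hφ contDiff_const (notMem_tsupport_iff_eventuallyEq.1 hp)

theorem IsWeakWaveSolution.integrableOn_mul_waveOperator {F u : E3 × ℝ → ℝ}
    (hu : IsWeakWaveSolution F u) {φ : E3 × ℝ → ℝ} (hφ : ContDiff ℝ ∞ φ)
    (hφc : HasCompactSupport φ) :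
    IntegrableOn (fun p => u p * waveOperator φ p) (univ ×ˢ Ioi (0 : ℝ)) := by
  have hcont : Continuous (waveOperator φ) := (waveOperator_contDiff hφ).continuous
  have hS : IsClosed (univ ×ˢ Ici (0 : ℝ) : Set (E3 × ℝ)) := isClosed_univ.prod isClosed_Ici
  have hK : IsCompact ((univ ×ˢ Ici (0 : ℝ)) ∩ tsupport φ) := hφc.isCompact.inter_left hS
  have h1 : IntegrableOn (fun p => u p * waveOperator φ p)
      ((univ ×ˢ Ici (0 : ℝ)) ∩ tsupport φ) :=
    (hu.1.integrableOn_compact_subset inter_subset_left hK).mul_continuousOn hcont.continuousOn hK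
  have h2 : IntegrableOn (fun p => u p * waveOperator φ p) (univ ×ˢ Ici (0 : ℝ)) :=
    h1.of_forall_sdiff_eq_zero hS.measurableSet fun p hp => by
      rw [waveOperator_eq_zero_of_notMem_tsupport hφ fun h => hp.2 ⟨hp.1, h⟩, mul_zero]
  exact h2.mono_set (prod_mono_right Ioi_subset_Ici_self)

theorem IsWeakWaveSolution.sub {F₁ F₂ u₁ u₂ : E3 × ℝ → ℝ} (h₁ : IsWeakWaveSolution F₁ u₁)
    (h₂ : IsWeakWaveSolution F₂ u₂) (hF₁ : Integrable F₁) (hF₂ : Integrable F₂) :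
    IsWeakWaveSolution (fun p => F₁ p - F₂ p) (fun p => u₁ p - u₂ p) := by
  refine ⟨h₁.1.sub h₂.1, fun φ hφ hφc => ?_⟩
  obtain ⟨C, hC⟩ := hφc.exists_bound_of_continuous hφ.continuous
  have hF : ∀ {F : E3 × ℝ → ℝ}, Integrable F →
      IntegrableOn (fun p => F p * φ p) (univ ×ˢ Ioi (0 : ℝ)) := fun hF =>
    (hF.mul_bdd hφ.continuous.aestronglyMeasurable (ae_of_all _ hC)).integrableOn
  simp only [sub_mul]
  rw [integral_sub (h₁.integrableOn_mul_waveOperator hφ hφc)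
    (h₂.integrableOn_mul_waveOperator hφ hφc), integral_sub (hF hF₁) (hF hF₂), h₁.2 φ hφ hφc,
    h₂.2 φ hφ hφc]

/-- Two functions with the same trace differ by a function with zero trace. -/
theorem tendsto_lintegral_shell_sub {R T : ℝ} {u₁ u₂ g : E3 × ℝ → ℝ}
    (hu : LocallyIntegrableOn u₁ (univ ×ˢ Ici (0 : ℝ)))
    (hg₁ : HasSphereTrace R T u₁ g) (hg₂ : HasSphereTrace R T u₂ g) :
    Tendsto (fun ε : ℝ => (ENNReal.ofReal ε)⁻¹ * ∫⁻ p in sphericalShell R T ε, ‖u₁ p - u₂ p‖ₑ)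
      (𝓝[>] 0) (𝓝 0) := by
  have hgm := hg₁.1
  have hle : ∀ ε : ℝ, (ENNReal.ofReal ε)⁻¹ * ∫⁻ p in sphericalShell R T ε, ‖u₁ p - u₂ p‖ₑ
      ≤ (ENNReal.ofReal ε)⁻¹ * (∫⁻ p in sphericalShell R T ε,
          ‖u₁ p - g ((R / ‖p.1‖) • p.1, p.2)‖ₑ)
        + (ENNReal.ofReal ε)⁻¹ * ∫⁻ p in sphericalShell R T ε,
          ‖u₂ p - g ((R / ‖p.1‖) • p.1, p.2)‖ₑ := by
    intro ε
    have hsub : sphericalShell R T ε ⊆ univ ×ˢ Ici (0 : ℝ) := fun p hp =>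
      ⟨mem_univ _, (hp.2.1 : (0 : ℝ) < p.2).le⟩
    have hu' : AEStronglyMeasurable u₁ (volume.restrict (sphericalShell R T ε)) :=
      hu.aestronglyMeasurable.mono_measure (Measure.restrict_mono hsub le_rfl)
    have hgm' : Measurable fun p : E3 × ℝ => g ((R / ‖p.1‖) • p.1, p.2) :=
      hgm.comp (by fun_prop)
    have hd : AEStronglyMeasurable (fun p : E3 × ℝ => u₁ p - g ((R / ‖p.1‖) • p.1, p.2))
        (volume.restrict (sphericalShell R T ε)) := hu'.sub hgm'.aestronglyMeasurable
    rw [← mul_add, ← lintegral_add_left' hd.enorm]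
    gcongr with p
    rw [← sub_sub_sub_cancel_right (u₁ p) (u₂ p) (g ((R / ‖p.1‖) • p.1, p.2))]
    exact enorm_sub_le
  have hsum := hg₁.2.add hg₂.2
  rw [add_zero] at hsum
  exact tendsto_of_tendsto_of_tendsto_of_le_of_le tendsto_const_nhds hsum (fun _ => zero_le) hle

/-- A separated source is orthogonal to all plane waves of the variables `(y, τ, s)`, if its wave has
zero trace on the sphere. -/
theorem integral_separated_plane_wave_eq_zero {R R₀ T₀ T : ℝ} (hR₀ : 0 < R₀)
    (hR : R₀ < R / Real.sqrt 2) (hT : T₀ + R + R₀ ≤ T) {h : ℝ → ℝ} (hh : Integrable h)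
    (hhs : ∀ s, h s ≠ 0 → |s| ≤ R₀) {f : E2 × ℝ → ℝ} (hf : Integrable f)
    (hfs : ∀ p, f p ≠ 0 → ‖p.1‖ < R₀ ∧ p.2 ∈ Icc 0 T₀) {u : E3 × ℝ → ℝ}
    (hu : IsWeakWaveSolution (separatedSource f h) u)
    (htr : Tendsto (fun ε : ℝ => (ENNReal.ofReal ε)⁻¹ * ∫⁻ p in sphericalShell R T ε, ‖u p‖ₑ)
      (𝓝[>] 0) (𝓝 0)) {ψ : ℝ → ℝ} (hψ : ContDiff ℝ ∞ ψ) {c : ℝ} (hc : c < T₀ + R₀)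
    (hψc : ∀ s, c ≤ s → ψ s = 0) {ν : E2} (hν : ‖ν‖ = 1) {q z : ℝ}
    (hqz : (1 - q) ^ 2 + z ^ 2 = 1) :
    ∫ p : (E2 × ℝ) × ℝ, f p.1 * h p.2 * ψ (p.1.2 - inner ℝ ν p.1.1
      + (q * inner ℝ ν p.1.1 - z * p.2)) ∂(volume.prod volume) = 0 := by
  obtain ⟨e, he, hep⟩ := exists_measurePreserving_separation
  have hF := integrable_separatedSource hf hh
  have h2 : Real.sqrt 2 ^ 2 = 2 := Real.sq_sqrt (by norm_num)
  have hs2 : 0 < Real.sqrt 2 := by positivity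
  -- The source lies in a cylinder of radius and half-height `R₀`, hence in the ball of radius `√2
  -- R₀`; this is where `R₀ < R/√2` enters.
  have hρ : Real.sqrt 2 * R₀ < R := by rwa [lt_div_iff₀ hs2, mul_comm] at hR
  have hFs : ∀ p, separatedSource f h p ≠ 0 → ‖p.1‖ ≤ Real.sqrt 2 * R₀ ∧ p.2 ∈ Icc 0 T₀ := by
    intro p hp
    obtain ⟨h3, h4⟩ := hfs _ (left_ne_zero_of_mul hp)
    have h5 := hhs _ (right_ne_zero_of_mul hp)
    refine ⟨abs_le_of_sq_le_sq' ?_ (by positivity) |>.2, h4⟩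
    have h6 : ‖(!₂[p.1 0, p.1 1] : E2)‖ ^ 2 ≤ R₀ ^ 2 := by gcongr
    have h7 : p.1 2 ^ 2 ≤ R₀ ^ 2 := sq_le_sq.2 (h5.trans (le_abs_self _))
    rw [EuclideanSpace.real_norm_sq_eq] at h6 ⊢
    rw [mul_pow, h2]
    simp only [Fin.sum_univ_two, Fin.sum_univ_three] at h6 ⊢
    simp at h6
    linarith
  -- The tilted direction is a unit vector because `(1 - q)² + z² = 1`, and its phase is `σ + q a -
  -- z s`.
  set n : E3 := !₂[(1 - q) * ν 0, (1 - q) * ν 1, z] with hn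
  have hn1 : ‖n‖ = 1 := by
    have h3 : ‖ν‖ ^ 2 = 1 := by rw [hν, one_pow]
    rw [← sq_eq_sq₀ (norm_nonneg _) zero_le_one, one_pow]
    rw [EuclideanSpace.real_norm_sq_eq] at h3 ⊢
    simp only [Fin.sum_univ_two, Fin.sum_univ_three] at h3 ⊢
    simp [hn]
    linear_combination (1 - q) ^ 2 * h3 + hqz
  have hmain := integral_mul_plane_wave_eq_zero (ψ := ψ) (c := c) hu hF
    (K := Metric.closedBall 0 (Real.sqrt 2 * R₀) ×ˢ Icc 0 T₀)
    ((isCompact_closedBall _ _).prod isCompact_Icc)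
    (fun p hp => ⟨mem_closedBall_zero_iff.2 (hFs p hp).1, (hFs p hp).2⟩)
    (fun p hp => (hFs p hp).2.1) (fun p hp => (hFs p hp).1)
    ((by positivity : 0 < Real.sqrt 2 * R₀).trans hρ) hρ hψ hψc (by linarith) htr hn1
  rw [← hmain, ← he.integral_comp e.measurableEmbedding]
  refine integral_congr_ae (ae_of_all _ fun p => ?_)
  simp only [hep, separatedSource]
  congr 2
  simp only [PiLp.inner_apply, Fin.sum_univ_two, Fin.sum_univ_three, hn]
  simp
  ring

theorem mainTheorem5 (R R₀ T₀ T : ℝ) (hR₀ : 0 < R₀) (hR : R₀ < R / Real.sqrt 2) (hT₀ : 0 < T₀)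
    (hT : T₀ + R + R₀ ≤ T)
    (h : ℝ → ℝ) (h_int : Integrable h) (h_supp : Function.support h ⊆ Ioo (-R₀) R₀)
    (h_ne : ¬ h =ᵐ[volume] 0)
    (f₁ f₂ : EuclideanSpace ℝ (Fin 2) × ℝ → ℝ)
    (f₁_int : Integrable f₁) (f₂_int : Integrable f₂)
    (f₁_supp : Function.support f₁ ⊆ Metric.ball 0 R₀ ×ˢ Icc 0 T₀)
    (f₂_supp : Function.support f₂ ⊆ Metric.ball 0 R₀ ×ˢ Icc 0 T₀)
    (u₁ u₂ : EuclideanSpace ℝ (Fin 3) × ℝ → ℝ)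
    (hu₁ : IsWeakWaveSolution (separatedSource f₁ h) u₁)
    (hu₂ : IsWeakWaveSolution (separatedSource f₂ h) u₂)
    (g : EuclideanSpace ℝ (Fin 3) × ℝ → ℝ)
    (hg₁ : HasSphereTrace R T u₁ g) (hg₂ : HasSphereTrace R T u₂ g) :
    f₁ =ᵐ[volume] f₂ := by
  classical
  have hhs : ∀ s, h s ≠ 0 → |s| ≤ R₀ := fun s hs =>
    abs_le.2 ⟨(h_supp hs).1.le, (h_supp hs).2.le⟩
  have hfs : ∀ p, (f₁ - f₂) p ≠ 0 → ‖p.1‖ < R₀ ∧ p.2 ∈ Icc 0 T₀ := by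
    intro p hp
    have h1 : p ∈ Metric.ball (0 : E2) R₀ ×ˢ Icc 0 T₀ := by
      by_contra hcon
      have h2 : f₁ p = 0 := by_contra fun h0 => hcon (f₁_supp h0)
      have h3 : f₂ p = 0 := by_contra fun h0 => hcon (f₂_supp h0)
      simp [h2, h3] at hp
    exact ⟨mem_ball_zero_iff.1 h1.1, h1.2⟩
  have hf : Integrable (f₁ - f₂) := f₁_int.sub f₂_int
  have hu : IsWeakWaveSolution (separatedSource (f₁ - f₂) h) fun p => u₁ p - u₂ p := by
    have h1 := hu₁.sub hu₂ (integrable_separatedSource f₁_int h_int)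
      (integrable_separatedSource f₂_int h_int)
    convert h1 using 2 with p
    simp [separatedSource, sub_mul]
  have htr := tendsto_lintegral_shell_sub hu₁.1 hg₁ hg₂
  have hmom := exists_moment_ne_zero h_int hhs h_ne
  have hk := Nat.find_spec hmom
  have hkl : ∀ l < Nat.find hmom, ∫ s, h s * s ^ l = 0 := fun l hl =>
    not_not.1 (Nat.find_min hmom hl)
  have hin : ∀ ν : E2, ‖ν‖ = 1 → ∀ p, (f₁ - f₂) p ≠ 0 → |inner ℝ ν p.1| < R₀ := fun ν hν p hp =>
    (abs_real_inner_le_norm _ _).trans_lt (by rw [hν, one_mul]; exact (hfs p hp).1)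
  have hzero : f₁ - f₂ =ᵐ[volume] 0 := by
    refine ae_eq_zero_of_integral_inner_pow_mul_eq_zero (B := T₀ + R₀) hf (fun p hp => ?_)
      fun ν hν j => ?_
    · obtain ⟨h1, h2⟩ := hfs p hp
      exact ⟨by linarith, by rw [abs_of_nonneg h2.1]; linarith [h2.2]⟩
    -- The value `s₀ = T₀ + R₀` serves both sides: `τ - ⟪ν, y⟫ < T₀ + R₀` on the support of `f₁ -
    -- f₂`, strictly since the disc is open, and `T₀ + R₀ ≤ T - R` admits every `c < s₀`.
    · refine integral_mul_pow_mul_comp_eq_zero (B := T₀ + R₀) (s₀ := T₀ + R₀)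
        (a := fun p => inner ℝ ν p.1) (σ := fun p => p.2 - inner ℝ ν p.1) hf (by fun_prop) (by fun_prop)
        (fun p hp => by linarith [hin ν hν p hp]) (fun p hp => ?_) (fun p hp => ?_) h_int
        (fun s hs => by linarith [hhs s hs]) (by linarith) hk hkl
        (fun ψ hψ c hc hψc q z hqz => integral_separated_plane_wave_eq_zero hR₀ hR hT h_int hhs hf
          hfs hu htr hψ hc hψc hν hqz) j
      · have h1 := abs_lt.1 (hin ν hν p hp)
        have h2 := (hfs p hp).2
        exact abs_le.2 ⟨by linarith [h2.1], by linarith [h2.2]⟩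
      · have h1 := abs_lt.1 (hin ν hν p hp)
        have h2 := (hfs p hp).2
        linarith [h2.2]
  filter_upwards [hzero] with p hp
  exact sub_eq_zero.1 hp
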